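/- **Theorem 5.1.** Let $E\subset\mathbb R$ be a bounded homogeneous set, that is, a bounded measurable set for which there is an $\eta>0$ with $$|(x-\delta,x+\delta)\cap E|\ge\eta\,\delta\qquad\text{for all } x\in E,\ 0<\delta<1 .$$ Let $W$ be an $n\times n$ matrix weight on $E$, that is, a measurable function on $E$ with values in the complex $n\times n$ matrices which is positive definite almost everywhere on $E$. Let $P_+$ be the orthogonal projection of $L^2(\mathbb R;\mathbb C^n)$ onto the Hardy space $H^2(\mathbb C^n)$ of the upper half-plane (identified with the space of its boundary functions), and let $\chi_E L^2(\mathbb C^n)$ be the space of those $f\in L^2(\mathbb R;\mathbb C^n)$ that vanish almost everywhere off $E$. For $x\in E$ and $0<\delta<1$ put $I=I_{(x,\delta)}=(x-\delta,x+\delta)$ and $$\langle W\rangle_{I}=\frac1{|I|}\int_{I\cap E}W(t)\,dt,\qquad \langle W^{-1}\rangle_{I}=\frac1{|I|}\int_{I\cap E}W(t)^{-1}\,dt,$$ $$Q_{2,E}(W)=\sup_{x\in E,\ 0<\delta<1}\left\|\langle W\rangle_{I_{(x,\delta)}}^{1/2}\,\langle W^{-1}\rangle_{I_{(x,\delta)}}^{1/2}\right\|,$$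 where $\|\cdot\|$ is the operator norm on $\mathbb C^n$ and $Q_{2,E}(W)=\infty$ if $W$ or $W^{-1}$ fails to be integrable on some $I_{(x,\delta)}\cap E$. Then the operator $$f\mapsto \chi_E W^{1/2}P_+\bigl(W^{-1/2}f\bigr),$$ defined on the dense subspace of all $f\in\chi_E L^2(\mathbb C^n)$ with $W^{-1/2}f\in L^2(\mathbb R;\mathbb C^n)$, is bounded as an operator into $\chi_E L^2(\mathbb C^n)$ (that is, there is a finite constant $C$ with $\|\chi_E W^{1/2}P_+W^{-1/2}f\|\le C\|f\|$ for all such $f$) if and only if $Q_{2,E}(W)<\infty$. -/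

import Mathlib

open MeasureTheory Set Filter Topology
open scoped ENNReal NNReal ComplexOrder MatrixOrder Matrix.Norms.L2Operator

noncomputable section

namespace MatrixA2

/-- `L²(ℝ; ℂⁿ)` with respect to Lebesgue measure. -/
abbrev L2 (n : ℕ) : Type := Lp (EuclideanSpace ℂ (Fin n)) 2 (volume : Measure ℝ)

/-- `F` belongs to the Hardy space `H²` of `ℂⁿ`-valued functions in the upper half-plane and the
function `f` on the real line is its boundary function (the `L²`-limit of the functions
`F (· + i y)` as `y → 0+`). -/
structure IsHardyBoundary {n : ℕ} (F : ℂ → EuclideanSpace ℂ (Fin n))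
    (f : ℝ → EuclideanSpace ℂ (Fin n)) : Prop where
  holo : DifferentiableOn ℂ F {z : ℂ | 0 < z.im}
  bdd : ∃ M : ℝ≥0, ∀ y : ℝ, 0 < y →
    eLpNorm (fun x : ℝ => F (x + y * Complex.I)) 2 volume ≤ M
  lim : Tendsto (fun y : ℝ => eLpNorm (fun x : ℝ => F (x + y * Complex.I) - f x) 2 volume)
    (𝓝[>] 0) (𝓝 0)

theorem aesm_line {n : ℕ} {F : ℂ → EuclideanSpace ℂ (Fin n)}
    (h : DifferentiableOn ℂ F {z : ℂ | 0 < z.im}) {y : ℝ} (hy : 0 < y) :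
    AEStronglyMeasurable (fun x : ℝ => F (x + y * Complex.I)) volume := by
  apply Continuous.aestronglyMeasurable
  refine h.continuousOn.comp_continuous (by fun_prop) ?_
  intro x
  simpa using hy

/-- The Hardy space `H²(ℂⁿ)` of the upper half-plane, as a subspace of `L²(ℝ; ℂⁿ)`. -/
def hardy (n : ℕ) : Submodule ℂ (L2 n) where
  carrier := {f | ∃ F : ℂ → EuclideanSpace ℂ (Fin n), IsHardyBoundary F f}
  zero_mem' := by
    refine ⟨0, ?_, ⟨0, ?_⟩, ?_⟩
    · exact differentiableOn_const _
    · intro y _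
      simp
    · have h : ∀ y : ℝ, eLpNorm (fun x : ℝ => (0 : ℂ → EuclideanSpace ℂ (Fin n))
          (x + y * Complex.I) - (0 : L2 n) x) 2 volume = 0 := by
        intro y
        rw [eLpNorm_congr_ae (g := 0)]
        · simp
        · filter_upwards [Lp.coeFn_zero (EuclideanSpace ℂ (Fin n)) 2 (volume : Measure ℝ)]
            with x hx
          simp
      simp only [h]
      exact tendsto_const_nhds
  add_mem' := by
    rintro f g ⟨F, hF, ⟨M, hM⟩, hFl⟩ ⟨G, hG, ⟨N, hN⟩, hGl⟩
    refine ⟨F + G, hF.add hG, ⟨M + N, ?_⟩, ?_⟩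
    · intro y hy
      refine (eLpNorm_add_le (aesm_line hF hy) (aesm_line hG hy) (by norm_num)).trans ?_
      push_cast
      exact add_le_add (hM y hy) (hN y hy)
    · have h0 := hFl.add hGl
      rw [add_zero] at h0
      refine tendsto_of_tendsto_of_tendsto_of_le_of_le' tendsto_const_nhds h0
        (Eventually.of_forall fun _ => zero_le) ?_
      filter_upwards [self_mem_nhdsWithin] with y hy
      refine le_trans (le_of_eq ?_) (eLpNorm_add_le
        ((aesm_line hF hy).sub (Lp.aestronglyMeasurable f))
        ((aesm_line hG hy).sub (Lp.aestronglyMeasurable g)) (by norm_num))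
      apply eLpNorm_congr_ae
      filter_upwards [Lp.coeFn_add f g] with x hx
      simp only [hx, Pi.add_apply]
      abel
  smul_mem' := by
    rintro c f ⟨F, hF, ⟨M, hM⟩, hFl⟩
    refine ⟨c • F, hF.const_smul c, ⟨‖c‖₊ * M, ?_⟩, ?_⟩
    · intro y hy
      refine (eLpNorm_const_smul_le (c := c) (f := fun x : ℝ => F (x + y * Complex.I))).trans ?_
      push_cast
      exact mul_le_mul_right (hM y hy) _
    · have h0 := ENNReal.Tendsto.const_mul (a := (‖c‖ₑ : ℝ≥0∞)) hFl (Or.inr enorm_ne_top)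
      rw [mul_zero] at h0
      refine tendsto_of_tendsto_of_tendsto_of_le_of_le tendsto_const_nhds h0
        (fun _ => zero_le) ?_
      intro y
      refine le_trans (le_of_eq ?_) (eLpNorm_const_smul_le (c := c)
        (f := fun x : ℝ => F (x + y * Complex.I) - f x))
      apply eLpNorm_congr_ae
      filter_upwards [Lp.coeFn_smul c f] with x hx
      simp only [hx, Pi.smul_apply, smul_sub]

/-- The Riesz projection `P₊`: the orthogonal projection of `L²(ℝ; ℂⁿ)` onto `H²(ℂⁿ)`.
The Hardy space is closed in `L²`, so passing to the closure does not change it; the closure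
is written only because the projection onto it is available without further proof. -/
def rieszProj (n : ℕ) : L2 n →L[ℂ] L2 n :=
  (hardy n).topologicalClosure.starProjection

/-- `E` is homogeneous: it is measurable and `|(x - δ, x + δ) ∩ E| ≥ η δ` for some `η > 0`, all
`0 < δ < 1` and all `x ∈ E`. -/
def IsHomogeneous (E : Set ℝ) : Prop :=
  MeasurableSet E ∧ ∃ η : ℝ, 0 < η ∧ ∀ δ : ℝ, 0 < δ → δ < 1 → ∀ x ∈ E,
    ENNReal.ofReal (η * δ) ≤ volume (Ioo (x - δ) (x + δ) ∩ E)

/-- A matrix weight on `E`: a measurable matrix function, positive definite almost everywhere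
on `E`. Its values off `E` play no role. -/
structure IsMatrixWeight {n : ℕ} (E : Set ℝ) (W : ℝ → Matrix (Fin n) (Fin n) ℂ) : Prop where
  measurable : ∀ i j, AEMeasurable (fun t => W t i j) (volume.restrict E)
  posDef : ∀ᵐ t ∂(volume.restrict E), (W t).PosDef

/-- All entries of `W` are integrable over `S`. -/
def EntriesIntegrableOn {n : ℕ} (W : ℝ → Matrix (Fin n) (Fin n) ℂ) (S : Set ℝ) : Prop :=
  ∀ i j, IntegrableOn (fun t => W t i j) S volume

/-- The average `|I|⁻¹ ∫_{I ∩ E} W(t) dt` over the interval `I = (x - δ, x + δ)`. -/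
def avg {n : ℕ} (E : Set ℝ) (W : ℝ → Matrix (Fin n) (Fin n) ℂ) (x δ : ℝ) :
    Matrix (Fin n) (Fin n) ℂ :=
  Matrix.of fun i j => ((2 * δ)⁻¹ : ℝ) • ∫ t in Ioo (x - δ) (x + δ) ∩ E, W t i j

open Classical in
/-- The matrix `A₂` constant `Q_{2,E}(W)`, the supremum over `x ∈ E` and `0 < δ < 1` of the operator
norms `‖⟨W⟩^{1/2} ⟨W⁻¹⟩^{1/2}‖`, the averages being taken over `(x - δ, x + δ)`. It is `∞` if one
of the averages does not exist. -/
def A2Const {n : ℕ} (E : Set ℝ) (W : ℝ → Matrix (Fin n) (Fin n) ℂ) : ℝ≥0∞ :=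
  ⨆ x ∈ E, ⨆ δ ∈ Ioo (0 : ℝ) 1,
    if EntriesIntegrableOn W (Ioo (x - δ) (x + δ) ∩ E) ∧
        EntriesIntegrableOn (fun t => (W t)⁻¹) (Ioo (x - δ) (x + δ) ∩ E)
    then ‖CFC.sqrt (avg E W x δ) * CFC.sqrt (avg E (fun t => (W t)⁻¹) x δ)‖ₑ
    else ∞

/-- Pointwise multiplication of a vector function by a matrix function, cut off to `E`. -/
def mulOn {n : ℕ} (E : Set ℝ) (A : ℝ → Matrix (Fin n) (Fin n) ℂ)
    (f : ℝ → EuclideanSpace ℂ (Fin n)) : ℝ → EuclideanSpace ℂ (Fin n) :=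
  E.indicator fun t => Matrix.toEuclideanLin (A t) (f t)

/-- The operator `W^{1/2} P₊ W^{-1/2} : χ_E L²(ℂⁿ) → χ_E L²(ℂⁿ)` is bounded. It is a priori defined
on the dense subspace of those `f ∈ χ_E L²` for which `W^{-1/2} f` is in `L²`; boundedness means that
it maps this subspace to `χ_E L²` with a norm estimate. -/
def WeightedRieszBounded {n : ℕ} (E : Set ℝ) (W : ℝ → Matrix (Fin n) (Fin n) ℂ) : Prop :=
  ∃ C : ℝ≥0, ∀ f : L2 n, (∀ᵐ t, t ∉ E → f t = 0) →
    ∀ hf : MemLp (mulOn E (fun t => (CFC.sqrt (W t))⁻¹) f) 2 volume,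
      eLpNorm (mulOn E (fun t => CFC.sqrt (W t)) (rieszProj n (hf.toLp _))) 2 volume
        ≤ C * eLpNorm f 2 volume

end MatrixA2

end

/-! Sufficiency. The Riesz projection is the boundary limit of Cauchy integrals, so it is enough to
bound the bilinear form of the Cauchy integral at height `y` with a constant independent of `y`
(`tendsto_integral_inner_cauchy`, `exists_bilinear_bound`). A stopping time argument, fed by the
weak type inequality, dominates this form by a sum over a sparse family of dyadic cells `c` of terms
`|c|⁻¹ ∫_{3c} ‖A_c u‖ ∫_c ‖B_c v‖`. Since the kernel is scalar, it commutes with matrices, so the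
coordinates `A_c`, `B_c` may be chosen anew on each cell, subject only to `⟪A_c x, B_c y⟫ = ⟪x, y⟫`
(`exists_sparse_domination`).

For cells of length `ℓ` that meet `E`, one takes `A_c = ⟨W⟩^{1/2}` and `B_c = ⟨W⟩^{-1/2}` over an
interval of radius `2ℓ` centred at a point of `E ∩ c`, and the identity once that radius is at least
`1`. The `A₂` condition makes these operators normalize both `W` and `W⁻¹`. By Cauchy–Schwarz the
sparse sum splits into two Carleson sums, one for `W^{1/2} u` and one for `W^{-1/2} v`. Each is
bounded by an embedding theorem whose weights vary with the cell (`sum_sq_lintegral_le`,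
`exists_cell_embedding`). What makes it work is that every scalar weight `‖W^{±1/2} e‖²` is `A_∞`
with uniform constants (`IsReducing.lintegral_le`), so the number of overlapping intervals is
exponentially integrable against it. Homogeneity says that intervals centred on `E` carry a fixed
proportion of mass of `E`, which is what transfers packing on the line to packing on `E`.

Necessity. For the Blaschke factor `b` with zero `w = a + iδ`, the operator `P₊ - b P₊ b̄` has the
kernel `(Im w / π) (x - w̄)⁻¹ (t - w)⁻¹` (`integral_inner_rieszProj_sub`). Multiplication by `b`
preserves weighted norms, so this operator inherits the weighted bound up to a factor two. Testing
it on `(t - w) W(t)⁻¹ h` and `(t - w) W(t) e` over `(a - δ, a + δ) ∩ E` gives `|⟪⟨W⁻¹⟩h, ⟨W⟩e⟫|² ≤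
(2πC)² ⟪⟨W⁻¹⟩h, h⟫ ⟪⟨W⟩e, e⟫`, which is the bound `‖⟨W⟩^{1/2}⟨W⁻¹⟩^{1/2}‖ ≤ 2πC`. As the averages
are not known to exist beforehand, the test is made on subsets where `W` and `W⁻¹` are bounded. The
inequality itself then forces integrability in the limit (`entriesIntegrableOn_of_formBound`). -/

noncomputable section

namespace MatrixA2

/-! ### Cauchy–Schwarz and Young inequalities for nonnegative integrals. -/

section Preliminaries

variable {α : Type*} [MeasurableSpace α] {μ : Measure α}

theorem sq_lintegral_mul_le {f g : α → ℝ≥0∞} (hf : AEMeasurable f μ) (hg : AEMeasurable g μ) :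
    (∫⁻ a, f a * g a ∂μ) ^ 2 ≤ (∫⁻ a, f a ^ 2 ∂μ) * ∫⁻ a, g a ^ 2 ∂μ := by
  have h := ENNReal.lintegral_mul_le_Lp_mul_Lq μ Real.HolderConjugate.two_two hf hg
  simp only [Pi.mul_apply, ENNReal.rpow_two] at h
  calc (∫⁻ a, f a * g a ∂μ) ^ 2
      ≤ ((∫⁻ a, f a ^ 2 ∂μ) ^ (1 / 2 : ℝ) * (∫⁻ a, g a ^ 2 ∂μ) ^ (1 / 2 : ℝ)) ^ 2 := by gcongr
    _ = _ := by
      rw [mul_pow, ← ENNReal.rpow_two, ← ENNReal.rpow_mul, ← ENNReal.rpow_two, ← ENNReal.rpow_mul]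
      norm_num

/-- Cauchy–Schwarz for the measure `f dμ`, applied to `g` and the constant `1`. -/
theorem sq_lintegral_mul_le_lintegral_mul {f g : α → ℝ≥0∞} (hf : AEMeasurable f μ)
    (hg : AEMeasurable g μ) :
    (∫⁻ a, f a * g a ∂μ) ^ 2 ≤ (∫⁻ a, f a ∂μ) * ∫⁻ a, f a * g a ^ 2 ∂μ := by
  have h2 : ∀ x : ℝ≥0∞, x ^ (1 / 2 : ℝ) * x ^ (1 / 2 : ℝ) = x := fun x => by
    rw [← ENNReal.rpow_add_of_nonneg _ _ (by norm_num) (by norm_num)]; norm_num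
  have h := sq_lintegral_mul_le (μ := μ) (f := fun a => f a ^ (1 / 2 : ℝ))
    (g := fun a => f a ^ (1 / 2 : ℝ) * g a) (hf.pow_const _) ((hf.pow_const _).mul hg)
  simp only [← mul_assoc, h2, mul_pow] at h
  simpa only [sq, h2] using h

theorem sq_eLpNorm_two {V : Type*} [NormedAddCommGroup V] (f : α → V) :
    eLpNorm f 2 μ ^ 2 = ∫⁻ a, ‖f a‖ₑ ^ 2 ∂μ := by
  have := eLpNorm_nnreal_pow_eq_lintegral (f := f) (μ := μ) (p := 2) (by norm_num)
  simpa using this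

theorem eLpNorm_two_le_iff {V : Type*} [NormedAddCommGroup V] {f : α → V} {C : ℝ≥0∞} :
    eLpNorm f 2 μ ≤ C ↔ ∫⁻ a, ‖f a‖ₑ ^ 2 ∂μ ≤ C ^ 2 := by
  rw [← sq_eLpNorm_two]
  exact (ENNReal.pow_le_pow_left_iff (by norm_num)).symm

/-- Young's inequality `L² * L¹ ⊆ L²`. -/
theorem lintegral_sq_conv_le {p φ : ℝ → ℝ≥0∞} (hp : Measurable p) (hφ : AEMeasurable φ) :
    ∫⁻ x, (∫⁻ t, p (x - t) * φ t) ^ 2 ≤ (∫⁻ x, p x ^ 2) * (∫⁻ t, φ t) ^ 2 := by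
  have hm : AEMeasurable (fun q : ℝ × ℝ => φ q.2 * p (q.1 - q.2) ^ 2)
      (volume.prod volume) := by
    refine AEMeasurable.mul (hφ.comp_snd) ?_
    exact ((hp.comp (measurable_fst.sub measurable_snd)).pow_const 2).aemeasurable
  calc ∫⁻ x, (∫⁻ t, p (x - t) * φ t) ^ 2
      ≤ ∫⁻ x, (∫⁻ t, φ t) * ∫⁻ t, φ t * p (x - t) ^ 2 := by
        refine lintegral_mono fun x => ?_
        have h := sq_lintegral_mul_le_lintegral_mul (μ := volume) hφ
          (g := fun t => p (x - t)) (hp.comp (measurable_const.sub measurable_id)).aemeasurable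
        simpa only [mul_comm (φ _) (p _)] using h
    _ = (∫⁻ t, φ t) * ∫⁻ x, ∫⁻ t, φ t * p (x - t) ^ 2 := by
        rw [lintegral_const_mul'' _ hm.lintegral_prod_right']
    _ = (∫⁻ t, φ t) * ∫⁻ t, ∫⁻ x, φ t * p (x - t) ^ 2 := by
        rw [lintegral_lintegral_swap hm]
    _ = (∫⁻ t, φ t) * ∫⁻ t, φ t * ∫⁻ x, p x ^ 2 := by
        congr 1
        refine lintegral_congr fun t => ?_
        have hm' : Measurable fun x => p (x - t) ^ 2 :=
          (hp.comp (measurable_id.sub measurable_const)).pow_const 2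
        rw [lintegral_const_mul _ hm']
        congr 1
        exact lintegral_sub_right_eq_self (fun x => p x ^ 2) t
    _ = (∫⁻ x, p x ^ 2) * (∫⁻ t, φ t) ^ 2 := by
        rw [lintegral_mul_const'' _ hφ]; ring

end Preliminaries

/-! ### Contour shifting in the upper half-plane. -/

section Vanishing

/-- A holomorphic function on the upper half-plane whose integrals over horizontal lines are
absolutely bounded away from the real axis and tend to `0` at `i∞` has vanishing integrals. -/
theorem integral_line_eq_zero {h : ℂ → ℂ} (hd : DifferentiableOn ℂ h {z : ℂ | 0 < z.im})
    (hb : ∀ y₀ : ℝ, 0 < y₀ → ∃ M : ℝ≥0, ∀ y : ℝ, y₀ ≤ y → ∫⁻ x : ℝ, ‖h (x + y * Complex.I)‖ₑ ≤ M)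
    (hl : Tendsto (fun y : ℝ => ∫⁻ x : ℝ, ‖h (x + y * Complex.I)‖ₑ) atTop (𝓝 0))
    {y : ℝ} (hy : 0 < y) :
    Integrable (fun x : ℝ => h (x + y * Complex.I)) ∧ ∫ x : ℝ, h (x + y * Complex.I) = 0 := by
  have hcont : ∀ y : ℝ, 0 < y → Continuous (fun x : ℝ => h (x + y * Complex.I)) := by
    intro y hy
    refine hd.continuousOn.comp_continuous (by fun_prop) fun x => ?_
    simpa using hy
  have hint : ∀ y : ℝ, 0 < y → Integrable (fun x : ℝ => h (x + y * Complex.I)) := by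
    intro y hy
    obtain ⟨M, hM⟩ := hb y hy
    exact ⟨(hcont y hy).aestronglyMeasurable, (hM y le_rfl).trans_lt ENNReal.coe_lt_top⟩
  refine ⟨hint y hy, ?_⟩
  -- The integral does not depend on the height, by Cauchy's theorem on long rectangles. Letting the
  -- height tend to infinity then makes it zero.
  have hconst : ∀ y₂ : ℝ, y < y₂ →
      ∫ x : ℝ, h (x + y * Complex.I) = ∫ x : ℝ, h (x + y₂ * Complex.I) := by
    intro y₂ hy₂
    obtain ⟨M, hM⟩ := hb y hy
    have hc2 : ContinuousOn (fun q : ℝ × ℝ => h (q.1 + q.2 * Complex.I)) (univ ×ˢ Icc y y₂) := by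
      refine hd.continuousOn.comp (by fun_prop) fun q hq => ?_
      have : y ≤ q.2 := hq.2.1
      simpa using lt_of_lt_of_le hy this
    have hmeas : AEMeasurable (fun q : ℝ × ℝ => ‖h (q.1 + q.2 * Complex.I)‖ₑ)
        (volume.prod (volume.restrict (Icc y y₂))) := by
      have : (volume : Measure ℝ).prod (volume.restrict (Icc y y₂))
          = (volume.prod volume).restrict (univ ×ˢ Icc y y₂) := by
        rw [← Measure.prod_restrict, Measure.restrict_univ]
      rw [this]
      exact (hc2.aemeasurable (MeasurableSet.univ.prod measurableSet_Icc)).enorm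
    have hfin : ∫⁻ x : ℝ, ∫⁻ t in Icc y y₂, ‖h (x + t * Complex.I)‖ₑ < ⊤ := by
      rw [lintegral_lintegral_swap hmeas]
      calc ∫⁻ t in Icc y y₂, ∫⁻ x : ℝ, ‖h (x + t * Complex.I)‖ₑ
          ≤ ∫⁻ t in Icc y y₂, (M : ℝ≥0∞) := by
            refine setLIntegral_mono measurable_const fun t ht => hM t ht.1
        _ < ⊤ := by
            rw [setLIntegral_const]
            exact ENNReal.mul_lt_top ENNReal.coe_lt_top (by simp)
    set v : ℝ → ℝ≥0∞ := fun x => ∫⁻ t in Icc y y₂, ‖h (x + t * Complex.I)‖ₑ with hv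
    have hfin2 : ∫⁻ x : ℝ, (v x + v (-x)) < ⊤ := by
      have h1 : AEMeasurable v := hmeas.lintegral_prod_right'
      rw [lintegral_add_left' h1, lintegral_neg_eq_self (f := v)]
      exact ENNReal.add_lt_top.2 ⟨hfin, hfin⟩
    -- a sequence of abscissas along which the vertical sides are negligible
    have hseq : ∀ k : ℕ, ∃ R : ℝ, (k : ℝ) ≤ R ∧ v R + v (-R) ≤ ENNReal.ofReal (1 / (k + 1)) := by
      intro k
      -- Otherwise `v x + v (-x)` would be bounded below on a half-line, against its integrability,
      -- which comes from Tonelli's theorem.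
      by_contra! hcon
      have : ∫⁻ x in Ici (k : ℝ), ENNReal.ofReal (1 / (k + 1)) ≤ ∫⁻ x : ℝ, (v x + v (-x)) := by
        refine le_trans ?_ (setLIntegral_le_lintegral (Ici (k : ℝ)) _)
        exact setLIntegral_mono' measurableSet_Ici fun x hx => (hcon x hx).le
      rw [setLIntegral_const, Real.volume_Ici, ENNReal.mul_top
        (by simp; positivity)] at this
      exact absurd this (not_le.2 hfin2)
    choose R hRk hRv using hseq
    have hRtop : Tendsto R atTop atTop :=
      tendsto_atTop_mono hRk tendsto_natCast_atTop_atTop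
    have hrect : ∀ k, (∫ x : ℝ in (-R k)..(R k), h (x + y * Complex.I)) -
        (∫ x : ℝ in (-R k)..(R k), h (x + y₂ * Complex.I)) =
        Complex.I * (∫ t : ℝ in y..y₂, h (-R k + t * Complex.I)) -
        Complex.I * (∫ t : ℝ in y..y₂, h (R k + t * Complex.I)) := by
      intro k
      have := Complex.integral_boundary_rect_eq_zero_of_differentiableOn h
        (⟨-R k, y⟩ : ℂ) (⟨R k, y₂⟩ : ℂ) (hd.mono ?_)
      · simp only [smul_eq_mul, Complex.ofReal_neg] at this
        linear_combination this
      · rintro z ⟨-, hz⟩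
        simp only [mem_preimage, uIcc_of_le hy₂.le] at hz
        exact lt_of_lt_of_le hy hz.1
    have hside : ∀ x : ℝ, ‖∫ t : ℝ in y..y₂, h (x + t * Complex.I)‖ₑ ≤ v x := by
      intro x
      rw [intervalIntegral.integral_of_le hy₂.le]
      refine (enorm_integral_le_lintegral_enorm _).trans ?_
      exact lintegral_mono_set Ioc_subset_Icc_self
    have hlim1 : Tendsto (fun k => (∫ x : ℝ in (-R k)..(R k), h (x + y * Complex.I)) -
        (∫ x : ℝ in (-R k)..(R k), h (x + y₂ * Complex.I))) atTop
        (𝓝 ((∫ x : ℝ, h (x + y * Complex.I)) - ∫ x : ℝ, h (x + y₂ * Complex.I))) :=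
      (intervalIntegral_tendsto_integral (hint y hy) (tendsto_neg_atTop_atBot.comp hRtop)
        hRtop).sub (intervalIntegral_tendsto_integral (hint y₂ (hy.trans hy₂))
          (tendsto_neg_atTop_atBot.comp hRtop) hRtop)
    have hlim2 : Tendsto (fun k => (∫ x : ℝ in (-R k)..(R k), h (x + y * Complex.I)) -
        (∫ x : ℝ in (-R k)..(R k), h (x + y₂ * Complex.I))) atTop (𝓝 0) := by
      simp only [hrect]
      rw [tendsto_zero_iff_norm_tendsto_zero]
      refine squeeze_zero (fun _ => norm_nonneg _) (fun k => ?_)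
        (tendsto_one_div_add_atTop_nhds_zero_nat (𝕜 := ℝ))
      have h1 := hside (R k)
      have h2 := hside (-R k)
      push_cast at h2
      have h3 : ‖Complex.I * (∫ t : ℝ in y..y₂, h (-R k + t * Complex.I)) -
        Complex.I * (∫ t : ℝ in y..y₂, h (R k + t * Complex.I))‖ₑ
          ≤ ENNReal.ofReal (1 / (k + 1)) := by
        refine le_trans (le_trans (enorm_sub_le) ?_) (hRv k)
        rw [enorm_mul, enorm_mul, add_comm]
        have : ‖Complex.I‖ₑ = 1 := by simp [enorm_eq_nnnorm]
        rw [this, one_mul, one_mul]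
        exact add_le_add h1 h2
      rw [← ofReal_norm] at h3
      exact (ENNReal.ofReal_le_ofReal_iff (by positivity)).1 h3
    exact sub_eq_zero.1 (tendsto_nhds_unique hlim1 hlim2)
  have hz : Tendsto (fun y₂ : ℝ => ∫ x : ℝ, h (x + y₂ * Complex.I)) atTop (𝓝 0) := by
    rw [tendsto_iff_edist_tendsto_0]
    refine tendsto_of_tendsto_of_tendsto_of_le_of_le tendsto_const_nhds hl
      (fun _ => zero_le) fun y₂ => ?_
    simp only [edist_zero_right]
    exact enorm_integral_le_lintegral_enorm _
  refine tendsto_nhds_unique (Tendsto.congr' ?_ tendsto_const_nhds) hz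
  filter_upwards [eventually_gt_atTop y] with y₂ hy₂ using hconst y₂ hy₂

end Vanishing

end MatrixA2

end

noncomputable section

namespace MatrixA2

/-! ### The Cauchy integral off the real axis. -/

section Cauchy

variable {V : Type*} [NormedAddCommGroup V] [NormedSpace ℂ V]

/-- The Cauchy kernel, normalized so that its boundary values represent the Riesz projection. -/
def cauchyKer (z : ℂ) : ℂ := Complex.I / (2 * Real.pi) / z

/-- The Cauchy integral `(2πi)⁻¹ ∫ f(t) (t - z)⁻¹ dt`. -/
def cauchy (f : ℝ → V) (z : ℂ) : V := ∫ t : ℝ, cauchyKer (z - t) • f t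

theorem norm_cauchyKer (z : ℂ) : ‖cauchyKer z‖ = (2 * Real.pi * ‖z‖)⁻¹ := by
  simp [cauchyKer, abs_of_pos Real.pi_pos, div_eq_mul_inv]
  ring

theorem norm_cauchyKer_le {z : ℂ} {y : ℝ} (hy : 0 < y) (hz : y ≤ |z.im|) :
    ‖cauchyKer z‖ ≤ y⁻¹ := by
  rw [norm_cauchyKer]
  have h1 : y ≤ ‖z‖ := hz.trans (Complex.abs_im_le_norm z)
  apply inv_anti₀ hy
  nlinarith [Real.pi_gt_three, Real.pi_pos]

theorem continuous_cauchyKer_sub {z : ℂ} (hz : z.im ≠ 0) :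
    Continuous fun t : ℝ => cauchyKer (z - t) := by
  unfold cauchyKer
  refine Continuous.div continuous_const (by fun_prop) fun t h => hz ?_
  have := congrArg Complex.im h
  simpa using this

theorem integrable_cauchyKer_smul {f : ℝ → V} (hf : Integrable f) {z : ℂ} (hz : z.im ≠ 0) :
    Integrable fun t : ℝ => cauchyKer (z - t) • f t := by
  refine hf.bdd_smul |z.im|⁻¹
    (continuous_cauchyKer_sub hz).aestronglyMeasurable (ae_of_all _ fun t => ?_)
  exact norm_cauchyKer_le (abs_pos.2 hz) (by simp)

theorem differentiableAt_cauchy {f : ℝ → V} (hf : Integrable f) {z : ℂ} (hz : 0 < z.im) :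
    DifferentiableAt ℂ (cauchy f) z := by
  have hs : {w : ℂ | z.im / 2 < w.im} ∈ 𝓝 z :=
    (isOpen_lt continuous_const Complex.continuous_im).mem_nhds (by simpa using hz)
  have hne : ∀ w : ℂ, z.im / 2 < w.im → ∀ t : ℝ, w - t ≠ 0 := by
    intro w hw t h
    have := congrArg Complex.im h
    simp at this
    linarith
  refine (hasDerivAt_integral_of_dominated_loc_of_deriv_le (μ := volume) hs
    (F := fun w t => cauchyKer (w - t) • f t)
    (F' := fun w t => (-(Complex.I / (2 * Real.pi)) / (w - t) ^ 2) • f t)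
    (bound := fun t => (z.im / 2)⁻¹ ^ 2 * ‖f t‖) ?_
    (integrable_cauchyKer_smul hf hz.ne') ?_ ?_ (hf.norm.const_mul _) ?_).2.differentiableAt
  · filter_upwards [hs] with w hw
    refine (integrable_cauchyKer_smul hf (z := w) ?_).aestronglyMeasurable
    have : z.im / 2 < w.im := hw
    linarith
  · refine AEStronglyMeasurable.smul (Continuous.aestronglyMeasurable ?_) hf.aestronglyMeasurable
    refine Continuous.div continuous_const (by fun_prop) fun t => ?_
    exact pow_ne_zero _ (hne z (by linarith) t)
  · refine ae_of_all _ fun t w hw => ?_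
    rw [norm_smul]
    gcongr
    have hw' : z.im / 2 < w.im := hw
    have h1 : z.im / 2 ≤ ‖w - t‖ := by
      have := Complex.abs_im_le_norm (w - t)
      simp only [Complex.sub_im, Complex.ofReal_im, sub_zero] at this
      exact hw'.le.trans ((le_abs_self _).trans this)
    have h2 : ‖(-(Complex.I / (2 * Real.pi)) : ℂ)‖ ≤ 1 := by
      simp only [norm_neg, norm_div, Complex.norm_I, norm_mul, Complex.norm_ofNat,
        Complex.norm_real, Real.norm_eq_abs, abs_of_pos Real.pi_pos]
      rw [div_le_one (by positivity)]
      nlinarith [Real.pi_gt_three]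
    rw [norm_div, norm_pow, inv_pow, ← one_div]
    have : 0 < z.im / 2 := by linarith
    gcongr
  · refine ae_of_all _ fun t w hw => ?_
    have h0 := hne w hw t
    have h1 : HasDerivAt (fun w : ℂ => cauchyKer (w - t))
        (-(Complex.I / (2 * Real.pi)) / (w - t) ^ 2) w := by
      have h2 : HasDerivAt (fun w : ℂ => w - (t : ℂ)) 1 w := (hasDerivAt_id w).sub_const _
      have h3 := (h2.inv h0).const_mul (Complex.I / (2 * Real.pi))
      have h4 : -(Complex.I / (2 * Real.pi)) / (w - t) ^ 2
          = Complex.I / (2 * Real.pi) * (-1 / (w - t) ^ 2) := by ring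
      rw [h4]
      exact h3
    exact h1.smul_const (f t)

theorem lintegral_sq_conv_smul_le {K : ℝ → ℂ} (hK : Continuous K) {f : ℝ → V}
    (hf : AEStronglyMeasurable f) :
    ∫⁻ x, ‖∫ t, K (x - t) • f t‖ₑ ^ 2 ≤ (∫⁻ x, ‖K x‖ₑ ^ 2) * (∫⁻ t, ‖f t‖ₑ) ^ 2 := by
  refine le_trans (lintegral_mono fun x => ?_)
    (lintegral_sq_conv_le (p := fun x => ‖K x‖ₑ) (φ := fun t => ‖f t‖ₑ)
      hK.enorm.measurable hf.enorm)
  gcongr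
  refine (enorm_integral_le_lintegral_enorm _).trans (le_of_eq ?_)
  simp only [enorm_smul]

theorem lintegral_inv_sq_add_sq {y : ℝ} (hy : 0 < y) :
    ∫⁻ x : ℝ, ENNReal.ofReal ((x ^ 2 + y ^ 2)⁻¹) = ENNReal.ofReal (Real.pi / y) := by
  have h0 : (fun x : ℝ => (x ^ 2 + y ^ 2)⁻¹) = fun x => (y ^ 2)⁻¹ * (1 + (x / y) ^ 2)⁻¹ := by
    ext x
    field_simp
    ring
  have hi : Integrable fun x : ℝ => (x ^ 2 + y ^ 2)⁻¹ := by
    rw [h0]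
    exact (integrable_inv_one_add_sq.comp_div hy.ne').const_mul _
  rw [← ofReal_integral_eq_lintegral_ofReal hi (ae_of_all _ fun x => by positivity), h0,
    integral_const_mul, Measure.integral_comp_div (fun x => (1 + x ^ 2)⁻¹),
    integral_univ_inv_one_add_sq, abs_of_pos hy, smul_eq_mul]
  congr 1
  field_simp

theorem norm_add_mul_I (x y : ℝ) : ‖(x : ℂ) + y * Complex.I‖ ^ 2 = x ^ 2 + y ^ 2 := by
  rw [Complex.sq_norm, Complex.normSq_add_mul_I]

theorem lintegral_sq_cauchyKer {y : ℝ} (hy : y ≠ 0) :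
    ∫⁻ x : ℝ, ‖cauchyKer (x + y * Complex.I)‖ₑ ^ 2 = ENNReal.ofReal (1 / (4 * Real.pi * |y|)) := by
  have hy' : 0 < |y| := abs_pos.2 hy
  have h : ∀ x : ℝ, ‖cauchyKer (x + y * Complex.I)‖ₑ ^ 2
      = ENNReal.ofReal ((4 * Real.pi ^ 2)⁻¹) * ENNReal.ofReal ((x ^ 2 + |y| ^ 2)⁻¹) := by
    intro x
    rw [← ofReal_norm, norm_cauchyKer, ← ENNReal.ofReal_pow (by positivity),
      ← ENNReal.ofReal_mul (by positivity), inv_pow, mul_pow, norm_add_mul_I, mul_inv,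
      sq_abs]
    congr 2
    ring
  simp only [h]
  rw [lintegral_const_mul' _ _ ENNReal.ofReal_ne_top, lintegral_inv_sq_add_sq hy',
    ← ENNReal.ofReal_mul (by positivity)]
  congr 1
  field_simp

theorem continuous_cauchyKer_line {y : ℝ} (hy : y ≠ 0) :
    Continuous fun x : ℝ => cauchyKer (x + y * Complex.I) := by
  unfold cauchyKer
  refine Continuous.div continuous_const (by fun_prop) fun t h => hy ?_
  have := congrArg Complex.im h
  simpa using this

theorem cauchy_line_eq (f : ℝ → V) (x y : ℝ) :
    cauchy f (x + y * Complex.I) = ∫ t : ℝ, cauchyKer ((x - t : ℝ) + y * Complex.I) • f t := by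
  unfold cauchy
  congr 1
  ext t
  congr 2
  push_cast
  ring

/-- Young's inequality: on a horizontal line the kernel is in `L²` and `f` is in `L¹`. The bound
decays as the line moves away from the axis, which later kills the contribution from `i∞`. -/
theorem lintegral_sq_cauchy_le {f : ℝ → V} (hf : AEStronglyMeasurable f) {y : ℝ} (hy : y ≠ 0) :
    ∫⁻ x : ℝ, ‖cauchy f (x + y * Complex.I)‖ₑ ^ 2
      ≤ ENNReal.ofReal (1 / (4 * Real.pi * |y|)) * (∫⁻ t, ‖f t‖ₑ) ^ 2 := by
  simp only [cauchy_line_eq]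
  rw [← lintegral_sq_cauchyKer hy]
  exact lintegral_sq_conv_smul_le (continuous_cauchyKer_line hy) hf

/-- The kernels at `z` and `z' = z + iε` differ by the factor `-iε / z'`, of modulus at most `|ε| /
|y|` when the shift does not approach the axis. -/
theorem lintegral_sq_cauchy_sub_le {f : ℝ → V} (hf : Integrable f) {y ε : ℝ}
    (hy : y ≠ 0) (hε : |y| ≤ |y + ε|) :
    ∫⁻ x : ℝ, ‖cauchy f (x + (y + ε : ℝ) * Complex.I) - cauchy f (x + y * Complex.I)‖ₑ ^ 2
      ≤ ENNReal.ofReal ((|ε| / |y|) ^ 2) *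
        (ENNReal.ofReal (1 / (4 * Real.pi * |y|)) * (∫⁻ t, ‖f t‖ₑ) ^ 2) := by
  have hyε : y + ε ≠ 0 := abs_pos.1 ((abs_pos.2 hy).trans_le hε)
  have hK : Continuous fun x : ℝ => cauchyKer (x + (y + ε : ℝ) * Complex.I)
      - cauchyKer (x + y * Complex.I) :=
    (continuous_cauchyKer_line hyε).sub (continuous_cauchyKer_line hy)
  have h1 := lintegral_sq_conv_smul_le hK hf.aestronglyMeasurable
  have h2 : ∀ x : ℝ, ∫ t, (cauchyKer (((x - t : ℝ) : ℂ) + (y + ε : ℝ) * Complex.I)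
      - cauchyKer ((x - t : ℝ) + y * Complex.I)) • f t =
      cauchy f (x + (y + ε : ℝ) * Complex.I) - cauchy f (x + y * Complex.I) := by
    intro x
    have hi : ∀ y : ℝ, y ≠ 0 →
        Integrable fun t : ℝ => cauchyKer (((x - t : ℝ) : ℂ) + y * Complex.I) • f t := by
      intro y hy
      have := integrable_cauchyKer_smul hf (z := x + y * Complex.I) (by simpa using hy)
      refine this.congr (ae_of_all _ fun t => ?_)
      simp only
      congr 2
      push_cast
      ring
    rw [cauchy_line_eq, cauchy_line_eq, ← integral_sub (hi _ hyε) (hi _ hy)]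
    simp only [sub_smul]
  simp only [h2] at h1
  refine h1.trans ?_
  rw [← mul_assoc]
  gcongr
  rw [← lintegral_sq_cauchyKer hy, ← lintegral_const_mul' _ _ ENNReal.ofReal_ne_top]
  refine lintegral_mono fun x => ?_
  rw [← ofReal_norm, ← ofReal_norm, ← ENNReal.ofReal_pow (by positivity),
    ← ENNReal.ofReal_pow (by positivity), ← ENNReal.ofReal_mul (by positivity), ← mul_pow]
  apply ENNReal.ofReal_le_ofReal
  gcongr
  set z : ℂ := x + y * Complex.I with hz
  set z' : ℂ := x + (y + ε : ℝ) * Complex.I with hz'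
  have hzi : z.im = y := by simp [hz]
  have hzi' : z'.im = y + ε := by simp [hz']
  have hz0 : z ≠ 0 := fun h => hy (by rw [← hzi, h]; simp)
  have hz0' : z' ≠ 0 := fun h => hyε (by rw [← hzi', h]; simp)
  have hd : cauchyKer z' - cauchyKer z = -(ε * Complex.I / z') * cauchyKer z := by
    unfold cauchyKer
    field_simp
    rw [hz, hz']
    push_cast
    ring
  rw [hd, norm_mul, norm_neg, norm_div]
  gcongr
  · simp
  · have := Complex.abs_im_le_norm z'
    rw [hzi'] at this
    exact hε.trans this

end Cauchy

end MatrixA2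

end

noncomputable section

namespace MatrixA2

/-! ### Poisson integrals and their convergence in `L²`. -/

section Poisson

variable {V : Type*} [NormedAddCommGroup V] [NormedSpace ℂ V]

/-- The Poisson kernel of the upper half-plane at height `1`. -/
def poissonKer (v : ℝ) : ℝ := (Real.pi * (1 + v ^ 2))⁻¹

theorem poissonKer_nonneg (v : ℝ) : 0 ≤ poissonKer v := by
  unfold poissonKer
  positivity

theorem continuous_poissonKer : Continuous poissonKer := by
  unfold poissonKer
  exact Continuous.inv₀ (by fun_prop) fun v => by positivity

theorem poissonKer_eq (v : ℝ) : poissonKer v = Real.pi⁻¹ * (1 + v ^ 2)⁻¹ := by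
  rw [poissonKer, mul_inv]

theorem integrable_poissonKer : Integrable poissonKer := by
  simp only [funext poissonKer_eq]
  exact integrable_inv_one_add_sq.const_mul _

theorem integral_poissonKer : ∫ v, poissonKer v = 1 := by
  simp only [poissonKer_eq]
  rw [integral_const_mul, integral_univ_inv_one_add_sq]
  exact inv_mul_cancel₀ Real.pi_ne_zero

theorem lintegral_poissonKer : ∫⁻ v, ENNReal.ofReal (poissonKer v) = 1 := by
  rw [← ofReal_integral_eq_lintegral_ofReal integrable_poissonKer
    (ae_of_all _ poissonKer_nonneg), integral_poissonKer, ENNReal.ofReal_one]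

theorem cauchyKer_sub_cauchyKer {y : ℝ} (hy : y ≠ 0) (u : ℝ) :
    cauchyKer (u + y * Complex.I) - cauchyKer (u - y * Complex.I)
      = ((y / (Real.pi * (u ^ 2 + y ^ 2)) : ℝ) : ℂ) := by
  have h1 : (u : ℂ) + y * Complex.I ≠ 0 := fun h => hy (by simpa using congrArg Complex.im h)
  have h2 : (u : ℂ) - y * Complex.I ≠ 0 := fun h => hy (by simpa using congrArg Complex.im h)
  have h3 : (u : ℂ) ^ 2 + y ^ 2 = (u + y * Complex.I) * (u - y * Complex.I) := by
    linear_combination ((y : ℂ) ^ 2) * Complex.I_sq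
  have hpi : (Real.pi : ℂ) ≠ 0 := by exact_mod_cast Real.pi_ne_zero
  unfold cauchyKer
  push_cast
  rw [h3]
  have h4 : ((u : ℂ) + y * Complex.I) - (u - y * Complex.I) = 2 * (y * Complex.I) := by ring
  generalize (u : ℂ) + y * Complex.I = a at *
  generalize (u : ℂ) - y * Complex.I = b at *
  field_simp
  linear_combination (-Complex.I) * h4 - (2 * (y : ℂ)) * Complex.I_sq

/-- The jump of the Cauchy integral across the axis is a Poisson integral. The substitution `u = y
v` moves `y` out of the kernel into a translation of `f`, so that convergence follows from
continuity of translations in `L²`. -/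
theorem cauchy_sub_cauchy {f : ℝ → V} (hf : Integrable f) {y : ℝ} (hy : 0 < y) (x : ℝ) :
    cauchy f (x + y * Complex.I) - cauchy f (x - y * Complex.I)
      = ∫ v, (poissonKer v : ℂ) • f (x - y * v) := by
  have h1 := integrable_cauchyKer_smul hf (z := x + y * Complex.I) (by simpa using hy.ne')
  have h2 := integrable_cauchyKer_smul hf (z := x - y * Complex.I) (by simpa using hy.ne')
  have h3 : ∀ t : ℝ, cauchyKer (x + y * Complex.I - t) • f t
      - cauchyKer (x - y * Complex.I - t) • f t
      = (fun u : ℝ => ((y / (Real.pi * (u ^ 2 + y ^ 2)) : ℝ) : ℂ) • f (x - u)) (x - t) := by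
    intro t
    simp only [sub_sub_cancel]
    rw [← sub_smul, ← cauchyKer_sub_cauchyKer hy.ne']
    congr 3 <;> push_cast <;> ring
  unfold cauchy
  rw [← integral_sub h1 h2]
  simp only [h3]
  rw [integral_sub_left_eq_self
    (fun u : ℝ => ((y / (Real.pi * (u ^ 2 + y ^ 2)) : ℝ) : ℂ) • f (x - u)) volume x]
  have h4 := Measure.integral_comp_mul_left
    (fun u : ℝ => ((y / (Real.pi * (u ^ 2 + y ^ 2)) : ℝ) : ℂ) • f (x - u)) y
  rw [abs_of_pos (inv_pos.2 hy)] at h4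
  rw [← smul_inv_smul₀ hy.ne'
    (∫ u : ℝ, ((y / (Real.pi * (u ^ 2 + y ^ 2)) : ℝ) : ℂ) • f (x - u)), ← h4, ← integral_smul]
  congr 1
  ext v
  rw [← Complex.coe_smul, smul_smul]
  congr 1
  unfold poissonKer
  rw [← Complex.ofReal_mul]
  congr 1
  field_simp
  ring

theorem tendsto_translate {n : ℕ} (f : L2 n) :
    Tendsto (fun u : ℝ => ∫⁻ x, ‖f (x - u) - f x‖ₑ ^ 2) (𝓝 0) (𝓝 0) := by
  let g : ℝ → C(ℝ, ℝ) := fun u => ⟨fun x => x - u, by fun_prop⟩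
  have hg : Continuous g :=
    (ContinuousMap.curry ⟨fun p : ℝ × ℝ => p.2 - p.1, by fun_prop⟩).continuous
  have hm : ∀ u, MeasurePreserving (g u) volume volume := fun u => measurePreserving_sub_right _ u
  have h := (continuous_const (y := f)).compMeasurePreservingLp hg hm (by norm_num)
  have h0 := (tendsto_iff_edist_tendsto_0.1 (h.tendsto 0))
  have h1 := (ENNReal.continuous_pow 2).tendsto 0 |>.comp h0
  simp only [Function.comp_def] at h1
  rw [zero_pow (by norm_num)] at h1
  refine h1.congr fun u => ?_
  rw [Lp.edist_def, sq_eLpNorm_two]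
  refine lintegral_congr_ae ?_
  filter_upwards [Lp.coeFn_compMeasurePreserving f (hm u),
    Lp.coeFn_compMeasurePreserving f (hm 0)] with x h1 h2
  simp only [Pi.sub_apply, h1, h2, Function.comp_apply]
  simp [g]

theorem lintegral_translate_le {n : ℕ} (f : L2 n) (u : ℝ) :
    ∫⁻ x, ‖f (x - u) - f x‖ₑ ^ 2 ≤ (2 * eLpNorm f 2) ^ 2 := by
  rw [← eLpNorm_two_le_iff]
  have hm : MeasurePreserving (fun x : ℝ => x - u) volume volume :=
    measurePreserving_sub_right _ u
  refine (eLpNorm_sub_le (f := fun x => f (x - u)) (g := f)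
    ((Lp.aestronglyMeasurable f).comp_measurePreserving hm)
    (Lp.aestronglyMeasurable f) (by norm_num)).trans ?_
  have := eLpNorm_comp_measurePreserving (p := 2) (Lp.aestronglyMeasurable f) hm
  simp only [Function.comp_def] at this
  rw [this, two_mul]

/-- Poisson integrals converge in `L²`. -/
theorem tendsto_poisson {n : ℕ} (f : L2 n) (hf : Integrable f) :
    Tendsto (fun y : ℝ => ∫⁻ x : ℝ, ‖cauchy f (x + y * Complex.I)
      - cauchy f (x - y * Complex.I) - f x‖ₑ ^ 2) (𝓝[>] 0) (𝓝 0) := by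
  have hfm : StronglyMeasurable f := Lp.stronglyMeasurable f
  have hle : ∀ y : ℝ, 0 < y → ∫⁻ x : ℝ, ‖cauchy f (x + y * Complex.I)
      - cauchy f (x - y * Complex.I) - f x‖ₑ ^ 2 ≤
      ∫⁻ v, ENNReal.ofReal (poissonKer v) * ∫⁻ x, ‖f (x - y * v) - f x‖ₑ ^ 2 := by
    intro y hy
    have hmeas : Measurable fun q : ℝ × ℝ => ‖f (q.1 - y * q.2) - f q.1‖ₑ := by
      refine ((hfm.comp_measurable ?_).sub (hfm.comp_measurable measurable_fst)).enorm
      fun_prop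
    have hpm : Measurable fun v => ENNReal.ofReal (poissonKer v) :=
      continuous_poissonKer.measurable.ennreal_ofReal
    calc ∫⁻ x : ℝ, ‖cauchy f (x + y * Complex.I) - cauchy f (x - y * Complex.I) - f x‖ₑ ^ 2
        ≤ ∫⁻ x : ℝ, ∫⁻ v, ENNReal.ofReal (poissonKer v) * ‖f (x - y * v) - f x‖ₑ ^ 2 := by
          refine lintegral_mono fun x => ?_
          have hi1 : Integrable fun v : ℝ => (poissonKer v : ℂ) • f (x - y * v) := by
            have hc : Integrable fun v : ℝ => f (x - y * v) :=
              (hf.comp_sub_left x).comp_mul_left' hy.ne'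
            refine hc.bdd_smul 1 (Complex.continuous_ofReal.comp
              continuous_poissonKer).aestronglyMeasurable (ae_of_all _ fun v => ?_)
            rw [Function.comp_apply, Complex.norm_real, Real.norm_of_nonneg (poissonKer_nonneg v)]
            apply inv_le_one_of_one_le₀
            nlinarith [Real.pi_gt_three, sq_nonneg v, mul_nonneg Real.pi_pos.le (sq_nonneg v)]
          have hi2 : Integrable fun v : ℝ => (poissonKer v : ℂ) • f x :=
            (integrable_poissonKer.ofReal (𝕜 := ℂ)).smul_const _
          have he : f x = ∫ v : ℝ, (poissonKer v : ℂ) • f x := by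
            rw [integral_smul_const, integral_complex_ofReal, integral_poissonKer]
            simp
          rw [cauchy_sub_cauchy hf hy]
          have he' : (∫ v : ℝ, (poissonKer v : ℂ) • f (x - y * v)) - f x
              = ∫ v : ℝ, ((poissonKer v : ℂ) • f (x - y * v) - (poissonKer v : ℂ) • f x) := by
            rw [integral_sub hi1 hi2, ← he]
          rw [he']
          -- Jensen's inequality for the probability density `poissonKer`, in place of Minkowski's
          -- inequality.
          have h1 := sq_lintegral_mul_le_lintegral_mul (μ := volume) hpm.aemeasurable
            (g := fun v => ‖f (x - y * v) - f x‖ₑ)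
            (hmeas.comp measurable_prodMk_left).aemeasurable
          rw [lintegral_poissonKer, one_mul] at h1
          refine le_trans ?_ h1
          gcongr
          refine (enorm_integral_le_lintegral_enorm _).trans (le_of_eq ?_)
          refine lintegral_congr fun v => ?_
          rw [← smul_sub, enorm_smul]
          congr 1
          rw [← ofReal_norm, Complex.norm_real, Real.norm_of_nonneg (poissonKer_nonneg v)]
      _ = ∫⁻ v, ∫⁻ x : ℝ, ENNReal.ofReal (poissonKer v) * ‖f (x - y * v) - f x‖ₑ ^ 2 := by
          rw [lintegral_lintegral_swap]
          exact ((hpm.comp measurable_snd).mul (hmeas.pow_const 2)).aemeasurable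
      _ = _ := by
          refine lintegral_congr fun v => ?_
          rw [lintegral_const_mul' _ _ ENNReal.ofReal_ne_top]
  have hlim : Tendsto (fun y : ℝ => ∫⁻ v, ENNReal.ofReal (poissonKer v) *
      ∫⁻ x, ‖f (x - y * v) - f x‖ₑ ^ 2) (𝓝[>] 0) (𝓝 (∫⁻ _ : ℝ, 0)) := by
    have hpm : Measurable fun v => ENNReal.ofReal (poissonKer v) :=
      continuous_poissonKer.measurable.ennreal_ofReal
    refine tendsto_lintegral_filter_of_dominated_convergence
      (fun v => ENNReal.ofReal (poissonKer v) * (2 * eLpNorm f 2) ^ 2) ?_ ?_ ?_ ?_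
    · refine Eventually.of_forall fun y => hpm.mul ?_
      refine Measurable.lintegral_prod_left' (f := fun q : ℝ × ℝ =>
        ‖f (q.1 - y * q.2) - f q.1‖ₑ ^ 2) (Measurable.pow_const ?_ 2)
      refine ((hfm.comp_measurable ?_).sub (hfm.comp_measurable measurable_fst)).enorm
      fun_prop
    · refine Eventually.of_forall fun y => ae_of_all _ fun v => ?_
      gcongr
      exact lintegral_translate_le f (y * v)
    · rw [lintegral_mul_const _ hpm, lintegral_poissonKer, one_mul]
      exact ENNReal.pow_ne_top (ENNReal.mul_ne_top (by norm_num) (Lp.eLpNorm_ne_top f))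
    · refine ae_of_all _ fun v => ?_
      have h1 : Tendsto (fun y : ℝ => y * v) (𝓝[>] 0) (𝓝 0) := by
        have : Tendsto (fun y : ℝ => y * v) (𝓝 0) (𝓝 (0 * v)) := by
          exact (continuous_id.mul continuous_const).tendsto 0
        rw [zero_mul] at this
        exact this.mono_left nhdsWithin_le_nhds
      have h2 := ENNReal.Tendsto.const_mul (a := ENNReal.ofReal (poissonKer v))
        ((tendsto_translate f).comp h1) (Or.inr ENNReal.ofReal_ne_top)
      simpa using h2
  rw [lintegral_zero] at hlim
  refine tendsto_of_tendsto_of_tendsto_of_le_of_le' tendsto_const_nhds hlim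
    (Eventually.of_forall fun _ => zero_le) ?_
  filter_upwards [self_mem_nhdsWithin] with y hy using hle y hy

end Poisson

end MatrixA2

end

noncomputable section

namespace MatrixA2

/-! ### Pairings of `L²` vector functions. -/

section Inner

variable {α : Type*} [MeasurableSpace α] {μ : Measure α}
  {V : Type*} [NormedAddCommGroup V]

theorem lintegral_enorm_mul_enorm_le {a b : α → V} (ha : AEStronglyMeasurable a μ)
    (hb : AEStronglyMeasurable b μ) :
    ∫⁻ x, ‖a x‖ₑ * ‖b x‖ₑ ∂μ ≤ eLpNorm a 2 μ * eLpNorm b 2 μ := by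
  rw [← ENNReal.pow_le_pow_left_iff (n := 2) (by norm_num), mul_pow, sq_eLpNorm_two,
    sq_eLpNorm_two]
  exact sq_lintegral_mul_le ha.enorm hb.enorm

variable [InnerProductSpace ℂ V]

theorem enorm_inner_le (x y : V) : ‖inner ℂ x y‖ₑ ≤ ‖x‖ₑ * ‖y‖ₑ := by
  rw [← ofReal_norm, ← ofReal_norm, ← ofReal_norm, ← ENNReal.ofReal_mul (norm_nonneg _)]
  exact ENNReal.ofReal_le_ofReal (norm_inner_le_norm x y)

theorem lintegral_enorm_inner_le {a b : α → V} (ha : AEStronglyMeasurable a μ)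
    (hb : AEStronglyMeasurable b μ) :
    ∫⁻ x, ‖inner ℂ (a x) (b x)‖ₑ ∂μ ≤ eLpNorm a 2 μ * eLpNorm b 2 μ :=
  (lintegral_mono fun x => enorm_inner_le (a x) (b x)).trans (lintegral_enorm_mul_enorm_le ha hb)

theorem enorm_integral_inner_le {a b : α → V} (ha : AEStronglyMeasurable a μ)
    (hb : AEStronglyMeasurable b μ) :
    ‖∫ x, inner ℂ (a x) (b x) ∂μ‖ₑ ≤ eLpNorm a 2 μ * eLpNorm b 2 μ :=
  (enorm_integral_le_lintegral_enorm _).trans (lintegral_enorm_inner_le ha hb)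

theorem integrable_inner {a b : α → V} (ha : MemLp a 2 μ) (hb : MemLp b 2 μ) :
    Integrable (fun x => inner ℂ (a x) (b x)) μ :=
  ⟨ha.1.inner hb.1, (lintegral_enorm_inner_le ha.1 hb.1).trans_lt (ENNReal.mul_lt_top ha.2 hb.2)⟩

end Inner

/-! ### The Riesz projection as a limit of Cauchy integrals. -/

section Riesz

variable {V : Type*} [NormedAddCommGroup V] [NormedSpace ℂ V]

theorem continuous_cauchy_line {f : ℝ → V} (hf : Integrable f) {y : ℝ} (hy : y ≠ 0) :
    Continuous fun x : ℝ => cauchy f (x + y * Complex.I) := by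
  simp only [cauchy_line_eq]
  refine continuous_of_dominated (bound := fun t => |y|⁻¹ * ‖f t‖) (fun x => ?_)
    (fun x => ae_of_all _ fun t => ?_) (hf.norm.const_mul _) (ae_of_all _ fun t => ?_)
  · have := (continuous_cauchyKer_line hy).comp (continuous_const.sub continuous_id : Continuous fun t : ℝ => x - t)
    exact this.aestronglyMeasurable.smul hf.aestronglyMeasurable
  · rw [norm_smul]
    gcongr
    exact norm_cauchyKer_le (abs_pos.2 hy) (by simp)
  · have := (continuous_cauchyKer_line hy).comp (continuous_id.sub continuous_const : Continuous fun x : ℝ => x - t)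
    exact this.smul continuous_const

theorem eLpNorm_cauchy_le {f : ℝ → V} (hf : AEStronglyMeasurable f) {y : ℝ} (hy : y ≠ 0) :
    eLpNorm (fun x : ℝ => cauchy f (x + y * Complex.I)) 2
      ≤ ENNReal.ofReal (√(1 / (4 * Real.pi * |y|))) * ∫⁻ t, ‖f t‖ₑ := by
  rw [eLpNorm_two_le_iff, mul_pow, ← ENNReal.ofReal_pow (by positivity),
    Real.sq_sqrt (by positivity)]
  exact lintegral_sq_cauchy_le hf hy

theorem memLp_cauchy {f : ℝ → V} (hf : Integrable f) {y : ℝ} (hy : y ≠ 0) :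
    MemLp (fun x : ℝ => cauchy f (x + y * Complex.I)) 2 :=
  ⟨(continuous_cauchy_line hf hy).aestronglyMeasurable,
    (eLpNorm_cauchy_le hf.aestronglyMeasurable hy).trans_lt
      (ENNReal.mul_lt_top ENNReal.ofReal_lt_top hf.2)⟩

/-- The sign makes the shift point away from the axis in either half-plane, as the difference
estimate requires. -/
theorem tendsto_cauchy_shift {f : ℝ → V} (hf : Integrable f) {y : ℝ} (hy : y ≠ 0) :
    Tendsto (fun ε : ℝ => eLpNorm (fun x : ℝ => cauchy f (x + (y + SignType.sign y * ε : ℝ) * Complex.I)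
      - cauchy f (x + y * Complex.I)) 2) (𝓝[>] 0) (𝓝 0) := by
  set A := ENNReal.ofReal (√(1 / (4 * Real.pi * |y|))) * ∫⁻ t, ‖f t‖ₑ with hA
  have hA' : A ≠ ⊤ := ENNReal.mul_ne_top ENNReal.ofReal_ne_top hf.2.ne
  have h1 : Tendsto (fun ε : ℝ => ENNReal.ofReal (|ε| / |y|) * A) (𝓝[>] 0) (𝓝 0) := by
    have h2 : Tendsto (fun ε : ℝ => ENNReal.ofReal (|ε| / |y|)) (𝓝 0) (𝓝 0) := by
      have : Continuous fun ε : ℝ => ENNReal.ofReal (|ε| / |y|) :=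
        ENNReal.continuous_ofReal.comp (by fun_prop)
      simpa using this.tendsto 0
    have h3 := ENNReal.Tendsto.mul_const (h2.mono_left (nhdsWithin_le_nhds (s := Ioi 0)))
      (Or.inr hA')
    simpa using h3
  refine tendsto_of_tendsto_of_tendsto_of_le_of_le' tendsto_const_nhds h1
    (Eventually.of_forall fun _ => zero_le) ?_
  filter_upwards [self_mem_nhdsWithin] with ε hε
  have hε : 0 < ε := hε
  have hs : |y| ≤ |y + SignType.sign y * ε| := by
    rcases lt_or_gt_of_ne hy with h | h
    · rw [sign_neg h]
      simp only [SignType.coe_neg, SignType.coe_one, neg_mul, one_mul]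
      rw [abs_of_neg h, abs_of_neg (by linarith)]
      linarith
    · rw [sign_pos h]
      simp only [SignType.coe_one, one_mul]
      rw [abs_of_pos h, abs_of_pos (by linarith)]
      linarith
  have he : |((SignType.sign y : SignType) : ℝ) * ε| = |ε| := by
    rcases lt_or_gt_of_ne hy with h | h
    · rw [sign_neg h]; simp
    · rw [sign_pos h]; simp
  rw [eLpNorm_two_le_iff]
  refine (lintegral_sq_cauchy_sub_le hf hy hs).trans (le_of_eq ?_)
  rw [he, hA, mul_pow, mul_pow, ENNReal.ofReal_pow (by positivity),
    ← ENNReal.ofReal_pow (by positivity : (0 : ℝ) ≤ √_), Real.sq_sqrt (by positivity)]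

variable {n : ℕ}

theorem cauchy_apply {f : ℝ → EuclideanSpace ℂ (Fin n)} (hf : Integrable f) {z : ℂ}
    (hz : z.im ≠ 0) (i : Fin n) : cauchy f z i = cauchy (fun t => f t i) z := by
  have := (EuclideanSpace.proj i : EuclideanSpace ℂ (Fin n) →L[ℂ] ℂ).integral_comp_comm
    (integrable_cauchyKer_smul hf hz)
  exact this.symm

theorem cauchyKer_conj (z : ℂ) :
    (starRingEnd ℂ) (cauchyKer z) = -cauchyKer ((starRingEnd ℂ) z) := by
  have h2 : (starRingEnd ℂ) 2 = 2 := Complex.conj_ofNat 2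
  simp [cauchyKer, neg_div, h2]

/-- Since the inner product is conjugate-linear in its first slot, this reflection turns Cauchy
integrals in the lower half-plane into holomorphic factors in the upper one. -/
theorem conj_cauchy (f : ℝ → ℂ) (z : ℂ) :
    (starRingEnd ℂ) (cauchy f z) = -cauchy (fun t => (starRingEnd ℂ) (f t)) ((starRingEnd ℂ) z) := by
  unfold cauchy
  rw [← integral_conj, ← integral_neg]
  congr 1
  ext t
  simp [cauchyKer_conj]

theorem integrable_coord {f : ℝ → EuclideanSpace ℂ (Fin n)} (hf : Integrable f) (i : Fin n) :
    Integrable fun t => f t i :=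
  (EuclideanSpace.proj i : EuclideanSpace ℂ (Fin n) →L[ℂ] ℂ).integrable_comp hf

/-- Cauchy integrals in the lower half-plane are orthogonal to the Hardy space. -/
theorem integral_inner_cauchy_eq_zero {f : ℝ → EuclideanSpace ℂ (Fin n)} (hf : Integrable f)
    {G : ℂ → EuclideanSpace ℂ (Fin n)} {g : ℝ → EuclideanSpace ℂ (Fin n)} (hg : MemLp g 2)
    (hG : IsHardyBoundary G g) {y : ℝ} (hy : 0 < y) :
    ∫ x : ℝ, inner ℂ (cauchy f (x + (-y : ℝ) * Complex.I)) (g x) = 0 := by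
  obtain ⟨M, hM⟩ := hG.bdd
  have hfc : ∀ i, Integrable fun t => (starRingEnd ℂ) (f t i) := fun i =>
    Complex.conjCLE.toContinuousLinearMap.integrable_comp (integrable_coord hf i)
  -- The pairing of `cauchy f` at `x - i(y + ε)` with `G` at `x + iε`, written by reflection as a
  -- holomorphic function of `x + iε`. Its line integrals vanish for every `ε > 0`.
  set h : ℂ → ℂ := fun z => ∑ i, G z i *
    (-cauchy (fun t => (starRingEnd ℂ) (f t i)) (z + y * Complex.I)) with hh
  have hval : ∀ x ε : ℝ, 0 < ε → h (x + ε * Complex.I)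
      = inner ℂ (cauchy f (x + (-(y + ε) : ℝ) * Complex.I)) (G (x + ε * Complex.I)) := by
    intro x ε hε
    rw [hh, PiLp.inner_apply]
    refine Finset.sum_congr rfl fun i _ => ?_
    rw [RCLike.inner_apply, cauchy_apply hf (by simp; linarith), conj_cauchy]
    congr 3
    simp
    ring
  have hmeasG : ∀ ε : ℝ, 0 < ε → AEStronglyMeasurable (fun x : ℝ => G (x + ε * Complex.I)) :=
    fun ε hε => aesm_line hG.holo hε
  have hmeasC : ∀ ε : ℝ, 0 < ε →
      AEStronglyMeasurable (fun x : ℝ => cauchy f (x + (-(y + ε) : ℝ) * Complex.I)) :=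
    fun ε hε => (memLp_cauchy hf (by linarith)).1
  have hbound : ∀ ε : ℝ, 0 < ε → ∫⁻ x : ℝ, ‖h (x + ε * Complex.I)‖ₑ ≤
      ENNReal.ofReal (√(1 / (4 * Real.pi * (y + ε)))) * (∫⁻ t, ‖f t‖ₑ) * M := by
    intro ε hε
    simp only [hval _ ε hε]
    refine (lintegral_enorm_inner_le (hmeasC ε hε) (hmeasG ε hε)).trans ?_
    gcongr
    · refine (eLpNorm_cauchy_le hf.aestronglyMeasurable (by linarith)).trans (le_of_eq ?_)
      rw [abs_neg, abs_of_pos (by linarith)]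
    · exact hM ε hε
  have hzero : ∀ ε : ℝ, 0 < ε → ∫ x : ℝ, inner ℂ
      (cauchy f (x + (-(y + ε) : ℝ) * Complex.I)) (G (x + ε * Complex.I)) = 0 := by
    intro ε hε
    simp only [← hval _ ε hε]
    refine (integral_line_eq_zero ?_ ?_ ?_ hε).2
    · intro z hz
      have hz : 0 < z.im := hz
      apply DifferentiableAt.differentiableWithinAt
      rw [hh]
      refine DifferentiableAt.fun_sum fun i _ => ?_
      have hGz : DifferentiableAt ℂ G z :=
        hG.holo.differentiableAt ((isOpen_lt continuous_const Complex.continuous_im).mem_nhds hz)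
      refine DifferentiableAt.mul ?_ (DifferentiableAt.neg ?_)
      · exact (EuclideanSpace.proj i : EuclideanSpace ℂ (Fin n) →L[ℂ] ℂ).differentiableAt.comp z hGz
      · have h1 := differentiableAt_cauchy (hfc i) (z := z + y * Complex.I) (by simp; linarith)
        exact DifferentiableAt.comp (f := fun z : ℂ => z + y * Complex.I) z h1 (by fun_prop)
    · intro y₀ hy₀
      refine ⟨(ENNReal.ofReal (√(1 / (4 * Real.pi * y))) * (∫⁻ t, ‖f t‖ₑ) * M).toNNReal, ?_⟩
      intro ε hε
      rw [ENNReal.coe_toNNReal (ENNReal.mul_ne_top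
        (ENNReal.mul_ne_top ENNReal.ofReal_ne_top hf.2.ne) ENNReal.coe_ne_top)]
      refine (hbound ε (by linarith)).trans ?_
      gcongr
      linarith
    · have h1 : Tendsto (fun ε : ℝ => ENNReal.ofReal (√(1 / (4 * Real.pi * (y + ε)))) *
          (∫⁻ t, ‖f t‖ₑ) * M) atTop (𝓝 0) := by
        have h2 : Tendsto (fun ε : ℝ => 1 / (4 * Real.pi * (y + ε))) atTop (𝓝 0) := by
          simp only [one_div]
          apply Tendsto.inv_tendsto_atTop
          apply Tendsto.const_mul_atTop (by positivity)
          exact tendsto_atTop_add_const_left _ _ tendsto_id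
        have h3 : Tendsto (fun ε : ℝ => ENNReal.ofReal (√(1 / (4 * Real.pi * (y + ε)))))
            atTop (𝓝 0) := by
          have := (ENNReal.continuous_ofReal.comp Real.continuous_sqrt).tendsto 0
          simp only [Function.comp_apply, Real.sqrt_zero, ENNReal.ofReal_zero] at this
          exact this.comp h2
        have h4 := ENNReal.Tendsto.mul_const h3
          (Or.inr (ENNReal.mul_ne_top hf.2.ne (ENNReal.coe_ne_top (r := M))))
        simpa [mul_assoc] using h4
      refine tendsto_of_tendsto_of_tendsto_of_le_of_le' tendsto_const_nhds h1
        (Eventually.of_forall fun _ => zero_le) ?_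
      filter_upwards [eventually_gt_atTop 0] with ε hε using hbound ε hε
  have hy' : (-y) ≠ 0 := by linarith
  -- The pairing with `g` differs from the vanishing pairing at height `ε` by two errors, each of
  -- which tends to zero with `ε` by Cauchy–Schwarz.
  have hle : ∀ ε : ℝ, 0 < ε →
      ‖∫ x : ℝ, inner ℂ (cauchy f (x + (-y : ℝ) * Complex.I)) (g x)‖ₑ ≤
      eLpNorm (fun x : ℝ => cauchy f (x + (-y + SignType.sign (-y) * ε : ℝ) * Complex.I)
        - cauchy f (x + (-y : ℝ) * Complex.I)) 2 * eLpNorm g 2 +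
      ENNReal.ofReal (√(1 / (4 * Real.pi * y))) * (∫⁻ t, ‖f t‖ₑ) *
        eLpNorm (fun x : ℝ => G (x + ε * Complex.I) - g x) 2 := by
    intro ε hε
    have hsig : (-y + SignType.sign (-y) * ε : ℝ) = -(y + ε) := by
      rw [sign_neg (by linarith)]
      simp
      ring
    rw [hsig]
    set a : ℝ → EuclideanSpace ℂ (Fin n) := fun x => cauchy f (x + (-y : ℝ) * Complex.I)
    set b : ℝ → EuclideanSpace ℂ (Fin n) := fun x => cauchy f (x + (-(y + ε) : ℝ) * Complex.I)
    set c : ℝ → EuclideanSpace ℂ (Fin n) := fun x => G (x + ε * Complex.I)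
    have ha : MemLp a 2 := memLp_cauchy hf hy'
    have hb : MemLp b 2 := memLp_cauchy hf (by linarith)
    have hc : MemLp c 2 := ⟨hmeasG ε hε, (hM ε hε).trans_lt ENNReal.coe_lt_top⟩
    have hz : ∫ x, inner ℂ (b x) (c x) = 0 := hzero ε hε
    have hsplit : ∫ x, inner ℂ (a x) (g x) =
        -(∫ x, inner ℂ ((b - a) x) (g x)) - ∫ x, inner ℂ (b x) ((c - g) x) := by
      have i1 := integrable_inner ha hg
      have i2 := integrable_inner hb hg
      have i3 := integrable_inner hb hc
      simp only [Pi.sub_apply, inner_sub_left, inner_sub_right]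
      rw [integral_sub i2 i1, integral_sub i3 i2, hz]
      ring
    rw [hsplit]
    refine enorm_sub_le.trans ?_
    rw [enorm_neg]
    refine add_le_add (enorm_integral_inner_le (hb.1.sub ha.1) hg.1) ?_
    refine (enorm_integral_inner_le hb.1 (hc.1.sub hg.1)).trans ?_
    refine mul_le_mul' ?_ le_rfl
    refine (eLpNorm_cauchy_le hf.aestronglyMeasurable (by linarith)).trans ?_
    rw [abs_neg, abs_of_pos (by linarith)]
    gcongr
    linarith
  have hlim := (ENNReal.Tendsto.mul_const (tendsto_cauchy_shift hf hy')
    (Or.inr hg.2.ne)).add (ENNReal.Tendsto.const_mul (a := ENNReal.ofReal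
      (√(1 / (4 * Real.pi * y))) * (∫⁻ t, ‖f t‖ₑ)) hG.lim
      (Or.inr (ENNReal.mul_ne_top ENNReal.ofReal_ne_top hf.2.ne)))
  simp only [zero_mul, mul_zero, add_zero] at hlim
  have hfin := ge_of_tendsto hlim (by
    filter_upwards [self_mem_nhdsWithin] with ε hε using hle ε hε)
  simpa using hfin

/-- Boundary values of Cauchy integrals converge to the Riesz projection. -/
theorem tendsto_cauchy_rieszProj (f : L2 n) (hf : Integrable f) :
    Tendsto (fun y : ℝ => eLpNorm (fun x : ℝ => cauchy f (x + y * Complex.I)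
      - rieszProj n f x) 2) (𝓝[>] 0) (𝓝 0) := by
  have hle : ∀ y : ℝ, 0 < y → eLpNorm (fun x : ℝ => cauchy f (x + y * Complex.I)
      - rieszProj n f x) 2 ≤ (∫⁻ x : ℝ, ‖cauchy f (x + y * Complex.I)
      - cauchy f (x - y * Complex.I) - f x‖ₑ ^ 2) ^ (1 / 2 : ℝ) := by
    intro y hy
    have hp := memLp_cauchy hf hy.ne'
    have hm := memLp_cauchy hf (y := -y) (by linarith)
    set s : L2 n := hp.toLp _
    set m : L2 n := hm.toLp _
    have hs : s ∈ (hardy n).topologicalClosure := by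
      refine (hardy n).le_topologicalClosure ?_
      have hF : IsHardyBoundary (fun z => cauchy f (z + y * Complex.I))
          (fun x : ℝ => cauchy f (x + y * Complex.I)) := by
        have he : ∀ x ε : ℝ, (x : ℂ) + ε * Complex.I + y * Complex.I
            = x + (y + ε : ℝ) * Complex.I := by
          intro x ε
          push_cast
          ring
        refine ⟨?_, ?_, ?_⟩
        · intro z hz
          have hz : 0 < z.im := hz
          apply DifferentiableAt.differentiableWithinAt
          have h1 := differentiableAt_cauchy hf (z := z + y * Complex.I) (by simp; linarith)
          exact DifferentiableAt.comp (f := fun z : ℂ => z + y * Complex.I) z h1 (by fun_prop)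
        · refine ⟨(ENNReal.ofReal (√(1 / (4 * Real.pi * y))) * ∫⁻ t, ‖f t‖ₑ).toNNReal, ?_⟩
          intro ε hε
          rw [ENNReal.coe_toNNReal (ENNReal.mul_ne_top ENNReal.ofReal_ne_top hf.2.ne)]
          simp only [he]
          refine (eLpNorm_cauchy_le hf.aestronglyMeasurable (by linarith)).trans ?_
          rw [abs_of_pos (by linarith)]
          gcongr
          linarith
        · have := tendsto_cauchy_shift hf hy.ne'
          rw [sign_pos hy] at this
          simp only [he]
          simpa using this
      refine ⟨_, hF.holo, hF.bdd, hF.lim.congr fun ε => ?_⟩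
      refine eLpNorm_congr_ae ?_
      filter_upwards [hp.coeFn_toLp] with x hx
      rw [hx]
    have hmo : m ∈ ((hardy n).topologicalClosure)ᗮ := by
      rw [Submodule.orthogonal_closure, Submodule.mem_orthogonal']
      rintro g ⟨G, hG⟩
      rw [L2.inner_def]
      rw [← integral_inner_cauchy_eq_zero hf (Lp.memLp g) hG hy]
      refine integral_congr_ae ?_
      filter_upwards [hm.coeFn_toLp] with x hx
      rw [hx]
    -- The upper Cauchy integral `s` lies in the Hardy space and the lower one `m` is orthogonal to
    -- it. Hence `s - P₊ f = P₊ (s - m - f)`, and `s - m - f` is the error of the Poisson integral.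
    have hproj : rieszProj n (s - m) = s := by
      have h1 : (hardy n).topologicalClosure.starProjection s = s :=
        Submodule.starProjection_eq_self_iff.2 hs
      have h2 : (hardy n).topologicalClosure.starProjection m = 0 :=
        (Submodule.starProjection_apply_eq_zero_iff _).2 hmo
      rw [rieszProj, map_sub, h1, h2, sub_zero]
    have hn : ‖s - rieszProj n f‖ ≤ ‖s - m - f‖ := by
      calc ‖s - rieszProj n f‖ = ‖rieszProj n (s - m - f)‖ := by
            rw [map_sub (rieszProj n) (s - m) f, hproj]
        _ ≤ ‖rieszProj n‖ * ‖s - m - f‖ := (rieszProj n).le_opNorm _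
        _ ≤ 1 * ‖s - m - f‖ := by
            gcongr
            exact Submodule.starProjection_norm_le _
        _ = _ := one_mul _
    have e1 : eLpNorm (fun x : ℝ => cauchy f (x + y * Complex.I) - rieszProj n f x) 2
        = ‖s - rieszProj n f‖ₑ := by
      rw [Lp.enorm_def]
      refine eLpNorm_congr_ae ?_
      filter_upwards [hp.coeFn_toLp, Lp.coeFn_sub s (rieszProj n f)] with x h1 h2
      rw [h2, Pi.sub_apply, h1]
    have e2 : ∫⁻ x : ℝ, ‖cauchy f (x + y * Complex.I)
      - cauchy f (x - y * Complex.I) - f x‖ₑ ^ 2 = ‖s - m - f‖ₑ ^ 2 := by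
      rw [Lp.enorm_def, sq_eLpNorm_two]
      refine lintegral_congr_ae ?_
      filter_upwards [hp.coeFn_toLp, hm.coeFn_toLp, Lp.coeFn_sub (s - m) f,
        Lp.coeFn_sub s m] with x h1 h2 h3 h4
      rw [h3, Pi.sub_apply, h4, Pi.sub_apply, h1, h2]
      congr 5
      push_cast
      ring
    rw [e1, e2, ← ENNReal.rpow_two, ← ENNReal.rpow_mul]
    norm_num
    rw [← ofReal_norm, ← ofReal_norm]
    exact ENNReal.ofReal_le_ofReal hn
  have hlim := (ENNReal.continuous_rpow_const (y := (1 / 2 : ℝ))).tendsto 0 |>.comp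
    (tendsto_poisson f hf)
  rw [ENNReal.zero_rpow_of_pos (by norm_num)] at hlim
  refine tendsto_of_tendsto_of_tendsto_of_le_of_le' tendsto_const_nhds hlim
    (Eventually.of_forall fun _ => zero_le) ?_
  filter_upwards [self_mem_nhdsWithin] with y hy using hle y hy

/-- The bilinear form of the Riesz projection as a limit of absolutely convergent integrals. -/
theorem tendsto_integral_inner_cauchy (f : L2 n) (hf : Integrable f)
    {g : ℝ → EuclideanSpace ℂ (Fin n)} (hg : MemLp g 2) :
    Tendsto (fun y : ℝ => ∫ x : ℝ, inner ℂ (cauchy f (x + y * Complex.I)) (g x)) (𝓝[>] 0)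
      (𝓝 (∫ x : ℝ, inner ℂ (rieszProj n f x) (g x))) := by
  rw [tendsto_iff_edist_tendsto_0]
  have h1 := ENNReal.Tendsto.mul_const (tendsto_cauchy_rieszProj f hf) (Or.inr hg.2.ne)
  rw [zero_mul] at h1
  refine tendsto_of_tendsto_of_tendsto_of_le_of_le' tendsto_const_nhds h1
    (Eventually.of_forall fun _ => zero_le) ?_
  filter_upwards [self_mem_nhdsWithin] with y hy
  have hy : 0 < y := hy
  have hp := memLp_cauchy hf hy.ne'
  have hr := Lp.memLp (rieszProj n f)
  rw [edist_eq_enorm_sub, ← integral_sub (integrable_inner hp hg) (integrable_inner hr hg)]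
  simp only [← inner_sub_left]
  exact enorm_integral_inner_le (hp.1.sub hr.1) hg.1

end Riesz

end MatrixA2

end

noncomputable section

namespace MatrixA2

/-! ### Kolmogorov's weak type inequality for the Cauchy integral. -/

section WeakType

/-- The real part is half the Poisson kernel. So Cauchy integrals of nonnegative functions have
nonnegative real part, whose integral over each line is half the mass. -/
theorem re_cauchyKer (u y : ℝ) :
    (cauchyKer (u + y * Complex.I)).re = (2 * Real.pi)⁻¹ * (y * (u ^ 2 + y ^ 2)⁻¹) := by
  have h : cauchyKer (u + y * Complex.I)
      = ((2 * Real.pi)⁻¹ : ℝ) * (Complex.I * ((u : ℂ) + y * Complex.I)⁻¹) := by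
    unfold cauchyKer
    push_cast
    rw [div_div, div_eq_mul_inv, mul_inv]
    ring
  rw [h, Complex.re_ofReal_mul, Complex.I_mul_re, Complex.inv_im, Complex.normSq_add_mul_I]
  simp [div_eq_mul_inv]

theorem re_cauchy {f : ℝ → ℝ} (hf : Integrable f) {y : ℝ} (hy : 0 < y) (x : ℝ) :
    (cauchy (fun t => (f t : ℂ)) (x + y * Complex.I)).re
      = ∫ t, (2 * Real.pi)⁻¹ * (y * ((x - t) ^ 2 + y ^ 2)⁻¹) * f t := by
  have hfc : Integrable fun t => (f t : ℂ) := hf.ofReal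
  have hi := integrable_cauchyKer_smul hfc (z := x + y * Complex.I) (by simpa using hy.ne')
  have h := (Complex.reCLM.integral_comp_comm hi).symm
  refine (show _ = _ from h).trans ?_
  congr 1
  ext t
  have : (x : ℂ) + y * Complex.I - t = (x - t : ℝ) + y * Complex.I := by
    push_cast
    ring
  rw [Complex.reCLM_apply, this, smul_eq_mul, mul_comm _ (f t : ℂ), Complex.re_ofReal_mul, re_cauchyKer,
    mul_comm]

theorem re_cauchy_nonneg {f : ℝ → ℝ} (hf : Integrable f) (h0 : ∀ t, 0 ≤ f t) {z : ℂ}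
    (hz : 0 < z.im) : 0 ≤ (cauchy (fun t => (f t : ℂ)) z).re := by
  rw [← Complex.re_add_im z, re_cauchy hf hz]
  exact integral_nonneg fun t => mul_nonneg (by positivity) (h0 t)

theorem lintegral_re_cauchy {f : ℝ → ℝ} (hf : Integrable f) (h0 : ∀ t, 0 ≤ f t) {y : ℝ}
    (hy : 0 < y) :
    ∫⁻ x : ℝ, ENNReal.ofReal (cauchy (fun t => (f t : ℂ)) (x + y * Complex.I)).re
      = ENNReal.ofReal (1 / 2) * ∫⁻ t, ENNReal.ofReal (f t) := by
  set k : ℝ → ℝ := fun u => (2 * Real.pi)⁻¹ * (y * (u ^ 2 + y ^ 2)⁻¹) with hk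
  have hk0 : ∀ u, 0 ≤ k u := fun u => by rw [hk]; positivity
  have hkc : Continuous k := by
    rw [hk]
    refine continuous_const.mul (continuous_const.mul (Continuous.inv₀ (by fun_prop) fun u => ?_))
    positivity
  have hki : ∫⁻ u, ENNReal.ofReal (k u) = ENNReal.ofReal (1 / 2) := by
    have : ∀ u, ENNReal.ofReal (k u)
        = ENNReal.ofReal ((2 * Real.pi)⁻¹ * y) * ENNReal.ofReal ((u ^ 2 + y ^ 2)⁻¹) := fun u => by
      rw [← ENNReal.ofReal_mul (by positivity), hk]
      congr 1
      ring
    simp only [this]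
    rw [lintegral_const_mul' _ _ ENNReal.ofReal_ne_top, lintegral_inv_sq_add_sq hy,
      ← ENNReal.ofReal_mul (by positivity)]
    congr 1
    field_simp
  have hint : ∀ x, Integrable fun t => k (x - t) * f t := by
    intro x
    refine hf.bdd_mul (c := (2 * Real.pi)⁻¹ * (y * (y ^ 2)⁻¹))
      (hkc.comp (continuous_const.sub continuous_id)).aestronglyMeasurable
      (ae_of_all _ fun t => ?_)
    rw [Real.norm_of_nonneg (hk0 _), hk]
    simp only
    gcongr
    nlinarith [sq_nonneg (x - t)]
  have hkm : Measurable fun u => ENNReal.ofReal (k u) := hkc.measurable.ennreal_ofReal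
  calc ∫⁻ x : ℝ, ENNReal.ofReal (cauchy (fun t => (f t : ℂ)) (x + y * Complex.I)).re
      = ∫⁻ x : ℝ, ∫⁻ t, ENNReal.ofReal (k (x - t)) * ENNReal.ofReal (f t) := by
        refine lintegral_congr fun x => ?_
        rw [re_cauchy hf hy, ofReal_integral_eq_lintegral_ofReal (hint x)
          (ae_of_all _ fun t => mul_nonneg (hk0 _) (h0 t))]
        exact lintegral_congr fun t => ENNReal.ofReal_mul (hk0 _)
    _ = ∫⁻ t, ∫⁻ x : ℝ, ENNReal.ofReal (k (x - t)) * ENNReal.ofReal (f t) := by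
        rw [lintegral_lintegral_swap]
        exact (hkm.comp (measurable_fst.sub measurable_snd)).aemeasurable.mul
          hf.aemeasurable.ennreal_ofReal.comp_snd
    _ = ∫⁻ t, ENNReal.ofReal (1 / 2) * ENNReal.ofReal (f t) := by
        refine lintegral_congr fun t => ?_
        rw [lintegral_mul_const' _ _ ENNReal.ofReal_ne_top,
          lintegral_sub_right_eq_self (fun u => ENNReal.ofReal (k u)) t, hki]
    _ = _ := lintegral_const_mul' _ _ ENNReal.ofReal_ne_top

/-- Kolmogorov's weak type inequality for nonnegative functions. -/
theorem weak_type_of_nonneg {f : ℝ → ℝ} (hf : Integrable f) (h0 : ∀ t, 0 ≤ f t) {y l : ℝ}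
    (hy : 0 < y) (hl : 0 < l) :
    volume {x : ℝ | l < ‖cauchy (fun t => (f t : ℂ)) (x + y * Complex.I)‖}
      ≤ ENNReal.ofReal (1 / l) * ∫⁻ t, ENNReal.ofReal (f t) := by
  set c : ℂ → ℂ := cauchy (fun t => (f t : ℂ)) with hc
  have hfc : Integrable fun t => (f t : ℂ) := hf.ofReal
  have hden : ∀ z : ℂ, 0 < z.im → l ≤ ‖c z + l‖ := by
    intro z hz
    have h1 := re_cauchy_nonneg hf h0 hz
    have h2 := Complex.re_le_norm (c z + l)
    simp only [Complex.add_re, Complex.ofReal_re] at h2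
    linarith
  have hden0 : ∀ z : ℂ, 0 < z.im → c z + l ≠ 0 := fun z hz h => by
    have := hden z hz
    rw [h, norm_zero] at this
    linarith
  -- As `Re c ≥ 0`, the denominator has modulus at least `l`, so `h` is holomorphic and dominated by
  -- `|c|² / l`. It is therefore integrable on lines with integral zero. On the other hand `c - h =
  -- l c / (c + l)` has real part at least `l / 2` wherever `|c| > l`.
  set h : ℂ → ℂ := fun z => c z ^ 2 / (c z + l) with hh
  have hhn : ∀ z : ℂ, 0 < z.im → ‖h z‖ₑ ≤ ENNReal.ofReal (1 / l) * ‖c z‖ₑ ^ 2 := by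
    intro z hz
    rw [← ofReal_norm, ← ofReal_norm, ← ENNReal.ofReal_pow (norm_nonneg _),
      ← ENNReal.ofReal_mul (by positivity)]
    apply ENNReal.ofReal_le_ofReal
    rw [hh]
    simp only [norm_div, norm_pow]
    rw [div_mul_eq_mul_div, one_mul]
    gcongr
    exact hden z hz
  have hhb : ∀ ε : ℝ, 0 < ε → ∫⁻ x : ℝ, ‖h (x + ε * Complex.I)‖ₑ ≤ ENNReal.ofReal (1 / l) *
      (ENNReal.ofReal (1 / (4 * Real.pi * ε)) * (∫⁻ t, ‖(f t : ℂ)‖ₑ) ^ 2) := by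
    intro ε hε
    have h1 := lintegral_sq_cauchy_le hfc.aestronglyMeasurable hε.ne'
    rw [abs_of_pos hε] at h1
    refine (lintegral_mono fun x => hhn _ (by simpa using hε)).trans ?_
    rw [lintegral_const_mul' _ _ ENNReal.ofReal_ne_top]
    gcongr
  have hhd : DifferentiableOn ℂ h {z : ℂ | 0 < z.im} := by
    intro z hz
    have hcz : DifferentiableAt ℂ c z := differentiableAt_cauchy hfc hz
    exact ((hcz.pow 2).div (hcz.add_const _) (hden0 z hz)).differentiableWithinAt
  have hhb' : ∀ y₀ : ℝ, 0 < y₀ → ∃ M : ℝ≥0, ∀ ε : ℝ, y₀ ≤ ε →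
      ∫⁻ x : ℝ, ‖h (x + ε * Complex.I)‖ₑ ≤ M := by
    intro y₀ hy₀
    refine ⟨(ENNReal.ofReal (1 / l) *
      (ENNReal.ofReal (1 / (4 * Real.pi * y₀)) * (∫⁻ t, ‖(f t : ℂ)‖ₑ) ^ 2)).toNNReal, ?_⟩
    intro ε hε
    rw [ENNReal.coe_toNNReal (ENNReal.mul_ne_top ENNReal.ofReal_ne_top
      (ENNReal.mul_ne_top ENNReal.ofReal_ne_top (ENNReal.pow_ne_top hfc.2.ne)))]
    refine (hhb ε (by linarith)).trans ?_
    gcongr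
  have hhl : Tendsto (fun ε : ℝ => ∫⁻ x : ℝ, ‖h (x + ε * Complex.I)‖ₑ) atTop (𝓝 0) := by
    have h1 : Tendsto (fun ε : ℝ => ENNReal.ofReal (1 / l) *
      (ENNReal.ofReal (1 / (4 * Real.pi * ε)) * (∫⁻ t, ‖(f t : ℂ)‖ₑ) ^ 2)) atTop (𝓝 0) := by
      have h2 : Tendsto (fun ε : ℝ => 1 / (4 * Real.pi * ε)) atTop (𝓝 0) := by
        simp only [one_div]
        exact (tendsto_id.const_mul_atTop (by positivity)).inv_tendsto_atTop
      have h3 := ENNReal.tendsto_ofReal h2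
      rw [ENNReal.ofReal_zero] at h3
      have h4 := ENNReal.Tendsto.const_mul (a := ENNReal.ofReal (1 / l))
        (ENNReal.Tendsto.mul_const h3 (Or.inr (ENNReal.pow_ne_top (n := 2) hfc.2.ne)))
        (Or.inr ENNReal.ofReal_ne_top)
      simpa using h4
    refine tendsto_of_tendsto_of_tendsto_of_le_of_le' tendsto_const_nhds h1
      (Eventually.of_forall fun _ => zero_le) ?_
    filter_upwards [eventually_gt_atTop 0] with ε hε using hhb ε hε
  obtain ⟨hhi, hh0⟩ := integral_line_eq_zero hhd hhb' hhl hy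
  have hrei : Integrable fun x : ℝ => (c (x + y * Complex.I)).re := by
    refine ⟨(Complex.continuous_re.comp
      (continuous_cauchy_line hfc hy.ne')).aestronglyMeasurable, ?_⟩
    rw [hasFiniteIntegral_iff_ofReal (ae_of_all _ fun x =>
      re_cauchy_nonneg hf h0 (by simpa using hy)), lintegral_re_cauchy hf h0 hy]
    refine ENNReal.mul_lt_top ENNReal.ofReal_lt_top ?_
    rw [← hasFiniteIntegral_iff_ofReal (ae_of_all _ h0)]
    exact hf.2
  -- This is `2 Re (c / (c + l))`, nonnegative and at least `1` on the set to be measured. It is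
  -- integrated through `Re c` and `h`, because `c` itself is in general not integrable on a line.
  set P : ℝ → ℝ := fun x => 2 / l * ((c (x + y * Complex.I)).re - (h (x + y * Complex.I)).re)
    with hP
  have hhre : Integrable fun x : ℝ => (h (x + y * Complex.I)).re := hhi.re
  have hPi : Integrable P := (hrei.sub hhre).const_mul _
  have hPeq : ∀ x : ℝ, P x
      = (‖c (x + y * Complex.I)‖ ^ 2 + l * (c (x + y * Complex.I)).re) * 2
        / ‖c (x + y * Complex.I) + l‖ ^ 2 := by
    intro x
    have hne := hden0 (x + y * Complex.I) (by simpa using hy)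
    have h1 : ((c (x + y * Complex.I)).re - (h (x + y * Complex.I)).re)
        = (l * (c (x + y * Complex.I) / (c (x + y * Complex.I) + l))).re := by
      rw [← Complex.sub_re, hh]
      congr 1
      field_simp
      ring
    rw [hP]
    simp only
    rw [h1, Complex.re_ofReal_mul, Complex.div_re, Complex.sq_norm, Complex.sq_norm,
      Complex.normSq_apply (c (x + y * Complex.I))]
    simp only [Complex.add_re, Complex.ofReal_re, Complex.add_im, Complex.ofReal_im, add_zero]
    field_simp
    ring
  have hP0 : ∀ x, 0 ≤ P x := by
    intro x
    rw [hPeq]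
    have := re_cauchy_nonneg hf h0 (z := x + y * Complex.I) (by simpa using hy)
    positivity
  have hP1 : ∀ x : ℝ, l < ‖c (x + y * Complex.I)‖ → 1 ≤ P x := by
    intro x hx
    have hden' := hden (x + y * Complex.I) (by simpa using hy)
    have hpos : 0 < ‖c (x + y * Complex.I) + l‖ := hl.trans_le hden'
    rw [hPeq, one_le_div (by positivity)]
    have h1 : ‖c (x + y * Complex.I) + l‖ ^ 2
        = ‖c (x + y * Complex.I)‖ ^ 2 + 2 * l * (c (x + y * Complex.I)).re + l ^ 2 := by
      rw [Complex.sq_norm, Complex.sq_norm, Complex.normSq_apply, Complex.normSq_apply]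
      simp only [Complex.add_re, Complex.ofReal_re, Complex.add_im, Complex.ofReal_im, add_zero]
      ring
    rw [h1]
    nlinarith
  have hPint : ∫ x, P x = 2 / l * ∫ x : ℝ, (c (x + y * Complex.I)).re := by
    rw [hP, integral_const_mul, integral_sub hrei hhre]
    have : ∫ x : ℝ, (h (x + y * Complex.I)).re = 0 := by
      have h1 := Complex.reCLM.integral_comp_comm hhi
      rw [hh0] at h1
      simpa using h1
    rw [this, sub_zero]
  calc volume {x : ℝ | l < ‖c (x + y * Complex.I)‖}
      ≤ volume {x : ℝ | 1 ≤ ENNReal.ofReal (P x)} := by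
        refine measure_mono fun x hx => ?_
        have := ENNReal.ofReal_le_ofReal (hP1 x hx)
        rwa [ENNReal.ofReal_one] at this
    _ ≤ ∫⁻ x, ENNReal.ofReal (P x) := by
        have := mul_meas_ge_le_lintegral₀ (μ := volume)
          hPi.aemeasurable.ennreal_ofReal (1 : ℝ≥0∞)
        rwa [one_mul] at this
    _ = ENNReal.ofReal (∫ x, P x) :=
        (ofReal_integral_eq_lintegral_ofReal hPi (ae_of_all _ hP0)).symm
    _ = ENNReal.ofReal (2 / l) *
          ∫⁻ x : ℝ, ENNReal.ofReal (c (x + y * Complex.I)).re := by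
        rw [hPint, ENNReal.ofReal_mul (by positivity),
          ofReal_integral_eq_lintegral_ofReal hrei (ae_of_all _ fun x =>
            re_cauchy_nonneg hf h0 (by simpa using hy))]
    _ = _ := by
        rw [lintegral_re_cauchy hf h0 hy, ← mul_assoc, ← ENNReal.ofReal_mul (by positivity)]
        congr 2
        field_simp

/-- The positive and negative parts of the real and imaginary parts, each at level `l / 4`, give the
constant `4 · 4`. -/
theorem weak_type_complex {f : ℝ → ℂ} (hf : Integrable f) {y l : ℝ} (hy : 0 < y) (hl : 0 < l) :
    volume {x : ℝ | l < ‖cauchy f (x + y * Complex.I)‖}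
      ≤ ENNReal.ofReal (16 / l) * ∫⁻ t, ‖f t‖ₑ := by
  let g : Fin 4 → ℝ → ℝ := ![fun t => max (f t).re 0, fun t => max (-(f t).re) 0,
    fun t => max (f t).im 0, fun t => max (-(f t).im) 0]
  let a : Fin 4 → ℂ := ![1, -1, Complex.I, -Complex.I]
  have hgi : ∀ k, Integrable (g k) := by
    intro k
    fin_cases k
    · exact hf.re.pos_part
    · exact hf.re.neg_part
    · exact hf.im.pos_part
    · exact hf.im.neg_part
  have hg0 : ∀ k t, 0 ≤ g k t := by
    intro k t
    fin_cases k <;> exact le_max_right _ _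
  have hgle : ∀ k t, ENNReal.ofReal (g k t) ≤ ‖f t‖ₑ := by
    intro k t
    rw [← ofReal_norm]
    apply ENNReal.ofReal_le_ofReal
    have h1 := Complex.abs_re_le_norm (f t)
    have h2 := Complex.abs_im_le_norm (f t)
    fin_cases k
    · exact max_le ((le_abs_self _).trans h1) (norm_nonneg _)
    · exact max_le ((neg_le_abs _).trans h1) (norm_nonneg _)
    · exact max_le ((le_abs_self _).trans h2) (norm_nonneg _)
    · exact max_le ((neg_le_abs _).trans h2) (norm_nonneg _)
  have ha : ∀ k, ‖a k‖ = 1 := by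
    intro k
    fin_cases k <;> simp [a]
  have hfe : ∀ t, f t = ∑ k, a k * (g k t : ℂ) := by
    intro t
    have hm : ∀ r : ℝ, max r 0 - max (-r) 0 = r := fun r => by
      rcases le_total 0 r with h | h
      · rw [max_eq_left h, max_eq_right (by linarith)]; ring
      · rw [max_eq_right h, max_eq_left (by linarith)]; ring
    simp only [Fin.sum_univ_four, a, g, Matrix.cons_val]
    apply Complex.ext
    · simp
      linarith [hm (f t).re]
    · simp
      linarith [hm (f t).im]
  have hce : ∀ x : ℝ, cauchy f (x + y * Complex.I)
      = ∑ k, a k * cauchy (fun t => (g k t : ℂ)) (x + y * Complex.I) := by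
    intro x
    have hz : (x + y * Complex.I : ℂ).im ≠ 0 := by simpa using hy.ne'
    have hgc : ∀ k, Integrable fun t => (g k t : ℂ) := fun k => (hgi k).ofReal
    unfold cauchy
    simp only [← integral_const_mul]
    rw [← integral_finsetSum Finset.univ fun k _ =>
      (integrable_cauchyKer_smul (hgc k) hz).const_mul (a k)]
    congr 1
    ext t
    conv_lhs => rw [hfe t]
    rw [Finset.smul_sum]
    refine Finset.sum_congr rfl fun k _ => ?_
    simp only [smul_eq_mul]
    ring
  calc volume {x : ℝ | l < ‖cauchy f (x + y * Complex.I)‖}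
      ≤ volume (⋃ k, {x : ℝ | l / 4 < ‖cauchy (fun t => (g k t : ℂ)) (x + y * Complex.I)‖}) := by
        refine measure_mono fun x hx => ?_
        simp only [mem_iUnion, mem_ofPred_eq] at hx ⊢
        by_contra! hcon
        have : ‖cauchy f (x + y * Complex.I)‖ ≤ l := by
          rw [hce]
          refine (norm_sum_le _ _).trans ?_
          refine (Finset.sum_le_sum (g := fun _ => l / 4) fun k _ => ?_).trans ?_
          · rw [norm_mul, ha, one_mul]
            exact hcon k
          · simp
            linarith
        linarith
    _ ≤ ∑ k, volume {x : ℝ | l / 4 < ‖cauchy (fun t => (g k t : ℂ)) (x + y * Complex.I)‖} :=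
        measure_iUnion_fintype_le _ _
    _ ≤ ∑ _k : Fin 4, ENNReal.ofReal (1 / (l / 4)) * ∫⁻ t, ‖f t‖ₑ := by
        refine Finset.sum_le_sum fun k _ => ?_
        refine (weak_type_of_nonneg (hgi k) (hg0 k) hy (by positivity)).trans ?_
        gcongr
        exact hgle k _
    _ = _ := by
        rw [Finset.sum_const, Finset.card_univ, Fintype.card_fin, nsmul_eq_mul, ← mul_assoc]
        congr 1
        rw [Nat.cast_ofNat, ← ENNReal.ofReal_ofNat, ← ENNReal.ofReal_mul (by positivity)]
        congr 1
        field_simp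
        norm_num

variable {n : ℕ}

/-- The weak type `(1, 1)` inequality for regularized Cauchy integrals, uniform in the height. -/
theorem weak_type {f : ℝ → EuclideanSpace ℂ (Fin n)} (hf : Integrable f) {y l : ℝ} (hy : 0 < y)
    (hl : 0 < l) :
    volume {x : ℝ | l < ‖cauchy f (x + y * Complex.I)‖}
      ≤ ENNReal.ofReal (16 * (n + 1) ^ 2 / l) * ∫⁻ t, ‖f t‖ₑ := by
  have hcoord : ∀ (v : EuclideanSpace ℂ (Fin n)) i, ‖v i‖ ≤ ‖v‖ := fun v i =>
    PiLp.norm_apply_le v i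
  -- If all `n` coordinates are at most `l / (n + 1)`, the norm is at most `l`. Dividing by `n + 1`
  -- keeps the level meaningful for `n = 0`.
  calc volume {x : ℝ | l < ‖cauchy f (x + y * Complex.I)‖}
      ≤ volume (⋃ i, {x : ℝ | l / (n + 1) < ‖cauchy (fun t => f t i) (x + y * Complex.I)‖}) := by
        refine measure_mono fun x hx => ?_
        simp only [mem_iUnion, mem_ofPred_eq] at hx ⊢
        by_contra! hcon
        have hz : (x + y * Complex.I : ℂ).im ≠ 0 := by simpa using hy.ne'
        have h1 : ∀ v : EuclideanSpace ℂ (Fin n), ‖v‖ ≤ ∑ i, ‖v i‖ := by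
          intro v
          have hv : v = ∑ i, EuclideanSpace.single i (v i) := by
            ext j
            simp [Finset.sum_apply, Pi.single_apply]
          conv_lhs => rw [hv]
          refine (norm_sum_le _ _).trans (le_of_eq ?_)
          simp
        have h2 := h1 (cauchy f (x + y * Complex.I))
        have h3 : ∑ i, ‖cauchy f (x + y * Complex.I) i‖ ≤ ∑ _i : Fin n, l / (n + 1) := by
          refine Finset.sum_le_sum fun i _ => ?_
          rw [cauchy_apply hf hz]
          exact hcon i
        have h4 : ∑ _i : Fin n, l / ((n : ℝ) + 1) ≤ l := by
          rw [Finset.sum_const, Finset.card_univ, Fintype.card_fin, nsmul_eq_mul,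
            mul_div_assoc', div_le_iff₀ (by positivity)]
          nlinarith
        linarith
    _ ≤ ∑ i, volume {x : ℝ | l / (n + 1) < ‖cauchy (fun t => f t i) (x + y * Complex.I)‖} :=
        measure_iUnion_fintype_le _ _
    _ ≤ ∑ _i : Fin n, ENNReal.ofReal (16 / (l / (n + 1))) * ∫⁻ t, ‖f t‖ₑ := by
        refine Finset.sum_le_sum fun i _ => ?_
        refine (weak_type_complex (integrable_coord hf i) hy (by positivity)).trans ?_
        gcongr with t
        rw [← ofReal_norm, ← ofReal_norm]
        exact ENNReal.ofReal_le_ofReal (hcoord (f t) i)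
    _ ≤ _ := by
        rw [Finset.sum_const, Finset.card_univ, Fintype.card_fin, nsmul_eq_mul, ← mul_assoc]
        gcongr
        rw [← ENNReal.ofReal_natCast, ← ENNReal.ofReal_mul (by positivity)]
        apply ENNReal.ofReal_le_ofReal
        rw [div_div_eq_mul_div, ← mul_div_assoc, div_le_div_iff_of_pos_right hl]
        nlinarith [(Nat.cast_nonneg n : (0 : ℝ) ≤ n)]

end WeakType

/-! ### The centred maximal function and its control of Poisson averages. -/

section Maximal

/-- The points where the centered maximal function of `φ` exceeds `l`. -/
def maximalSet (φ : ℝ → ℝ≥0∞) (l : ℝ) : Set ℝ :=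
  {x | ∃ ρ : ℝ, 0 < ρ ∧ ENNReal.ofReal (l * ρ) < ∫⁻ t in Metric.ball x ρ, φ t}

/-- Vitali covering: the fourfold enlargements of disjoint selected balls cover the set, and each
has length `8ρ`, at most `8 / l` times the mass of its ball. The radii are bounded since `lρ` is
less than the total mass. -/
theorem volume_maximalSet_le {φ : ℝ → ℝ≥0∞} {l : ℝ} (hl : 0 < l) (hφ : ∫⁻ t, φ t ≠ ⊤) :
    volume (maximalSet φ l) ≤ ENNReal.ofReal (8 / l) * ∫⁻ t, φ t := by
  choose! ρ hρ0 hρ using fun x (hx : x ∈ maximalSet φ l) => hx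
  obtain ⟨u, hut, hud, hcov⟩ := Vitali.exists_disjoint_subfamily_covering_enlargement_ball
    (maximalSet φ l) (fun x : ℝ => x) ρ ((∫⁻ t, φ t).toReal / l) (fun x hx => by
      rw [le_div_iff₀ hl, mul_comm]
      have h1 := (hρ x hx).le.trans (setLIntegral_le_lintegral _ _)
      exact (ENNReal.ofReal_le_iff_le_toReal hφ).1 h1) 4 (by norm_num)
  have hcount : u.Countable := hud.countable_of_isOpen (fun _ _ => Metric.isOpen_ball)
    (fun x hx => Metric.nonempty_ball.2 (hρ0 x (hut hx)))
  calc volume (maximalSet φ l)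
      ≤ volume (⋃ b ∈ u, Metric.ball b (4 * ρ b)) := by
        refine measure_mono fun x hx => ?_
        obtain ⟨b, hb, hsub⟩ := hcov x hx
        exact mem_biUnion hb (hsub (Metric.mem_ball_self (hρ0 x hx)))
    _ ≤ ∑' b : u, volume (Metric.ball (b : ℝ) (4 * ρ b)) := measure_biUnion_le _ hcount _
    _ ≤ ∑' b : u, ENNReal.ofReal (8 / l) * ∫⁻ t in Metric.ball (b : ℝ) (ρ b), φ t := by
        refine ENNReal.tsum_le_tsum fun b => ?_
        have h1 := (hρ b (hut b.2)).le
        rw [Real.volume_ball]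
        calc ENNReal.ofReal (2 * (4 * ρ b)) = ENNReal.ofReal (8 / l) * ENNReal.ofReal (l * ρ b) := by
              rw [← ENNReal.ofReal_mul (by positivity)]
              congr 1
              field_simp
              ring
          _ ≤ _ := by gcongr
    _ = ENNReal.ofReal (8 / l) * ∑' b : u, ∫⁻ t in Metric.ball (b : ℝ) (ρ b), φ t :=
        ENNReal.tsum_mul_left
    _ = ENNReal.ofReal (8 / l) * ∫⁻ t in ⋃ b ∈ u, Metric.ball b (ρ b), φ t := by
        rw [lintegral_biUnion hcount (fun _ _ => Metric.isOpen_ball.measurableSet) hud]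
    _ ≤ _ := by
        exact mul_le_mul' le_rfl (setLIntegral_le_lintegral _ _)

/-- On the annulus where `|x - t|` is between `2^(k-1) ℓ` and `2^k ℓ` the kernel is at most `4 · 4⁻ᵏ
/ ℓ`, while the ball of radius `2^k ℓ` has mass at most `l 2^k ℓ`. The geometric series sums to `8
l`. -/
theorem lintegral_poisson_le {φ : ℝ → ℝ≥0∞} (hφ : AEMeasurable φ) {l x : ℝ} (hl : 0 < l)
    (hx : x ∉ maximalSet φ l) {ℓ : ℝ} (hℓ : 0 < ℓ) :
    ∫⁻ t, ENNReal.ofReal (ℓ / (ℓ ^ 2 + (x - t) ^ 2)) * φ t ≤ ENNReal.ofReal (8 * l) := by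
  have hball : ∀ ρ : ℝ, 0 < ρ → ∫⁻ t in Metric.ball x ρ, φ t ≤ ENNReal.ofReal (l * ρ) := by
    intro ρ hρ
    by_contra! hcon
    exact hx ⟨ρ, hρ, hcon⟩
  have hpt : ∀ t, ENNReal.ofReal (ℓ / (ℓ ^ 2 + (x - t) ^ 2)) * φ t ≤
      ∑' k : ℕ, ENNReal.ofReal (4 / ℓ * (1 / 4) ^ k) *
        (Metric.ball x (2 ^ k * ℓ)).indicator φ t := by
    intro t
    have hex : ∃ k : ℕ, |x - t| < 2 ^ k * ℓ := by
      obtain ⟨k, hk⟩ := pow_unbounded_of_one_lt (|x - t| / ℓ) (one_lt_two (α := ℝ))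
      exact ⟨k, (div_lt_iff₀ hℓ).1 hk⟩
    classical
    set k := Nat.find hex with hk
    have hk1 : |x - t| < 2 ^ k * ℓ := Nat.find_spec hex
    refine le_trans ?_ (ENNReal.le_tsum k)
    have hmem : t ∈ Metric.ball x (2 ^ k * ℓ) := by
      rw [Metric.mem_ball, Real.dist_eq, abs_sub_comm]
      exact hk1
    rw [indicator_of_mem hmem]
    gcongr
    rcases Nat.eq_zero_or_pos k with h0 | h0
    · rw [h0, pow_zero, mul_one]
      rw [div_le_div_iff₀ (by positivity) hℓ]
      nlinarith [sq_nonneg (x - t)]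
    · have h2 : 2 ^ (k - 1) * ℓ ≤ |x - t| := by
        by_contra! hcon
        exact Nat.find_min hex (Nat.sub_lt h0 one_pos) hcon
      obtain ⟨j, hj⟩ : ∃ j, k = j + 1 := ⟨k - 1, by omega⟩
      rw [hj, Nat.add_sub_cancel] at h2
      have h3 : (2 ^ j * ℓ) ^ 2 ≤ (x - t) ^ 2 := by
        rw [← sq_abs (x - t)]
        gcongr
      rw [hj, show (4 / ℓ * (1 / 4) ^ (j + 1) : ℝ) = 1 / (ℓ * 4 ^ j) by
        rw [one_div_pow, pow_succ]; field_simp, div_le_div_iff₀ (by positivity) (by positivity)]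
      have h4 : (2 ^ j * ℓ) ^ 2 = ℓ * (ℓ * 4 ^ j) := by
        rw [mul_pow, ← pow_mul, mul_comm j 2, pow_mul]
        norm_num
        ring
      nlinarith [sq_nonneg ℓ]
  calc ∫⁻ t, ENNReal.ofReal (ℓ / (ℓ ^ 2 + (x - t) ^ 2)) * φ t
      ≤ ∫⁻ t, ∑' k : ℕ, ENNReal.ofReal (4 / ℓ * (1 / 4) ^ k) *
        (Metric.ball x (2 ^ k * ℓ)).indicator φ t := lintegral_mono hpt
    _ = ∑' k : ℕ, ∫⁻ t, ENNReal.ofReal (4 / ℓ * (1 / 4) ^ k) *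
        (Metric.ball x (2 ^ k * ℓ)).indicator φ t :=
        lintegral_tsum fun k => (hφ.indicator Metric.isOpen_ball.measurableSet).const_mul _
    _ ≤ ∑' k : ℕ, ENNReal.ofReal (4 * l * (1 / 2) ^ k) := by
        refine ENNReal.tsum_le_tsum fun k => ?_
        rw [lintegral_const_mul' _ _ ENNReal.ofReal_ne_top,
          lintegral_indicator Metric.isOpen_ball.measurableSet]
        refine (mul_le_mul' le_rfl (hball _ (by positivity))).trans (le_of_eq ?_)
        rw [← ENNReal.ofReal_mul (by positivity)]
        congr 1
        have : ((1 : ℝ) / 4) ^ k * 2 ^ k = (1 / 2) ^ k := by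
          rw [← mul_pow]
          norm_num
        rw [← this]
        field_simp
    _ = ENNReal.ofReal (8 * l) := by
        have hs : HasSum (fun k : ℕ => 4 * l * (1 / 2 : ℝ) ^ k) (4 * l * 2) :=
          hasSum_geometric_two.mul_left _
        rw [← ENNReal.ofReal_tsum_of_nonneg (fun k => by positivity) hs.summable, hs.tsum_eq]
        congr 1
        ring

end Maximal

end MatrixA2

end

noncomputable section

namespace MatrixA2

/-! ### Dyadic cells and stopping cells. -/

section Cells

/-- The half-open interval number `c.2` of length `2 ^ c.1 * r` in the dyadic grid with
origin `t`. -/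
def cell (t r : ℝ) (c : ℕ × ℤ) : Set ℝ :=
  Ico (t + c.2 * (2 ^ c.1 * r)) (t + (c.2 + 1) * (2 ^ c.1 * r))

/-- The concentric interval of three times the length of `cell t r c`. -/
def tripleCell (t r : ℝ) (c : ℕ × ℤ) : Set ℝ :=
  Ico (t + (c.2 - 1) * (2 ^ c.1 * r)) (t + (c.2 + 2) * (2 ^ c.1 * r))

variable {t r : ℝ}

theorem measurableSet_cell (c : ℕ × ℤ) : MeasurableSet (cell t r c) := measurableSet_Ico

theorem measurableSet_tripleCell (c : ℕ × ℤ) : MeasurableSet (tripleCell t r c) :=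
  measurableSet_Ico

theorem volume_cell (c : ℕ × ℤ) : volume (cell t r c) = ENNReal.ofReal (2 ^ c.1 * r) := by
  rw [cell, Real.volume_Ico]
  congr 1
  ring

theorem mem_cell_iff (hr : 0 < r) {c : ℕ × ℤ} {x : ℝ} :
    x ∈ cell t r c ↔ ⌊(x - t) / (2 ^ c.1 * r)⌋ = c.2 := by
  have h : 0 < 2 ^ c.1 * r := by positivity
  rw [Int.floor_eq_iff, le_div_iff₀ h, div_lt_iff₀ h, cell, mem_Ico]
  constructor <;> rintro ⟨h1, h2⟩ <;> constructor <;> linarith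

theorem cell_nonempty (hr : 0 < r) (c : ℕ × ℤ) : (cell t r c).Nonempty := by
  refine nonempty_Ico.2 ?_
  have : 0 < 2 ^ c.1 * r := by positivity
  linarith

theorem cell_bounds {c : ℕ × ℤ} {x x' : ℝ} (hx : x ∈ cell t r c) (hx' : x' ∈ cell t r c) :
    |x - x'| < 2 ^ c.1 * r := by
  obtain ⟨h1, h2⟩ := hx
  obtain ⟨h3, h4⟩ := hx'
  rw [abs_lt]
  constructor <;> linarith

theorem cell_succ_left (hr : 0 < r) (d : ℕ) (m : ℤ) :
    cell t r (d, 2 * m) ⊆ cell t r (d + 1, m) := by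
  have : 0 < 2 ^ d * r := by positivity
  unfold cell
  simp only
  rw [pow_succ]
  push_cast
  exact Ico_subset_Ico (by linarith) (by linarith)

theorem cell_succ_right (hr : 0 < r) (d : ℕ) (m : ℤ) :
    cell t r (d, 2 * m + 1) ⊆ cell t r (d + 1, m) := by
  have : 0 < 2 ^ d * r := by positivity
  unfold cell
  simp only
  rw [pow_succ]
  push_cast
  exact Ico_subset_Ico (by linarith) (by linarith)

theorem cell_disjoint (hr : 0 < r) (d : ℕ) {m m' : ℤ} (h : m ≠ m') :
    Disjoint (cell t r (d, m)) (cell t r (d, m')) := by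
  rw [disjoint_left]
  intro x hx hx'
  rw [mem_cell_iff hr] at hx hx'
  exact h (hx.symm.trans hx')

theorem mem_cell_succ (d : ℕ) {m : ℤ} {x : ℝ} (hx : x ∈ cell t r (d + 1, m)) :
    x ∈ cell t r (d, 2 * m) ∨ x ∈ cell t r (d, 2 * m + 1) := by
  obtain ⟨h1, h2⟩ := hx
  simp only [pow_succ] at h1 h2
  rcases lt_or_ge x (t + (2 * m + 1) * (2 ^ d * r)) with h | h
  · left
    refine ⟨?_, ?_⟩ <;> push_cast <;> linarith
  · right
    refine ⟨?_, ?_⟩ <;> push_cast <;> linarith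

theorem tripleCell_subset (hr : 0 < r) {c c' : ℕ × ℤ} (h : cell t r c ⊆ cell t r c')
    (hle : c.1 ≤ c'.1) : tripleCell t r c ⊆ tripleCell t r c' := by
  have hpos : 0 < 2 ^ c.1 * r := by positivity
  have hle' : (2 : ℝ) ^ c.1 * r ≤ 2 ^ c'.1 * r := by
    gcongr
    norm_num
  obtain ⟨h1, h2⟩ := (Ico_subset_Ico_iff (by linarith)).1 h
  exact Ico_subset_Ico (by linarith) (by linarith)

theorem cell_subset_tripleCell (hr : 0 < r) (c : ℕ × ℤ) : cell t r c ⊆ tripleCell t r c := by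
  have hpos : 0 < 2 ^ c.1 * r := by positivity
  exact Ico_subset_Ico (by linarith) (by linarith)

/-- Selection of the maximal bad cells below a cell that is not bad. -/
theorem exists_stopping_cells (hr : 0 < r) (bad : ℕ × ℤ → Prop) (d : ℕ) (m : ℤ)
    (hbad : ¬ bad (d, m)) :
    ∃ J : Finset (ℕ × ℤ),
      (∀ c ∈ J, bad c ∧ cell t r c ⊆ cell t r (d, m) ∧ c.1 < d ∧
        ∃ p : ℕ × ℤ, p.1 = c.1 + 1 ∧ cell t r c ⊆ cell t r p ∧
          cell t r p ⊆ cell t r (d, m) ∧ p.1 ≤ d ∧ ¬ bad p) ∧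
      (J : Set (ℕ × ℤ)).PairwiseDisjoint (cell t r) ∧
      ∀ x ∈ cell t r (d, m), (∃ c ∈ J, x ∈ cell t r c) ∨
        ∃ k : ℤ, x ∈ cell t r (0, k) ∧ ¬ bad (0, k) := by
  induction d generalizing m with
  | zero => exact ⟨∅, by simp, by simp, fun x hx => Or.inr ⟨m, hx, hbad⟩⟩
  | succ d ih =>
    -- A bad half is selected whole, with the present cell as its good parent. A half that is not
    -- bad is handled by induction.
    have hchild : ∀ m' : ℤ, cell t r (d, m') ⊆ cell t r (d + 1, m) →
        ∃ J : Finset (ℕ × ℤ),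
        (∀ c ∈ J, cell t r c ⊆ cell t r (d, m') ∧ bad c ∧ cell t r c ⊆ cell t r (d + 1, m) ∧
          c.1 < d + 1 ∧ ∃ p : ℕ × ℤ, p.1 = c.1 + 1 ∧ cell t r c ⊆ cell t r p ∧
            cell t r p ⊆ cell t r (d + 1, m) ∧ p.1 ≤ d + 1 ∧ ¬ bad p) ∧
        (J : Set (ℕ × ℤ)).PairwiseDisjoint (cell t r) ∧
        ∀ x ∈ cell t r (d, m'), (∃ c ∈ J, x ∈ cell t r c) ∨
          ∃ k : ℤ, x ∈ cell t r (0, k) ∧ ¬ bad (0, k) := by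
      intro m' hsub
      by_cases hb : bad (d, m')
      · refine ⟨{(d, m')}, ?_, by simp, fun x hx => Or.inl ⟨_, by simp, hx⟩⟩
        intro c hc
        rw [Finset.mem_singleton] at hc
        subst hc
        exact ⟨le_rfl, hb, hsub, Nat.lt_succ_self d, (d + 1, m), rfl, hsub, le_rfl, le_rfl, hbad⟩
      · obtain ⟨J, h1, h2, h3⟩ := ih m' hb
        refine ⟨J, fun c hc => ?_, h2, h3⟩
        obtain ⟨hb', hs, hlt, p, hp1, hp2, hp3, hp4, hp5⟩ := h1 c hc
        exact ⟨hs, hb', hs.trans hsub, by omega, p, hp1, hp2, hp3.trans hsub, by omega, hp5⟩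
    obtain ⟨J₀, h₀, hd₀, hc₀⟩ := hchild _ (cell_succ_left hr d m)
    obtain ⟨J₁, h₁, hd₁, hc₁⟩ := hchild _ (cell_succ_right hr d m)
    classical
    refine ⟨J₀ ∪ J₁, ?_, ?_, ?_⟩
    · intro c hc
      rcases Finset.mem_union.1 hc with h | h
      · exact (h₀ c h).2
      · exact (h₁ c h).2
    · rw [Finset.coe_union, pairwiseDisjoint_union]
      refine ⟨hd₀, hd₁, fun c hc c' hc' _ => ?_⟩
      exact (cell_disjoint hr d (by omega)).mono (h₀ c hc).1 (h₁ c' hc').1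
    · intro x hx
      rcases mem_cell_succ d hx with h | h
      · rcases hc₀ x h with ⟨c, hc, hxc⟩ | h'
        · exact Or.inl ⟨c, Finset.mem_union_left _ hc, hxc⟩
        · exact Or.inr h'
      · rcases hc₁ x h with ⟨c, hc, hxc⟩ | h'
        · exact Or.inl ⟨c, Finset.mem_union_right _ hc, hxc⟩
        · exact Or.inr h'

end Cells

/-! ### Pointwise estimates for differences of Cauchy integrals. -/

section Oscillation

variable {V : Type*} [NormedAddCommGroup V] [NormedSpace ℂ V]

theorem norm_cauchyKer_sub (x x' : ℝ) {y : ℝ} (hy : 0 < y) (t : ℝ) :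
    ‖cauchyKer (x + y * Complex.I - t) - cauchyKer (x' + y * Complex.I - t)‖
      = |x - x'| / (2 * Real.pi * ‖(x + y * Complex.I - t : ℂ)‖ * ‖(x' + y * Complex.I - t : ℂ)‖) := by
  have h1 : (x + y * Complex.I - t : ℂ) ≠ 0 := fun h => by
    have := congrArg Complex.im h
    simp at this
    linarith
  have h2 : (x' + y * Complex.I - t : ℂ) ≠ 0 := fun h => by
    have := congrArg Complex.im h
    simp at this
    linarith
  have h3 : cauchyKer (x + y * Complex.I - t) - cauchyKer (x' + y * Complex.I - t)
      = cauchyKer (x + y * Complex.I - t) * ((x' - x : ℝ) / (x' + y * Complex.I - t)) := by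
    unfold cauchyKer
    have h4 : ((x' - x : ℝ) : ℂ) = (x' + y * Complex.I - t) - (x + y * Complex.I - t) := by
      push_cast
      ring
    rw [h4]
    generalize (x + y * Complex.I - t : ℂ) = a at *
    generalize (x' + y * Complex.I - t : ℂ) = b at *
    field_simp
  rw [h3, norm_mul, norm_cauchyKer, norm_div, Complex.norm_real, Real.norm_eq_abs, abs_sub_comm]
  field_simp

/-- The kernel bound is asked only where `f` does not vanish, so that support information can be
used in it. -/
theorem enorm_integral_kernel_le {K : ℝ → ℂ} {f : ℝ → V} {w : ℝ → ℝ}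
    (h : ∀ t, f t ≠ 0 → ‖K t‖ ≤ w t) :
    ‖∫ t, K t • f t‖ₑ ≤ ∫⁻ t, ENNReal.ofReal (w t) * ‖f t‖ₑ := by
  refine (enorm_integral_le_lintegral_enorm _).trans (lintegral_mono fun t => ?_)
  by_cases ht : f t = 0
  · simp [ht]
  · rw [enorm_smul, ← ofReal_norm (K t)]
    gcongr
    exact h t ht

theorem abs_sub_le_norm_line (x y t : ℝ) : |x - t| ≤ ‖(x + y * Complex.I - t : ℂ)‖ := by
  have := Complex.abs_re_le_norm (x + y * Complex.I - t : ℂ)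
  simpa using this

theorem sq_norm_line (x y t : ℝ) :
    ‖(x + y * Complex.I - t : ℂ)‖ ^ 2 = y ^ 2 + (x - t) ^ 2 := by
  have : (x + y * Complex.I - t : ℂ) = (x - t : ℝ) + y * Complex.I := by
    push_cast
    ring
  rw [this, norm_add_mul_I, add_comm]

theorem cauchy_sub_eq {f : ℝ → V} (hf : Integrable f) {y : ℝ} (hy : 0 < y) (x x' : ℝ) :
    cauchy f (x + y * Complex.I) - cauchy f (x' + y * Complex.I)
      = ∫ t : ℝ, (cauchyKer (x + y * Complex.I - t) - cauchyKer (x' + y * Complex.I - t)) • f t := by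
  unfold cauchy
  rw [← integral_sub (integrable_cauchyKer_smul hf (by simpa using hy.ne'))
    (integrable_cauchyKer_smul hf (by simpa using hy.ne'))]
  simp only [sub_smul]

/-- At scales below the height the kernel is smooth: the distances of `x + iy` and `x' + iy` to any
real `t` are comparable, so the difference of kernels is a Poisson kernel at height `y`. -/
theorem enorm_cauchy_sub_le_of_dist_le {f : ℝ → V} (hf : Integrable f) {x x' y : ℝ} (hy : 0 < y)
    (hx : |x - x'| ≤ y) :
    ‖cauchy f (x + y * Complex.I) - cauchy f (x' + y * Complex.I)‖ₑ
      ≤ ∫⁻ t, ENNReal.ofReal (y / (y ^ 2 + (x' - t) ^ 2)) * ‖f t‖ₑ := by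
  rw [cauchy_sub_eq hf hy]
  refine enorm_integral_kernel_le fun t _ => ?_
  rw [norm_cauchyKer_sub x x' hy, ← sq_norm_line]
  set a := ‖(x + y * Complex.I - t : ℂ)‖ with ha
  set b := ‖(x' + y * Complex.I - t : ℂ)‖ with hb
  have hya : y ≤ a := by
    have := Complex.abs_im_le_norm (x + y * Complex.I - t : ℂ)
    simp only [Complex.sub_im, Complex.add_im, Complex.ofReal_im, Complex.mul_im,
      Complex.ofReal_re, Complex.I_im, Complex.I_re] at this
    rw [← ha] at this
    refine le_trans ?_ this
    simp [le_abs_self]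
  have hyb : y ≤ b := by
    have := Complex.abs_im_le_norm (x' + y * Complex.I - t : ℂ)
    simp only [Complex.sub_im, Complex.add_im, Complex.ofReal_im, Complex.mul_im,
      Complex.ofReal_re, Complex.I_im, Complex.I_re] at this
    rw [← hb] at this
    refine le_trans ?_ this
    simp [le_abs_self]
  have hab : b ≤ 2 * a := by
    have h1 : (x' + y * Complex.I - t : ℂ) = (x + y * Complex.I - t) - (x - x' : ℝ) := by
      push_cast
      ring
    have h2 : b ≤ a + |x - x'| := by
      rw [hb, h1]
      refine (norm_sub_le _ _).trans ?_
      rw [Complex.norm_real, Real.norm_eq_abs]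
    linarith
  have ha0 : 0 < a := by linarith
  have hb0 : 0 < b := by linarith
  rw [div_le_div_iff₀ (by positivity) (by positivity)]
  have h3 : |x - x'| * b ^ 2 ≤ y * b ^ 2 := by gcongr
  have h4 : b ^ 2 ≤ 2 * a * b := by nlinarith
  have h5 : 2 * a * b ≤ 2 * Real.pi * a * b := by nlinarith [Real.pi_gt_three, mul_pos ha0 hb0]
  have h6 : y * b ^ 2 ≤ y * (2 * Real.pi * a * b) := by gcongr; linarith
  linarith

/-- Here the distance `ℓ` to the support plays the part of the height, so the bound does not depend
on `y`. -/
theorem enorm_cauchy_sub_le_of_far {f : ℝ → V} (hf : Integrable f) {x x' y a ℓ : ℝ} (hy : 0 < y)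
    (hℓ : 0 < ℓ) (hx : x ∈ Ico a (a + ℓ)) (hx' : x' ∈ Ico a (a + ℓ))
    (hsupp : ∀ t ∈ Ico (a - ℓ) (a + 2 * ℓ), f t = 0) :
    ‖cauchy f (x + y * Complex.I) - cauchy f (x' + y * Complex.I)‖ₑ
      ≤ ∫⁻ t, ENNReal.ofReal (ℓ / (ℓ ^ 2 + (x' - t) ^ 2)) * ‖f t‖ₑ := by
  rw [cauchy_sub_eq hf hy]
  refine enorm_integral_kernel_le fun t ht => ?_
  have hout : t < a - ℓ ∨ a + 2 * ℓ ≤ t := by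
    by_contra! hcon
    exact ht (hsupp t hcon)
  obtain ⟨hx1, hx2⟩ := hx
  obtain ⟨hx1', hx2'⟩ := hx'
  have h1 : ℓ ≤ |x - t| := by
    rcases hout with h | h
    · rw [abs_of_pos (by linarith)]; linarith
    · rw [abs_of_neg (by linarith)]; linarith
  have h2 : ℓ ≤ |x' - t| := by
    rcases hout with h | h
    · rw [abs_of_pos (by linarith)]; linarith
    · rw [abs_of_neg (by linarith)]; linarith
  have h3 : |x' - t| ≤ 2 * |x - t| := by
    have h4 : |x' - x| ≤ ℓ := by rw [abs_le]; constructor <;> linarith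
    have h5 : |x' - t| ≤ |x' - x| + |x - t| := abs_sub_le _ _ _
    linarith
  have h4 : |x - x'| ≤ ℓ := by rw [abs_le]; constructor <;> linarith
  rw [norm_cauchyKer_sub x x' hy, ← sq_abs (x' - t)]
  have hn1 := abs_sub_le_norm_line x y t
  have hn2 := abs_sub_le_norm_line x' y t
  have hp1 : 0 < |x - t| := by linarith
  have hp2 : 0 < |x' - t| := by linarith
  calc |x - x'| / (2 * Real.pi * ‖(x + y * Complex.I - t : ℂ)‖ * ‖(x' + y * Complex.I - t : ℂ)‖)
      ≤ ℓ / (2 * Real.pi * |x - t| * |x' - t|) := by gcongr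
    _ ≤ ℓ / (ℓ ^ 2 + |x' - t| ^ 2) := by
        apply div_le_div_of_nonneg_left hℓ.le (by positivity)
        have h6 : |x' - t| ^ 2 ≤ 2 * (|x - t| * |x' - t|) := by nlinarith
        have h7 : ℓ ^ 2 ≤ |x - t| * |x' - t| := by nlinarith
        nlinarith [Real.pi_gt_three, mul_pos hp1 hp2]

/-- The support lies in the triple of a parent interval but off the triple of its child. There the
kernel at `x` is at most of order `1 / ℓ`, and so is the Poisson kernel centred at `x'` from below,
because `|x' - t| ≤ 2ℓ`. -/
theorem enorm_cauchy_le_of_near {f : ℝ → V} {x x' y a b ℓ : ℝ}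
    (hℓ : 0 < ℓ) (hx : x ∈ Ico b (b + ℓ / 2)) (hx' : x' ∈ Ico a (a + ℓ))
    (hsupp : ∀ t, f t ≠ 0 → t ∈ Ico (a - ℓ) (a + 2 * ℓ) ∧ t ∉ Ico (b - ℓ / 2) (b + ℓ)) :
    ‖cauchy f (x + y * Complex.I)‖ₑ
      ≤ ∫⁻ t, ENNReal.ofReal (2 * (ℓ / (ℓ ^ 2 + (x' - t) ^ 2))) * ‖f t‖ₑ := by
  refine enorm_integral_kernel_le fun t ht => ?_
  obtain ⟨⟨h1, h2⟩, h3⟩ := hsupp t ht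
  obtain ⟨hx1, hx2⟩ := hx
  obtain ⟨hx1', hx2'⟩ := hx'
  have hout : t < b - ℓ / 2 ∨ b + ℓ ≤ t := by
    by_contra! hcon
    exact h3 hcon
  have h4 : ℓ / 2 ≤ |x - t| := by
    rcases hout with h | h
    · rw [abs_of_pos (by linarith)]; linarith
    · rw [abs_of_neg (by linarith)]; linarith
  have h5 : |x' - t| ≤ 2 * ℓ := by rw [abs_le]; constructor <;> linarith
  have h6 : (x' - t) ^ 2 ≤ 4 * ℓ ^ 2 := by
    rw [← sq_abs]
    nlinarith [abs_nonneg (x' - t)]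
  rw [norm_cauchyKer]
  have hn := abs_sub_le_norm_line x y t
  calc (2 * Real.pi * ‖(x + y * Complex.I - t : ℂ)‖)⁻¹ ≤ (2 * Real.pi * (ℓ / 2))⁻¹ := by
        gcongr
        linarith
    _ ≤ 2 * (ℓ / (5 * ℓ ^ 2)) := by
        rw [inv_eq_one_div, mul_div_assoc' 2 ℓ, div_le_div_iff₀ (by positivity) (by positivity)]
        nlinarith [Real.pi_gt_three, sq_pos_of_pos hℓ]
    _ ≤ 2 * (ℓ / (ℓ ^ 2 + (x' - t) ^ 2)) := by
        gcongr
        linarith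

end Oscillation

end MatrixA2

end

noncomputable section

namespace MatrixA2

/-! ### One step of the stopping time argument. -/

section LocalStep

variable {n : ℕ}

theorem cauchy_add {V : Type*} [NormedAddCommGroup V] [NormedSpace ℂ V] {f g : ℝ → V}
    (hf : Integrable f) (hg : Integrable g) {z : ℂ} (hz : z.im ≠ 0) :
    cauchy (f + g) z = cauchy f z + cauchy g z := by
  unfold cauchy
  rw [← integral_add (integrable_cauchyKer_smul hf hz) (integrable_cauchyKer_smul hg hz)]
  simp only [Pi.add_apply, smul_add]

theorem cauchy_eq_zero {V : Type*} [NormedAddCommGroup V] [NormedSpace ℂ V] {f : ℝ → V}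
    (hf : f =ᵐ[volume] 0) (z : ℂ) : cauchy f z = 0 := by
  unfold cauchy
  refine integral_eq_zero_of_ae ?_
  filter_upwards [hf] with t ht
  simp [ht]

theorem indicator_eq_add_indicator_diff {α V : Type*} [AddCommMonoid V] {S T : Set α}
    (h : S ⊆ T) (f : α → V) : T.indicator f = S.indicator f + (T \ S).indicator f := by
  classical
  ext t
  by_cases hS : t ∈ S
  · simp [hS, h hS]
  · by_cases hT : t ∈ T <;> simp [hS, hT]

theorem lintegral_enorm_eq_ofReal {V : Type*} [NormedAddCommGroup V] {f : ℝ → V}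
    (hf : Integrable f) : ∫⁻ t, ‖f t‖ₑ = ENNReal.ofReal (∫ t, ‖f t‖) :=
  (ofReal_integral_norm_eq_lintegral_enorm hf).symm

theorem ae_eq_zero_of_integral_norm {V : Type*} [NormedAddCommGroup V] {f : ℝ → V}
    (hf : Integrable f) (h : ∫ t, ‖f t‖ = 0) : f =ᵐ[volume] 0 := by
  filter_upwards [(integral_eq_zero_iff_of_nonneg (fun t => norm_nonneg (f t)) hf.norm).1 h]
    with t ht
  simpa using ht

/-- Choosing the level proportional to the average makes the weak type bound proportional to `ℓ`,
whatever the mass of `f`. Mass zero is separate, as the weak type inequality needs a positive level.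
-/
theorem volume_gt_mul_average_le {f : ℝ → EuclideanSpace ℂ (Fin n)} (hf : Integrable f)
    {y ℓ K : ℝ} (hy : 0 < y) (hℓ : 0 < ℓ) (hK : 0 < K) :
    volume {x : ℝ | K * (∫ t, ‖f t‖) / ℓ < ‖cauchy f (x + y * Complex.I)‖}
      ≤ ENNReal.ofReal (16 * (n + 1) ^ 2 / K * ℓ) := by
  have hnn : 0 ≤ ∫ t, ‖f t‖ := integral_nonneg fun t => norm_nonneg (f t)
  rcases hnn.eq_or_lt' with h | h
  · have hz := cauchy_eq_zero (ae_eq_zero_of_integral_norm hf h)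
    simp [hz, h]
  · refine (weak_type hf hy (by positivity)).trans (le_of_eq ?_)
    rw [lintegral_enorm_eq_ofReal hf, ← ENNReal.ofReal_mul (by positivity)]
    congr 1
    field_simp

/-- The threshold of the stopping condition. -/
def stopConst (n : ℕ) : ℝ := 8 * (16 * (n + 1) ^ 2 + 8)

theorem stopConst_pos (n : ℕ) : 0 < stopConst n := by
  unfold stopConst
  positivity

/-- `stopConst` is eight times the sum of the weak type constants of the Cauchy integral and of the
maximal function, so the exceptional set takes at most an eighth of the length. -/
theorem weakConst_div_le (n : ℕ) {ℓ : ℝ} (hℓ : 0 < ℓ) :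
    16 * ((n : ℝ) + 1) ^ 2 / stopConst n * ℓ + 8 / stopConst n * ℓ = ℓ / 8 := by
  unfold stopConst
  field_simp

/-- The constant in the local comparison estimate. -/
def localConst (n : ℕ) : ℝ := 25 * stopConst n + 40 * stopConst n ^ 2

theorem localConst_pos (n : ℕ) : 0 < localConst n := by
  have := stopConst_pos n
  unfold localConst
  positivity

/-- The regularized Cauchy integral of `f` localized to `tripleCell c` at a point of the cell:
comparison with the localization to a subcell `c'` with parent `p` through a good point `x'`. -/
theorem enorm_cauchy_sub_cauchy_le {t₀ r y : ℝ} (hr : 0 < r) (hy : 0 < y)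
    {f : ℝ → EuclideanSpace ℂ (Fin n)} (hf : Integrable f) {c c' p : ℕ × ℤ}
    (hp : p.1 = c'.1 + 1) (hcp : cell t₀ r c' ⊆ cell t₀ r p)
    (hpc : cell t₀ r p ⊆ cell t₀ r c) (hle : p.1 ≤ c.1) {x x' l k : ℝ} (hx : x ∈ cell t₀ r c')
    (hx' : x' ∈ cell t₀ r p) (hl : 0 < l) (hk : 0 ≤ k)
    (hmax : x' ∉ maximalSet (fun t => ‖(tripleCell t₀ r c).indicator f t‖ₑ) l)
    (h1 : ‖cauchy ((tripleCell t₀ r c).indicator f) (x' + y * Complex.I)‖ ≤ l)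
    (h2 : ‖cauchy ((tripleCell t₀ r p).indicator f) (x' + y * Complex.I)‖
      ≤ k * (∫ t, ‖(tripleCell t₀ r p).indicator f t‖) / (2 ^ p.1 * r)) :
    ‖cauchy ((tripleCell t₀ r c).indicator f) (x + y * Complex.I)
      - cauchy ((tripleCell t₀ r c').indicator f) (x + y * Complex.I)‖ₑ
      ≤ ENNReal.ofReal (25 * l + 40 * k * l) := by
  set Q := tripleCell t₀ r c with hQ
  set P := tripleCell t₀ r p with hP
  set P' := tripleCell t₀ r c' with hP'
  set ℓ : ℝ := 2 ^ p.1 * r with hℓ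
  have hℓ0 : 0 < ℓ := by positivity
  have hQm : MeasurableSet Q := measurableSet_tripleCell _
  have hPm : MeasurableSet P := measurableSet_tripleCell _
  have hPm' : MeasurableSet P' := measurableSet_tripleCell _
  have hPQ : P ⊆ Q := tripleCell_subset hr hpc hle
  have hPP : P' ⊆ P := tripleCell_subset hr hcp (by omega)
  have hz : ∀ x : ℝ, (x + y * Complex.I : ℂ).im ≠ 0 := fun x => by simpa using hy.ne'
  have ifQ := hf.indicator hQm
  have ifP := hf.indicator hPm
  have ifP' := hf.indicator hPm'
  have ig1 := hf.indicator (hPm.diff hPm')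
  have ig2 := hf.indicator (hQm.diff hPm)
  have e1 : Q.indicator f = P.indicator f + (Q \ P).indicator f :=
    indicator_eq_add_indicator_diff hPQ f
  have e2 : P.indicator f = P'.indicator f + (P \ P').indicator f :=
    indicator_eq_add_indicator_diff hPP f
  -- Three contributions: the near part from `P \ P'`, the oscillation between `x` and `x'` of the
  -- far part from `Q \ P`, and the values at the good point `x'`.
  have e3 : cauchy (Q.indicator f) (x + y * Complex.I) - cauchy (P'.indicator f) (x + y * Complex.I)
      = cauchy ((P \ P').indicator f) (x + y * Complex.I) +
        ((cauchy ((Q \ P).indicator f) (x + y * Complex.I)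
          - cauchy ((Q \ P).indicator f) (x' + y * Complex.I)) +
        (cauchy (Q.indicator f) (x' + y * Complex.I)
          - cauchy (P.indicator f) (x' + y * Complex.I))) := by
    rw [e1, cauchy_add ifP ig2 (hz x), cauchy_add ifP ig2 (hz x'), e2,
      cauchy_add ifP' ig1 (hz x), cauchy_add ifP' ig1 (hz x')]
    abel
  set φ : ℝ → ℝ≥0∞ := fun t => ‖Q.indicator f t‖ₑ with hφ
  have hφm : AEMeasurable φ := ifQ.aestronglyMeasurable.enorm
  have hE := lintegral_poisson_le hφm hl hmax hℓ0
  set E := ∫⁻ t, ENNReal.ofReal (ℓ / (ℓ ^ 2 + (x' - t) ^ 2)) * φ t with hEdef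
  have hmono : ∀ S : Set ℝ, S ⊆ Q → ∀ t, ‖S.indicator f t‖ₑ ≤ φ t := by
    intro S hS t
    by_cases ht : t ∈ S
    · rw [hφ]
      simp only
      rw [indicator_of_mem ht, indicator_of_mem (hS ht)]
    · rw [indicator_of_notMem ht]
      simp
  have hx'I : x' ∈ Ico (t₀ + p.2 * ℓ) (t₀ + p.2 * ℓ + ℓ) := by
    obtain ⟨ha, hb⟩ := hx'
    exact ⟨ha, by linarith⟩
  have hPI : P = Ico (t₀ + p.2 * ℓ - ℓ) (t₀ + p.2 * ℓ + 2 * ℓ) := by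
    rw [hP, tripleCell]
    congr 1 <;> ring
  have hℓ' : (2 : ℝ) ^ c'.1 * r = ℓ / 2 := by
    rw [hℓ, hp, pow_succ]
    ring
  have hxI' : x ∈ Ico (t₀ + c'.2 * (ℓ / 2)) (t₀ + c'.2 * (ℓ / 2) + ℓ / 2) := by
    obtain ⟨ha, hb⟩ := hx
    rw [hℓ'] at ha hb
    exact ⟨ha, by linarith⟩
  have hPI' : P' = Ico (t₀ + c'.2 * (ℓ / 2) - ℓ / 2) (t₀ + c'.2 * (ℓ / 2) + ℓ) := by
    rw [hP', tripleCell, hℓ']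
    congr 1 <;> ring
  have hxI : x ∈ Ico (t₀ + p.2 * ℓ) (t₀ + p.2 * ℓ + ℓ) := by
    obtain ⟨ha, hb⟩ := hcp hx
    exact ⟨ha, by linarith⟩
  have b1 : ‖cauchy ((P \ P').indicator f) (x + y * Complex.I)‖ₑ ≤ ENNReal.ofReal (16 * l) := by
    refine (enorm_cauchy_le_of_near hℓ0 hxI' hx'I fun t ht => ?_).trans ?_
    · have := mem_of_indicator_ne_zero ht
      rw [hPI, hPI'] at this
      exact this
    · calc _ ≤ ∫⁻ t, ENNReal.ofReal 2 * (ENNReal.ofReal (ℓ / (ℓ ^ 2 + (x' - t) ^ 2)) * φ t) := by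
            refine lintegral_mono fun t => ?_
            rw [ENNReal.ofReal_mul (by norm_num), mul_assoc]
            gcongr
            exact hmono _ (sdiff_subset.trans hPQ) t
        _ = ENNReal.ofReal 2 * E := lintegral_const_mul' _ _ ENNReal.ofReal_ne_top
        _ ≤ ENNReal.ofReal 2 * ENNReal.ofReal (8 * l) := by gcongr
        _ = _ := by
            rw [← ENNReal.ofReal_mul (by norm_num)]
            congr 1
            ring
  have b2 : ‖cauchy ((Q \ P).indicator f) (x + y * Complex.I)
      - cauchy ((Q \ P).indicator f) (x' + y * Complex.I)‖ₑ ≤ ENNReal.ofReal (8 * l) := by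
    refine (enorm_cauchy_sub_le_of_far ig2 hy hℓ0 hxI hx'I fun t ht => ?_).trans (le_trans ?_ hE)
    · rw [← hPI] at ht
      exact indicator_of_notMem (fun h => h.2 ht) f
    · refine lintegral_mono fun t => ?_
      gcongr
      exact hmono _ sdiff_subset t
  -- On `P` the Poisson kernel centred at `x'` is at least `1 / (5ℓ)`, so the mass of `f` on `P` is
  -- bounded by the maximal function at `x'`.
  have b3 : ENNReal.ofReal (∫ t, ‖P.indicator f t‖) ≤ ENNReal.ofReal (40 * ℓ * l) := by
    rw [← lintegral_enorm_eq_ofReal ifP]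
    calc ∫⁻ t, ‖P.indicator f t‖ₑ
        ≤ ∫⁻ t, ENNReal.ofReal (5 * ℓ) * (ENNReal.ofReal (ℓ / (ℓ ^ 2 + (x' - t) ^ 2)) * φ t) := by
          refine lintegral_mono fun t => ?_
          by_cases ht : t ∈ P
          · rw [← mul_assoc, ← ENNReal.ofReal_mul (by positivity)]
            have h3 : 1 ≤ ENNReal.ofReal (5 * ℓ * (ℓ / (ℓ ^ 2 + (x' - t) ^ 2))) := by
              rw [ENNReal.one_le_ofReal, mul_div_assoc', one_le_div (by positivity)]
              rw [hPI] at ht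
              obtain ⟨ha, hb⟩ := ht
              obtain ⟨hc, hd⟩ := hx'I
              have : |x' - t| ≤ 2 * ℓ := by rw [abs_le]; constructor <;> linarith
              rw [← sq_abs (x' - t)]
              nlinarith [abs_nonneg (x' - t)]
            calc ‖P.indicator f t‖ₑ = 1 * ‖P.indicator f t‖ₑ := (one_mul _).symm
              _ ≤ _ := mul_le_mul' h3 (hmono _ hPQ t)
          · rw [indicator_of_notMem ht]
            simp
      _ = ENNReal.ofReal (5 * ℓ) * E := lintegral_const_mul' _ _ ENNReal.ofReal_ne_top
      _ ≤ ENNReal.ofReal (5 * ℓ) * ENNReal.ofReal (8 * l) := by gcongr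
      _ = _ := by
          rw [← ENNReal.ofReal_mul (by positivity)]
          congr 1
          ring
  have b4 : ‖cauchy (P.indicator f) (x' + y * Complex.I)‖ ≤ 40 * k * l := by
    refine h2.trans ?_
    rw [div_le_iff₀ hℓ0]
    have := (ENNReal.ofReal_le_ofReal_iff (by positivity)).1 b3
    nlinarith
  rw [e3]
  refine (enorm_add_le _ _).trans ?_
  have b5 : ‖cauchy (Q.indicator f) (x' + y * Complex.I)
          - cauchy (P.indicator f) (x' + y * Complex.I)‖ₑ ≤ ENNReal.ofReal (l + 40 * k * l) := by
    rw [← ofReal_norm]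
    apply ENNReal.ofReal_le_ofReal
    refine (norm_sub_le _ _).trans ?_
    linarith
  calc _ ≤ ENNReal.ofReal (16 * l) + (ENNReal.ofReal (8 * l) + ENNReal.ofReal (l + 40 * k * l)) :=
        add_le_add b1 ((enorm_add_le _ _).trans (add_le_add b2 b5))
    _ = _ := by
        rw [← ENNReal.ofReal_add (by positivity) (by positivity),
          ← ENNReal.ofReal_add (by positivity) (by positivity)]
        congr 1
        ring

/-- One step of the sparse decomposition: off a family of subcells of small total length, the
localized Cauchy integral is controlled by the average of `f`; on the subcells, it is so
controlled up to localization to the subcell. -/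
theorem exists_local_step {t₀ r y : ℝ} (hr : 0 < r) (hry : r ≤ y)
    {f : ℝ → EuclideanSpace ℂ (Fin n)} (hf : Integrable f) (c : ℕ × ℤ) :
    ∃ J : Finset (ℕ × ℤ), (∀ c' ∈ J, cell t₀ r c' ⊆ cell t₀ r c ∧ c'.1 < c.1) ∧
      (J : Set (ℕ × ℤ)).PairwiseDisjoint (cell t₀ r) ∧
      2 * ∑ c' ∈ J, volume (cell t₀ r c') ≤ volume (cell t₀ r c) ∧
      ∀ x ∈ cell t₀ r c,
        ‖cauchy ((tripleCell t₀ r c).indicator f) (x + y * Complex.I)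
          - ∑ c' ∈ J, (cell t₀ r c').indicator (fun x : ℝ =>
            cauchy ((tripleCell t₀ r c').indicator f) (x + y * Complex.I)) x‖ₑ
        ≤ ENNReal.ofReal (localConst n / (2 ^ c.1 * r)) *
          ∫⁻ t in tripleCell t₀ r c, ‖f t‖ₑ := by
  have hy : 0 < y := hr.trans_le hry
  set Q := tripleCell t₀ r c with hQ
  have hQm : MeasurableSet Q := measurableSet_tripleCell _
  have ifQ := hf.indicator hQm
  set L : ℝ := 2 ^ c.1 * r with hL
  have hL0 : 0 < L := by positivity
  set K := stopConst n with hK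
  have hK0 : 0 < K := stopConst_pos n
  set a : ℝ := (∫ t, ‖Q.indicator f t‖) / L with ha
  have ha0 : 0 ≤ a := div_nonneg (integral_nonneg fun t => norm_nonneg _) hL0.le
  have hint : ∫⁻ t in Q, ‖f t‖ₑ = ENNReal.ofReal (a * L) := by
    rw [ha, div_mul_cancel₀ _ hL0.ne', ← lintegral_enorm_eq_ofReal ifQ,
      ← lintegral_indicator hQm]
    refine lintegral_congr fun t => ?_
    rw [enorm_indicator_eq_indicator_enorm]
  have hrhs : ENNReal.ofReal (localConst n / L) * ∫⁻ t in Q, ‖f t‖ₑ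
      = ENNReal.ofReal (localConst n * a) := by
    rw [hint, ← ENNReal.ofReal_mul (div_nonneg (localConst_pos n).le hL0.le)]
    congr 1
    field_simp
  rw [hrhs]
  rcases ha0.eq_or_lt' with h0 | hpos
  · refine ⟨∅, by simp, by simp, by simp, fun x _ => ?_⟩
    have hz : ∫ t, ‖Q.indicator f t‖ = 0 := by
      rw [ha, div_eq_zero_iff] at h0
      exact h0.resolve_right hL0.ne'
    rw [cauchy_eq_zero (ae_eq_zero_of_integral_norm ifQ hz)]
    simp
  -- The exceptional set: the localized Cauchy integral or the maximal function exceeds `K` times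
  -- the average `a`.
  set B : Set ℝ := {x : ℝ | K * (∫ t, ‖Q.indicator f t‖) / L
      < ‖cauchy (Q.indicator f) (x + y * Complex.I)‖} ∪
    maximalSet (fun t => ‖Q.indicator f t‖ₑ) (K * a) with hB
  have hKa : 0 < K * a := by positivity
  have hBvol : volume B ≤ ENNReal.ofReal (L / 8) := by
    refine (measure_union_le _ _).trans ?_
    refine (add_le_add (volume_gt_mul_average_le ifQ hy hL0 hK0)
      (volume_maximalSet_le hKa ifQ.2.ne)).trans (le_of_eq ?_)
    rw [lintegral_enorm_eq_ofReal ifQ, ← ENNReal.ofReal_mul (by positivity),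
      ← ENNReal.ofReal_add (by positivity) (by positivity), ← weakConst_div_le n hL0]
    congr 2
    rw [ha]
    have : (∫ t, ‖Q.indicator f t‖) ≠ 0 := fun h => by
      rw [ha, h, zero_div] at hpos
      exact lt_irrefl _ hpos
    rw [← hK]
    field_simp
  have hgood : ∀ x, x ∉ B → ‖cauchy (Q.indicator f) (x + y * Complex.I)‖ ≤ K * a ∧
      x ∉ maximalSet (fun t => ‖Q.indicator f t‖ₑ) (K * a) := by
    intro x hx
    rw [hB, mem_union, not_or] at hx
    refine ⟨?_, hx.2⟩
    have := hx.1
    rwa [mem_ofPred_eq, not_lt, mul_div_assoc] at this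
  -- A cell is bad if at least a quarter of it lies in `B`. As `|B| ≤ L / 8`, the top cell is not
  -- bad, and the selected cells have total length at most `4 |B| ≤ L / 2`.
  obtain ⟨J, hJ, hJd, hJc⟩ := exists_stopping_cells (t := t₀) hr
    (fun c' => volume (cell t₀ r c') ≤ 4 * volume (cell t₀ r c' ∩ B)) c.1 c.2 (by
      rw [not_le, volume_cell]
      calc 4 * volume (cell t₀ r c ∩ B) ≤ 4 * ENNReal.ofReal (L / 8) := by
            gcongr
            exact (measure_mono inter_subset_right).trans hBvol
        _ = ENNReal.ofReal (L / 2) := by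
            rw [← ENNReal.ofReal_ofNat, ← ENNReal.ofReal_mul (by norm_num)]
            congr 1
            ring
        _ < ENNReal.ofReal (2 ^ c.1 * r) :=
            (ENNReal.ofReal_lt_ofReal_iff hL0).2 (by linarith))
  refine ⟨J, fun c' hc' => ⟨(hJ c' hc').2.1, (hJ c' hc').2.2.1⟩, hJd, ?_, ?_⟩
  · have h1 : ∑ c' ∈ J, volume (cell t₀ r c') ≤ 4 * ENNReal.ofReal (L / 8) := by
      calc ∑ c' ∈ J, volume (cell t₀ r c')
          ≤ ∑ c' ∈ J, 4 * (volume.restrict B) (cell t₀ r c') := by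
            refine Finset.sum_le_sum fun c' hc' => ?_
            rw [Measure.restrict_apply (measurableSet_cell _)]
            exact (hJ c' hc').1
        _ = 4 * (volume.restrict B) (⋃ c' ∈ J, cell t₀ r c') := by
            rw [← Finset.mul_sum, measure_biUnion_finset hJd fun _ _ => measurableSet_cell _]
        _ ≤ 4 * (volume.restrict B) univ := by
            gcongr
            exact subset_univ _
        _ ≤ _ := by
            rw [Measure.restrict_apply_univ]
            gcongr
    calc 2 * ∑ c' ∈ J, volume (cell t₀ r c') ≤ 2 * (4 * ENNReal.ofReal (L / 8)) := by gcongr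
      _ = volume (cell t₀ r c) := by
          rw [volume_cell, ← mul_assoc, show (2 * 4 : ℝ≥0∞) = ENNReal.ofReal 8 by
            rw [ENNReal.ofReal_ofNat]; norm_num, ← ENNReal.ofReal_mul (by norm_num)]
          congr 1
          rw [hL]
          ring
  · intro x hx
    by_cases hex : ∃ c' ∈ J, x ∈ cell t₀ r c'
    · obtain ⟨c', hc', hxc'⟩ := hex
      rw [Finset.sum_eq_single c', indicator_of_mem hxc']
      rotate_left
      · intro b hb hbc
        refine indicator_of_notMem (fun hxb => ?_) _
        exact disjoint_left.1 (hJd hb hc' hbc) hxb hxc'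
      · exact fun h => absurd hc' h
      obtain ⟨-, -, -, p, hp1, hp2, hp3, hp4, hp5⟩ := hJ c' hc'
      rw [not_le, volume_cell] at hp5
      set ℓ : ℝ := 2 ^ p.1 * r with hℓ
      have hℓ0 : 0 < ℓ := by positivity
      set P := tripleCell t₀ r p with hP
      have ifP : Integrable (P.indicator f) := hf.indicator (measurableSet_tripleCell _)
      set B' : Set ℝ := {x : ℝ | K * (∫ t, ‖P.indicator f t‖) / ℓ
        < ‖cauchy (P.indicator f) (x + y * Complex.I)‖} with hB'
      have hB'vol : volume B' ≤ ENNReal.ofReal (ℓ / 8) := by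
        refine (volume_gt_mul_average_le ifP hy hℓ0 hK0).trans (ENNReal.ofReal_le_ofReal ?_)
        rw [← weakConst_div_le n hℓ0]
        have : 0 ≤ 8 / stopConst n * ℓ := by positivity
        linarith
      -- The parent is not bad, so less than a quarter of it lies in `B`, and `B'` has length at
      -- most an eighth of the parent.
      obtain ⟨x', hx'p, hxK, hxG⟩ : ∃ x' ∈ cell t₀ r p, x' ∉ B ∧ x' ∉ B' := by
        by_contra! hcon
        have hsub : cell t₀ r p ⊆ (cell t₀ r p ∩ B) ∪ B' := by
          intro z hz
          by_cases hzB : z ∈ B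
          · exact Or.inl ⟨hz, hzB⟩
          · exact Or.inr (hcon z hz hzB)
        have h2 := (measure_mono (μ := volume) hsub).trans (measure_union_le _ _)
        rw [volume_cell] at h2
        have h3 : 4 * ENNReal.ofReal ℓ ≤ 4 * volume (cell t₀ r p ∩ B) + 4 * volume B' := by
          rw [← mul_add]
          gcongr
        have h4 : 4 * volume B' ≤ ENNReal.ofReal ℓ := by
          calc 4 * volume B' ≤ 4 * ENNReal.ofReal (ℓ / 8) := by gcongr
            _ = ENNReal.ofReal (ℓ / 2) := by
              rw [← ENNReal.ofReal_ofNat, ← ENNReal.ofReal_mul (by norm_num)]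
              congr 1
              ring
            _ ≤ _ := ENNReal.ofReal_le_ofReal (by linarith)
        have h5 : 4 * volume (cell t₀ r p ∩ B) + 4 * volume B'
            < ENNReal.ofReal ℓ + ENNReal.ofReal ℓ :=
          ENNReal.add_lt_add_of_lt_of_le
            (ne_top_of_le_ne_top ENNReal.ofReal_ne_top h4) hp5 h4
        have h6 : ENNReal.ofReal ℓ + ENNReal.ofReal ℓ ≤ 4 * ENNReal.ofReal ℓ := by
          rw [← two_mul]
          gcongr
          norm_num
        exact absurd (h3.trans_lt (h5.trans_le h6)) (lt_irrefl _)
      obtain ⟨g1, g2⟩ := hgood x' hxK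
      rw [hB', mem_ofPred_eq, not_lt] at hxG
      -- With `l = K a` and `k = K` the bound `25 l + 40 k l` equals `localConst n * a`.
      refine (enorm_cauchy_sub_cauchy_le hr hy hf hp1 hp2 hp3 hp4 hxc' hx'p hKa hK0.le g2 g1
        hxG).trans (le_of_eq ?_)
      congr 1
      rw [localConst, ← hK]
      ring
    · rw [Finset.sum_eq_zero fun c' hc' => indicator_of_notMem (fun h => hex ⟨c', hc', h⟩) _,
        sub_zero]
      obtain ⟨k, hk1, hk2⟩ := (hJc x hx).resolve_left hex
      rw [not_le, volume_cell, pow_zero, one_mul] at hk2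
      obtain ⟨x', hx'p, hxK⟩ : ∃ x' ∈ cell t₀ r (0, k), x' ∉ B := by
        by_contra! hcon
        rw [inter_eq_left.2 hcon, volume_cell, pow_zero, one_mul] at hk2
        refine absurd hk2 (not_lt.2 ?_)
        calc ENNReal.ofReal r = 1 * ENNReal.ofReal r := (one_mul _).symm
          _ ≤ _ := by
            gcongr
            norm_num
      obtain ⟨g1, g2⟩ := hgood x' hxK
      -- The smallest cells have length `r ≤ y`. This is where the height stops the descent and a
      -- good point of the cell controls all its points.
      have hd : |x - x'| ≤ y := by
        have := cell_bounds hk1 hx'p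
        rw [pow_zero, one_mul] at this
        linarith
      have h1 := (enorm_cauchy_sub_le_of_dist_le ifQ hy hd).trans
        (lintegral_poisson_le ifQ.aestronglyMeasurable.enorm hKa g2 hy)
      have h2 : ‖cauchy (Q.indicator f) (x' + y * Complex.I)‖ₑ ≤ ENNReal.ofReal (K * a) := by
        rw [← ofReal_norm]
        exact ENNReal.ofReal_le_ofReal g1
      rw [← sub_add_cancel (cauchy (Q.indicator f) (x + y * Complex.I))
        (cauchy (Q.indicator f) (x' + y * Complex.I))]
      refine (enorm_add_le _ _).trans ((add_le_add h1 h2).trans ?_)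
      rw [← ENNReal.ofReal_add (by positivity) (by positivity)]
      apply ENNReal.ofReal_le_ofReal
      rw [localConst, ← hK]
      nlinarith [mul_nonneg (sq_nonneg K) ha0]

end LocalStep

end MatrixA2

end

noncomputable section

namespace MatrixA2

/-! ### Sparse domination in varying coordinates. -/

section Sparse

variable {n : ℕ}

theorem norm_cauchy_le {V : Type*} [NormedAddCommGroup V] [NormedSpace ℂ V] {f : ℝ → V}
    (hf : Integrable f) {y : ℝ} (hy : 0 < y) (x : ℝ) :
    ‖cauchy f (x + y * Complex.I)‖ ≤ y⁻¹ * ∫ t, ‖f t‖ := by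
  unfold cauchy
  refine (norm_integral_le_integral_norm _).trans ?_
  rw [← integral_const_mul]
  refine integral_mono_of_nonneg (ae_of_all _ fun t => norm_nonneg _) (hf.norm.const_mul _)
    (ae_of_all _ fun t => ?_)
  simp only [norm_smul]
  gcongr
  exact norm_cauchyKer_le hy (by simp [le_abs_self])

theorem integrable_inner_cauchy {f v : ℝ → EuclideanSpace ℂ (Fin n)} (hf : Integrable f)
    (hv : Integrable v) {y : ℝ} (hy : 0 < y) :
    Integrable fun x : ℝ => inner ℂ (cauchy f (x + y * Complex.I)) (v x) := by
  refine Integrable.mono' (hv.norm.const_mul (y⁻¹ * ∫ t, ‖f t‖))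
    ((continuous_cauchy_line hf hy.ne').aestronglyMeasurable.inner hv.aestronglyMeasurable)
    (ae_of_all _ fun x => ?_)
  refine (norm_inner_le_norm _ _).trans ?_
  gcongr
  exact norm_cauchy_le hf hy x

theorem map_cauchy {V : Type*} [NormedAddCommGroup V] [NormedSpace ℂ V] [CompleteSpace V]
    (A : V →L[ℂ] V) {f : ℝ → V} (hf : Integrable f) {z : ℂ} (hz : z.im ≠ 0) :
    A (cauchy f z) = cauchy (fun t => A (f t)) z := by
  have := A.integral_comp_comm (integrable_cauchyKer_smul hf hz)
  simp only [map_smul] at this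
  exact this.symm

open Classical in
/-- Sparse domination of the bilinear form of a regularized Cauchy integral, with an arbitrary
change of coordinates on every cell. -/
theorem exists_sparse_domination {t₀ r y : ℝ} (hr : 0 < r) (hry : r ≤ y)
    {u v : ℝ → EuclideanSpace ℂ (Fin n)} (hu : Integrable u) (hv : Integrable v)
    (A B : ℕ × ℤ → EuclideanSpace ℂ (Fin n) →L[ℂ] EuclideanSpace ℂ (Fin n))
    (hAB : ∀ c x y, inner ℂ (A c x) (B c y) = inner ℂ x y) (d : ℕ) (m : ℤ) :
    ∃ S : Finset (ℕ × ℤ), (∀ c ∈ S, cell t₀ r c ⊆ cell t₀ r (d, m) ∧ c.1 ≤ d) ∧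
      (∀ R : Set ℝ, MeasurableSet R →
        ∑ c ∈ S with cell t₀ r c ⊆ R, volume (cell t₀ r c)
          ≤ 2 * volume (R ∩ cell t₀ r (d, m))) ∧
      ‖∫ x in cell t₀ r (d, m), inner ℂ
          (cauchy ((tripleCell t₀ r (d, m)).indicator u) (x + y * Complex.I)) (v x)‖ₑ
        ≤ ENNReal.ofReal (localConst n) * ∑ c ∈ S, ENNReal.ofReal (2 ^ c.1 * r)⁻¹ *
          ((∫⁻ t in tripleCell t₀ r c, ‖A c (u t)‖ₑ) * ∫⁻ t in cell t₀ r c, ‖B c (v t)‖ₑ) := by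
  have hy : 0 < y := hr.trans_le hry
  induction d using Nat.strong_induction_on generalizing m with
  | _ d ih =>
  set c₀ : ℕ × ℤ := (d, m) with hc₀
  -- The stopping cells are chosen for `A c₀ ∘ u`, that is, in the coordinates of the present cell.
  -- The induction hypothesis then treats each of them in its own coordinates.
  obtain ⟨J, hJ, hJd, hJv, hJx⟩ := exists_local_step (t₀ := t₀) hr hry
    ((A c₀).integrable_comp hu) c₀
  choose! S hS1 hS2 hS3 using fun c (hc : c ∈ J) => ih c.1 (hJ c hc).2 c.2
  have hdisj : (J : Set (ℕ × ℤ)).PairwiseDisjoint S := by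
    intro c hc c' hc' hne
    rw [Function.onFun, Finset.disjoint_left]
    intro b hb hb'
    obtain ⟨x, hx⟩ := cell_nonempty (t := t₀) hr b
    exact disjoint_left.1 (hJd hc hc' hne) ((hS1 c hc b hb).1 hx) ((hS1 c' hc' b hb').1 hx)
  have hnot : c₀ ∉ J.biUnion S := by
    intro h
    obtain ⟨c, hc, hcS⟩ := Finset.mem_biUnion.1 h
    have h1 := (hS1 c hc _ hcS).2
    have h2 := (hJ c hc).2
    omega
  refine ⟨insert c₀ (J.biUnion S), ?_, ?_, ?_⟩
  · intro c hc
    rcases Finset.mem_insert.1 hc with rfl | h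
    · exact ⟨le_rfl, le_rfl⟩
    · obtain ⟨c', hc', hcS⟩ := Finset.mem_biUnion.1 h
      have h1 := hS1 c' hc' c hcS
      have h2 := hJ c' hc'
      exact ⟨h1.1.trans h2.1, h1.2.trans h2.2.le⟩
  · intro R hR
    rw [Finset.sum_filter, Finset.sum_insert hnot, Finset.sum_biUnion hdisj]
    have h1 : ∑ c ∈ J, ∑ b ∈ S c, (if cell t₀ r b ⊆ R then volume (cell t₀ r b) else 0)
        ≤ ∑ c ∈ J, 2 * volume (R ∩ cell t₀ r c) := by
      refine Finset.sum_le_sum fun c hc => ?_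
      rw [← Finset.sum_filter]
      exact hS2 c hc R hR
    -- If the top cell lies in `R`, it adds its own length, while the rest is bounded by twice the
    -- stopping cells and hence once more by that length. If not, only the disjoint stopping cells
    -- matter.
    by_cases hcR : cell t₀ r c₀ ⊆ R
    · rw [if_pos hcR, inter_eq_right.2 hcR]
      calc _ ≤ volume (cell t₀ r c₀) + ∑ c ∈ J, 2 * volume (R ∩ cell t₀ r c) := by gcongr
        _ ≤ volume (cell t₀ r c₀) + ∑ c ∈ J, 2 * volume (cell t₀ r c) := by
            gcongr
            exact inter_subset_right
        _ ≤ volume (cell t₀ r c₀) + volume (cell t₀ r c₀) := by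
            rw [← Finset.mul_sum]
            gcongr
        _ = _ := (two_mul _).symm
    · rw [if_neg hcR, zero_add]
      refine h1.trans ?_
      rw [← Finset.mul_sum, ← measure_biUnion_finset (f := fun c => R ∩ cell t₀ r c)]
      · gcongr
        refine iUnion₂_subset fun c hc => ?_
        exact inter_subset_inter_right _ (hJ c hc).1
      · exact hJd.mono fun c => inter_subset_right
      · exact fun c _ => hR.inter (measurableSet_cell c)
  · rw [Finset.sum_insert hnot, Finset.sum_biUnion hdisj]
    set T : ℕ × ℤ → ℝ → EuclideanSpace ℂ (Fin n) := fun c x =>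
      cauchy ((tripleCell t₀ r c).indicator u) (x + y * Complex.I) with hT
    have hui : ∀ c, Integrable ((tripleCell t₀ r c).indicator u) := fun c =>
      hu.indicator (measurableSet_tripleCell c)
    have hTi : ∀ c, Integrable fun x => inner ℂ (T c x) (v x) := fun c =>
      integrable_inner_cauchy (hui c) hv hy
    have hsum : ∑ c ∈ J, ∫ x in cell t₀ r c, inner ℂ (T c x) (v x)
        = ∫ x in cell t₀ r c₀, inner ℂ (∑ c ∈ J, (cell t₀ r c).indicator (T c) x) (v x) := by
      have h1 : ∀ x, inner ℂ (∑ c ∈ J, (cell t₀ r c).indicator (T c) x) (v x)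
          = ∑ c ∈ J, (cell t₀ r c).indicator (fun x => inner ℂ (T c x) (v x)) x := by
        intro x
        rw [sum_inner]
        refine Finset.sum_congr rfl fun c _ => ?_
        by_cases hx : x ∈ cell t₀ r c
        · rw [indicator_of_mem hx, indicator_of_mem hx]
        · rw [indicator_of_notMem hx, indicator_of_notMem hx, inner_zero_left]
      simp only [h1]
      rw [integral_finsetSum J fun c _ =>
        ((hTi c).indicator (measurableSet_cell c)).integrableOn]
      refine Finset.sum_congr rfl fun c hc => ?_
      rw [setIntegral_indicator (measurableSet_cell c), inter_eq_right.2 (hJ c hc).1]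
    have hsi : Integrable fun x =>
        inner ℂ (∑ c ∈ J, (cell t₀ r c).indicator (T c) x) (v x) := by
      simp only [sum_inner]
      refine integrable_finsetSum J fun c _ => ?_
      refine ((hTi c).indicator (measurableSet_cell (t := t₀) (r := r) c)).congr (ae_of_all _ fun x => ?_)
      by_cases hx : x ∈ cell t₀ r c
      · simp only [indicator_of_mem hx]
      · simp only [indicator_of_notMem hx, inner_zero_left]
    have hsplit : ∫ x in cell t₀ r c₀, inner ℂ (T c₀ x) (v x)
        = (∫ x in cell t₀ r c₀, inner ℂ
            (T c₀ x - ∑ c ∈ J, (cell t₀ r c).indicator (T c) x) (v x))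
          + ∑ c ∈ J, ∫ x in cell t₀ r c, inner ℂ (T c x) (v x) := by
      rw [hsum]
      simp only [inner_sub_left]
      rw [integral_sub (hTi c₀).integrableOn hsi.integrableOn, sub_add_cancel]
    have hmain : ‖∫ x in cell t₀ r c₀, inner ℂ
            (T c₀ x - ∑ c ∈ J, (cell t₀ r c).indicator (T c) x) (v x)‖ₑ
        ≤ ENNReal.ofReal (localConst n) * (ENNReal.ofReal (2 ^ c₀.1 * r)⁻¹ *
          ((∫⁻ t in tripleCell t₀ r c₀, ‖A c₀ (u t)‖ₑ) *
            ∫⁻ t in cell t₀ r c₀, ‖B c₀ (v t)‖ₑ)) := by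
      refine (enorm_integral_le_lintegral_enorm _).trans ?_
      calc ∫⁻ x in cell t₀ r c₀, ‖inner ℂ
            (T c₀ x - ∑ c ∈ J, (cell t₀ r c).indicator (T c) x) (v x)‖ₑ
          ≤ ∫⁻ x in cell t₀ r c₀, ENNReal.ofReal (localConst n / (2 ^ c₀.1 * r)) *
            (∫⁻ t in tripleCell t₀ r c₀, ‖A c₀ (u t)‖ₑ) * ‖B c₀ (v x)‖ₑ := by
            refine setLIntegral_mono' (measurableSet_cell _) fun x hx => ?_
            -- The change of coordinates: `A c₀` passes through the scalar Cauchy kernel and `B c₀`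
            -- compensates for it on `v`.
            rw [← hAB c₀]
            refine (enorm_inner_le _ _).trans ?_
            gcongr
            refine le_trans (le_of_eq ?_) (hJx x hx)
            congr 1
            have hz : (x + y * Complex.I : ℂ).im ≠ 0 := by simpa using hy.ne'
            have hAT : ∀ c, A c₀ (T c x) = cauchy ((tripleCell t₀ r c).indicator
                (fun t => A c₀ (u t))) (x + y * Complex.I) := by
              intro c
              rw [hT]
              simp only
              rw [map_cauchy _ (hui c) hz]
              congr 1
              ext1 t
              by_cases ht : t ∈ tripleCell t₀ r c
              · simp only [indicator_of_mem ht]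
              · simp only [indicator_of_notMem ht, map_zero]
            rw [map_sub, map_sum, hAT]
            congr 1
            refine Finset.sum_congr rfl fun c _ => ?_
            by_cases hxc : x ∈ cell t₀ r c
            · rw [indicator_of_mem hxc, indicator_of_mem hxc, hAT]
            · rw [indicator_of_notMem hxc, indicator_of_notMem hxc, map_zero]
        _ = ENNReal.ofReal (localConst n / (2 ^ c₀.1 * r)) *
            (∫⁻ t in tripleCell t₀ r c₀, ‖A c₀ (u t)‖ₑ) *
              ∫⁻ x in cell t₀ r c₀, ‖B c₀ (v x)‖ₑ := by
            refine lintegral_const_mul' _ _ (ENNReal.mul_ne_top ENNReal.ofReal_ne_top ?_)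
            exact ((setLIntegral_le_lintegral _ _).trans_lt ((A c₀).integrable_comp hu).2).ne
        _ = _ := by
            rw [div_eq_mul_inv, ENNReal.ofReal_mul (localConst_pos n).le]
            ring
    change ‖∫ x in cell t₀ r c₀, inner ℂ (T c₀ x) (v x)‖ₑ ≤ _
    rw [hsplit, mul_add]
    refine (enorm_add_le _ _).trans (add_le_add hmain ?_)
    refine (enorm_sum_le _ _).trans ?_
    rw [Finset.mul_sum]
    exact Finset.sum_le_sum fun c hc => hS3 c hc

end Sparse

end MatrixA2

end

noncomputable section
namespace MatrixA2

/-! ### A Carleson embedding theorem with weights depending on the set. -/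

section Embedding

open Classical in
-- The number of predecessors within `A` takes each of the values `0, …, |A| - 1` exactly once.
theorem sum_card_lower {ι κ M : Type*} [LinearOrder κ] [AddCommMonoid M] {ρ : ι → κ}
    (hρ : Function.Injective ρ) (f : ℕ → M) (A : Finset ι) :
    ∑ a ∈ A, f (A.filter fun b => ρ b < ρ a).card = ∑ k ∈ Finset.range A.card, f k := by
  induction A using Finset.induction_on_max_value ρ with
  | empty => simp
  | insert a s has hmax ih =>
    have hlt : ∀ b ∈ s, ρ b < ρ a := fun b hb =>
      lt_of_le_of_ne (hmax b hb) fun h => has (hρ h ▸ hb)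
    rw [Finset.sum_insert has, Finset.card_insert_of_notMem has, Finset.sum_range_succ, ← ih,
      add_comm]
    congr 1
    · refine Finset.sum_congr rfl fun b hb => ?_
      rw [Finset.filter_insert, if_neg (not_lt.2 (hlt b hb).le)]
    · rw [Finset.filter_insert, if_neg (lt_irrefl _), Finset.filter_true_of_mem hlt]

variable {α ι κ : Type*} [LinearOrder κ] {ρ : ι → κ}
  {R : ι → Set α} {S : Finset ι}

open Classical in
/-- The number of sets `R j`, `j ∈ S`, that come before `R i` and contain `x`. -/
def depth (ρ : ι → κ) (R : ι → Set α) (S : Finset ι) (i : ι) (x : α) : ℕ :=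
  (S.filter fun j => ρ j < ρ i ∧ x ∈ R j).card

open Classical in
-- At a given point the sets containing it have depths `0, 1, 2, …`, each once. Hence overlaps at
-- bounded depth are bounded, and geometric weights in the depth have bounded sums.
theorem sum_depth_mem (hρ : Function.Injective ρ) {M : Type*} [AddCommMonoid M] (f : ℕ → M)
    (x : α) :
    ∑ i ∈ S with x ∈ R i, f (depth ρ R S i x)
      = ∑ k ∈ Finset.range (S.filter fun i => x ∈ R i).card, f k := by
  rw [← sum_card_lower hρ]
  refine Finset.sum_congr rfl fun i _ => ?_
  rw [depth, Finset.filter_filter]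
  simp only [and_comm]

open Classical in
theorem sum_depth_lower (hρ : Function.Injective ρ) {M : Type*} [AddCommMonoid M] (f : ℕ → M)
    (i : ι) (x : α) :
    ∑ j ∈ S with ρ j < ρ i ∧ x ∈ R j, f (depth ρ R S j x)
      = ∑ k ∈ Finset.range (depth ρ R S i x), f k := by
  rw [depth, ← sum_card_lower hρ]
  refine Finset.sum_congr rfl fun j hj => ?_
  rw [depth, Finset.filter_filter]
  congr 2
  ext k
  simp only [Finset.mem_filter]
  have := (Finset.mem_filter.1 hj).2.1
  constructor
  · rintro ⟨h1, h2, h3⟩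
    exact ⟨h1, ⟨h2.trans this, h3⟩, h2⟩
  · rintro ⟨h1, ⟨h2, h3⟩, h4⟩
    exact ⟨h1, h4, h3⟩

open Classical in
theorem cast_depth (i : ι) (x : α) :
    ((depth ρ R S i x : ℕ) : ℝ≥0∞) = ∑ j ∈ S with ρ j < ρ i, (R j).indicator 1 x := by
  rw [depth, ← Finset.filter_filter, Finset.card_filter]
  push_cast
  refine Finset.sum_congr rfl fun j _ => ?_
  simp [indicator_apply]

variable [MeasurableSpace α] {μ : Measure α}

open Classical in
theorem measurable_depth (hR : ∀ i, MeasurableSet (R i)) (i : ι) :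
    Measurable (depth ρ R S i) := by
  have : depth ρ R S i
      = fun x => ∑ j ∈ S with ρ j < ρ i, (R j).indicator (fun _ => (1 : ℕ)) x := by
    ext x
    rw [depth, ← Finset.filter_filter, Finset.card_filter]
    refine Finset.sum_congr rfl fun j _ => ?_
    simp [indicator_apply]
  rw [this]
  exact Finset.measurable_fun_sum _ fun j _ => measurable_const.indicator (hR j)

theorem one_add_pow_eq (ε : ℝ≥0∞) (m : ℕ) :
    (1 + ε) ^ m = 1 + ε * ∑ k ∈ Finset.range m, (1 + ε) ^ k := by
  induction m with
  | zero => simp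
  | succ m ih => rw [Finset.sum_range_succ, mul_add, ← add_assoc, ← ih]; ring

open Classical in
/-- Most of `R i` is covered by few of the preceding sets. -/
theorem measure_le_two_mul_depth_lt (hR : ∀ i, MeasurableSet (R i)) {i : ι}
    (hfin : μ (R i) ≠ ∞) {K : ℕ} (hK0 : K ≠ 0)
    (hK : 2 * ∑ j ∈ S with ρ j < ρ i ∧ ¬ Disjoint (R j) (R i), μ (R j) ≤ K * μ (R i)) :
    μ (R i) ≤ 2 * μ (R i ∩ {x | depth ρ R S i x < K}) := by
  have hm : MeasurableSet {x | depth ρ R S i x < K} :=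
    measurable_depth hR i (measurableSet_Iio (a := K))
  set F := {x | depth ρ R S i x < K} with hF
  -- Chebyshev's inequality: the integral of the depth over `R i` is the sum of the `μ (R j ∩ R i)`
  -- over the preceding `j`.
  have h1 : (K : ℝ≥0∞) * μ (R i \ F)
      ≤ ∑ j ∈ S with ρ j < ρ i ∧ ¬ Disjoint (R j) (R i), μ (R j) := by
    calc (K : ℝ≥0∞) * μ (R i \ F) = ∫⁻ _ in R i \ F, (K : ℝ≥0∞) ∂μ := by
          rw [setLIntegral_const]
      _ ≤ ∫⁻ x in R i \ F, (depth ρ R S i x : ℝ≥0∞) ∂μ := by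
          refine setLIntegral_mono' ((hR i).diff hm) fun x hx => ?_
          have := hx.2
          rw [hF, mem_ofPred_eq, not_lt] at this
          exact_mod_cast this
      _ ≤ ∫⁻ x in R i, (depth ρ R S i x : ℝ≥0∞) ∂μ := lintegral_mono_set sdiff_subset
      _ = ∑ j ∈ S with ρ j < ρ i, μ (R j ∩ R i) := by
          simp only [cast_depth]
          rw [lintegral_finsetSum _ fun j _ => measurable_one.indicator (hR j)]
          refine Finset.sum_congr rfl fun j _ => ?_
          rw [lintegral_indicator_one (hR j), Measure.restrict_apply (hR j)]
      _ ≤ _ := by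
          rw [← Finset.filter_filter, Finset.sum_filter (fun j => ¬ Disjoint (R j) (R i))]
          refine Finset.sum_le_sum fun j _ => ?_
          split_ifs with h
          · rw [disjoint_iff_inter_eq_empty.1 h, measure_empty]
          · exact measure_mono inter_subset_left
  have h2 : (K : ℝ≥0∞) * (2 * μ (R i \ F)) ≤ K * μ (R i) := by
    calc (K : ℝ≥0∞) * (2 * μ (R i \ F)) = 2 * (K * μ (R i \ F)) := by ring
      _ ≤ _ := (mul_le_mul_right h1 2).trans hK
  have h3 : 2 * μ (R i \ F) ≤ μ (R i) :=
    (ENNReal.mul_le_mul_iff_right (by exact_mod_cast hK0) (ENNReal.natCast_ne_top K)).1 h2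
  have h4 := measure_inter_add_sdiff (μ := μ) (R i) hm
  have h5 : 2 * μ (R i ∩ F) + 2 * μ (R i \ F) = μ (R i) + μ (R i) := by
    rw [← mul_add, h4, two_mul]
  have h6 : μ (R i) + μ (R i) ≤ 2 * μ (R i ∩ F) + μ (R i) := by
    rw [← h5]
    gcongr
  exact (ENNReal.add_le_add_iff_right hfin).1 h6

/-- The sets `R i` are a Carleson family, and the weight `w` is `A_∞` with respect to it. -/
structure IsCarlesonWeight (μ : Measure α) (ρ : ι → κ) (R : ι → Set α) (S : Finset ι)
    (a D : ℝ≥0∞) (w : α → ℝ≥0∞) : Prop where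
  measure_le : ∀ i ∈ S, ∀ F ⊆ R i, MeasurableSet F → μ (R i) ≤ 2 * μ F →
    ∫⁻ x in R i, w x ∂μ ≤ a * ∫⁻ x in F, w x ∂μ
  doubling : ∀ i ∈ S, ∫⁻ x in ⋃ j ∈ S, ⋃ (_ : ρ j < ρ i ∧ ¬ Disjoint (R j) (R i)), R j, w x ∂μ
    ≤ D * ∫⁻ x in R i, w x ∂μ

open Classical in
-- Packing passes from `μ` to the weight. Each `R j` is replaced, at the cost of the factor `a`, by
-- its part of depth less than `K`. These parts overlap at most `K` times, and doubling bounds the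
-- weight of the union.
theorem sum_weight_le (hρ : Function.Injective ρ) (hR : ∀ i, MeasurableSet (R i))
    (hfin : ∀ i ∈ S, μ (R i) ≠ ∞) {K : ℕ} (hK0 : K ≠ 0)
    (hK : ∀ i ∈ S, 2 * ∑ j ∈ S with ρ j < ρ i ∧ ¬ Disjoint (R j) (R i), μ (R j) ≤ K * μ (R i))
    {a D : ℝ≥0∞} {w : α → ℝ≥0∞} (hwm : AEMeasurable w μ)
    (hw : IsCarlesonWeight μ ρ R S a D w) {i : ι} (hi : i ∈ S) :
    ∑ j ∈ S with ρ j < ρ i ∧ ¬ Disjoint (R j) (R i), ∫⁻ x in R j, w x ∂μ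
      ≤ a * K * D * ∫⁻ x in R i, w x ∂μ := by
  set U := ⋃ j ∈ S, ⋃ (_ : ρ j < ρ i ∧ ¬ Disjoint (R j) (R i)), R j with hU
  have hUm : MeasurableSet U := by
    refine MeasurableSet.biUnion S.countable_toSet fun j _ => ?_
    exact MeasurableSet.iUnion fun _ => hR j
  set F : ι → Set α := fun j => R j ∩ {x | depth ρ R S j x < K} with hF
  have hFm : ∀ j, MeasurableSet (F j) := fun j =>
    (hR j).inter (measurable_depth hR j (measurableSet_Iio (a := K)))
  calc ∑ j ∈ S with ρ j < ρ i ∧ ¬ Disjoint (R j) (R i), ∫⁻ x in R j, w x ∂μ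
      ≤ ∑ j ∈ S with ρ j < ρ i ∧ ¬ Disjoint (R j) (R i), a * ∫⁻ x in U, (F j).indicator w x ∂μ := by
        refine Finset.sum_le_sum fun j hj => ?_
        obtain ⟨hjS, hj1⟩ := Finset.mem_filter.1 hj
        refine (hw.measure_le j hjS (F j) inter_subset_left (hFm j)
          (measure_le_two_mul_depth_lt hR (hfin j hjS) hK0 (hK j hjS))).trans (le_of_eq ?_)
        rw [lintegral_indicator (hFm j), Measure.restrict_restrict (hFm j), inter_eq_left.2]
        refine inter_subset_left.trans ?_
        rw [hU]
        exact subset_iUnion₂_of_subset j hjS (subset_iUnion_of_subset hj1 le_rfl)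
    _ = a * ∫⁻ x in U, ∑ j ∈ S with ρ j < ρ i ∧ ¬ Disjoint (R j) (R i),
          (F j).indicator w x ∂μ := by
        rw [← Finset.mul_sum, lintegral_finsetSum']
        exact fun j _ => (hwm.indicator (hFm j)).restrict
    _ ≤ a * ∫⁻ x in U, K * w x ∂μ := by
        gcongr with x
        calc ∑ j ∈ S with ρ j < ρ i ∧ ¬ Disjoint (R j) (R i), (F j).indicator w x
            ≤ ∑ j ∈ S, (F j).indicator w x :=
              Finset.sum_le_sum_of_subset (Finset.filter_subset _ _)
          _ = ∑ j ∈ S with x ∈ R j, if depth ρ R S j x < K then w x else 0 := by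
              rw [Finset.sum_filter]
              refine Finset.sum_congr rfl fun j _ => ?_
              rw [hF, indicator_apply]
              simp only [mem_inter_iff, mem_ofPred_eq]
              by_cases h1 : x ∈ R j <;> simp [h1]
          _ = ∑ k ∈ Finset.range (S.filter fun i => x ∈ R i).card, if k < K then w x else 0 :=
              sum_depth_mem hρ (fun k => if k < K then w x else 0) x
          _ = ((Finset.range (S.filter fun i => x ∈ R i).card).filter (· < K)).card * w x := by
              rw [← Finset.sum_filter, Finset.sum_const, nsmul_eq_mul]
          _ ≤ K * w x := by
              gcongr
              calc _ ≤ (Finset.range K).card := Finset.card_le_card fun k hk =>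
                    Finset.mem_range.2 (Finset.mem_filter.1 hk).2
                _ = K := Finset.card_range K
    _ = a * K * ∫⁻ x in U, w x ∂μ := by
        rw [lintegral_const_mul' _ _ (ENNReal.natCast_ne_top K), mul_assoc]
    _ ≤ a * K * (D * ∫⁻ x in R i, w x ∂μ) := by
        gcongr
        exact hw.doubling i hi
    _ = _ := by ring

open Classical in
-- Exponential integrability of the depth, in the manner of John and Nirenberg. Expanding the power
-- over the preceding sets and applying induction to each of them leaves an error `2ε · aKD` times
-- the weight of `R i`, which the choice of `ε` absorbs.
theorem lintegral_mul_pow_depth_le (hρ : Function.Injective ρ) (hR : ∀ i, MeasurableSet (R i))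
    (hfin : ∀ i ∈ S, μ (R i) ≠ ∞) {K : ℕ} (hK0 : K ≠ 0)
    (hK : ∀ i ∈ S, 2 * ∑ j ∈ S with ρ j < ρ i ∧ ¬ Disjoint (R j) (R i), μ (R j) ≤ K * μ (R i))
    {a D : ℝ≥0∞} {w : α → ℝ≥0∞} (hwm : AEMeasurable w μ)
    (hw : IsCarlesonWeight μ ρ R S a D w) {ε : ℝ≥0∞} (hε : 2 * ε * (a * K * D) ≤ 1)
    (hε' : ε ≠ ∞) {i : ι} (hi : i ∈ S) :
    ∫⁻ x in R i, w x * (1 + ε) ^ depth ρ R S i x ∂μ ≤ 2 * ∫⁻ x in R i, w x ∂μ := by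
  induction hN : (S.filter fun j => ρ j < ρ i).card using Nat.strong_induction_on generalizing i with
  | _ N ih =>
  have hpm : ∀ j, AEMeasurable (fun x => w x * (1 + ε) ^ depth ρ R S j x) μ := fun j =>
    hwm.mul (((measurable_from_nat (f := fun k : ℕ => (1 + ε) ^ k)).comp
      (measurable_depth hR j)).aemeasurable)
  calc ∫⁻ x in R i, w x * (1 + ε) ^ depth ρ R S i x ∂μ
      = ∫⁻ x in R i, (w x + ε * ∑ j ∈ S with ρ j < ρ i,
          (R j).indicator (fun x => w x * (1 + ε) ^ depth ρ R S j x) x) ∂μ := by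
        refine lintegral_congr fun x => ?_
        rw [one_add_pow_eq, ← sum_depth_lower hρ, mul_add, mul_one, mul_left_comm, Finset.mul_sum,
          ← Finset.filter_filter, Finset.sum_filter (fun j => x ∈ R j)]
        simp only [indicator_apply]
    _ = ∫⁻ x in R i, w x ∂μ + ε * ∑ j ∈ S with ρ j < ρ i,
          ∫⁻ x in R j ∩ R i, w x * (1 + ε) ^ depth ρ R S j x ∂μ := by
        rw [lintegral_add_left' hwm.restrict, lintegral_const_mul' _ _ hε', lintegral_finsetSum']
        · congr 2
          refine Finset.sum_congr rfl fun j _ => ?_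
          rw [lintegral_indicator (hR j), Measure.restrict_restrict (hR j)]
        · exact fun j _ => ((hpm j).indicator (hR j)).restrict
    _ ≤ ∫⁻ x in R i, w x ∂μ + ε * ∑ j ∈ S with ρ j < ρ i ∧ ¬ Disjoint (R j) (R i),
          2 * ∫⁻ x in R j, w x ∂μ := by
        gcongr
        rw [← Finset.filter_filter, Finset.sum_filter (fun j => ¬ Disjoint (R j) (R i))]
        refine Finset.sum_le_sum fun j hj => ?_
        obtain ⟨hjS, hji⟩ := Finset.mem_filter.1 hj
        split_ifs with h
        · rw [disjoint_iff_inter_eq_empty.1 h]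
          simp
        · refine (lintegral_mono_set inter_subset_left).trans (ih _ ?_ hjS rfl)
          rw [← hN]
          refine Finset.card_lt_card (Finset.ssubset_iff_subset_ne.2 ⟨fun k hk => ?_, fun h => ?_⟩)
          · rw [Finset.mem_filter] at hk ⊢
            exact ⟨hk.1, hk.2.trans hji⟩
          · rw [← h] at hj
            exact lt_irrefl _ (Finset.mem_filter.1 hj).2
    _ ≤ ∫⁻ x in R i, w x ∂μ + ε * (2 * (a * K * D * ∫⁻ x in R i, w x ∂μ)) := by
        rw [← Finset.mul_sum]
        gcongr
        exact sum_weight_le hρ hR hfin hK0 hK hwm hw hi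
    _ = ∫⁻ x in R i, w x ∂μ + 2 * ε * (a * K * D) * ∫⁻ x in R i, w x ∂μ := by ring
    _ ≤ ∫⁻ x in R i, w x ∂μ + 1 * ∫⁻ x in R i, w x ∂μ := by gcongr
    _ = _ := by rw [one_mul, two_mul]

open Classical in
/-- A Carleson embedding theorem with weights that depend on the set. -/
theorem sum_sq_lintegral_le (hρ : Function.Injective ρ) (hR : ∀ i, MeasurableSet (R i))
    {σ : ℝ≥0} (hσ : 1 ≤ σ) {C : ℝ≥0∞} {ℓ : ι → ℝ≥0∞} (hℓ : ∀ i ∈ S, ℓ i ≠ 0 ∧ ℓ i ≠ ∞)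
    {g : ι → α → ℝ≥0∞} (hg : ∀ i ∈ S, AEMeasurable (g i) μ)
    (hC : ∀ i ∈ S, ∫⁻ x in R i, g i x ^ 2 * ((σ : ℝ≥0∞) ^ 2) ^ depth ρ R S i x ∂μ ≤ C * ℓ i)
    {φ : α → ℝ≥0∞} (hφ : AEMeasurable φ μ) :
    ∑ i ∈ S, (ℓ i)⁻¹ * (∫⁻ x in R i, g i x * φ x ∂μ) ^ 2
      ≤ C * (1 - ((σ : ℝ≥0∞) ^ 2)⁻¹)⁻¹ * ∫⁻ x, φ x ^ 2 ∂μ := by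
  have hσ0 : (σ : ℝ≥0∞) ≠ 0 := by
    rw [ENNReal.coe_ne_zero]
    exact (lt_of_lt_of_le zero_lt_one hσ).ne'
  have hpow : ∀ (f : ℕ → ℝ≥0∞) (i : ι), Measurable fun x => f (depth ρ R S i x) := fun f i =>
    (measurable_from_nat (f := f)).comp (measurable_depth hR i)
  set q : ℝ≥0∞ := ((σ : ℝ≥0∞) ^ 2)⁻¹ with hq
  have hterm : ∀ i ∈ S, (ℓ i)⁻¹ * (∫⁻ x in R i, g i x * φ x ∂μ) ^ 2
      ≤ C * ∫⁻ x in R i, φ x ^ 2 * q ^ depth ρ R S i x ∂μ := by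
    intro i hi
    -- The growing factor goes to `g i`, where exponential integrability pays for it. The decaying
    -- factor goes to `φ`, where it makes the sum over all sets through a point a geometric series.
    have h1 : ∀ x, g i x * φ x = (g i x * (σ : ℝ≥0∞) ^ depth ρ R S i x)
        * (φ x * ((σ : ℝ≥0∞)⁻¹) ^ depth ρ R S i x) := by
      intro x
      rw [mul_mul_mul_comm, ← mul_pow, ENNReal.mul_inv_cancel hσ0 ENNReal.coe_ne_top, one_pow,
        mul_one]
    simp only [h1]
    have h2 := sq_lintegral_mul_le (μ := μ.restrict (R i))
      (f := fun x => g i x * (σ : ℝ≥0∞) ^ depth ρ R S i x)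
      (g := fun x => φ x * ((σ : ℝ≥0∞)⁻¹) ^ depth ρ R S i x)
      (((hg i hi).mul (hpow (fun k => (σ : ℝ≥0∞) ^ k) i).aemeasurable).restrict)
      ((hφ.mul (hpow (fun k => ((σ : ℝ≥0∞)⁻¹) ^ k) i).aemeasurable).restrict)
    have h3 : ∀ x, (g i x * (σ : ℝ≥0∞) ^ depth ρ R S i x) ^ 2
        = g i x ^ 2 * ((σ : ℝ≥0∞) ^ 2) ^ depth ρ R S i x := fun x => by
      rw [mul_pow, ← pow_mul, ← pow_mul, mul_comm 2]
    have h4 : ∀ x, (φ x * ((σ : ℝ≥0∞)⁻¹) ^ depth ρ R S i x) ^ 2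
        = φ x ^ 2 * q ^ depth ρ R S i x := fun x => by
      rw [mul_pow, ← pow_mul, hq, ENNReal.inv_pow, ← pow_mul, mul_comm 2]
    simp only [h3, h4] at h2
    calc _ ≤ (ℓ i)⁻¹ * ((C * ℓ i) * ∫⁻ x in R i, φ x ^ 2 * q ^ depth ρ R S i x ∂μ) := by
          gcongr
          exact h2.trans (mul_le_mul_left (hC i hi) _)
      _ = ((ℓ i)⁻¹ * ℓ i) * (C * ∫⁻ x in R i, φ x ^ 2 * q ^ depth ρ R S i x ∂μ) := by ring
      _ = _ := by rw [ENNReal.inv_mul_cancel (hℓ i hi).1 (hℓ i hi).2, one_mul]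
  have hqm : ∀ i, AEMeasurable (fun x => φ x ^ 2 * q ^ depth ρ R S i x) μ := fun i =>
    (hφ.pow_const 2).mul (hpow (fun k => q ^ k) i).aemeasurable
  calc _ ≤ ∑ i ∈ S, C * ∫⁻ x in R i, φ x ^ 2 * q ^ depth ρ R S i x ∂μ :=
        Finset.sum_le_sum hterm
    _ = C * ∫⁻ x, ∑ i ∈ S, (R i).indicator (fun x => φ x ^ 2 * q ^ depth ρ R S i x) x ∂μ := by
        rw [← Finset.mul_sum, lintegral_finsetSum' S fun i _ => (hqm i).indicator (hR i)]
        congr 1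
        exact Finset.sum_congr rfl fun i _ => (lintegral_indicator (hR i) _).symm
    _ ≤ C * ∫⁻ x, (1 - q)⁻¹ * φ x ^ 2 ∂μ := by
        gcongr with x
        calc ∑ i ∈ S, (R i).indicator (fun x => φ x ^ 2 * q ^ depth ρ R S i x) x
            = ∑ i ∈ S with x ∈ R i, φ x ^ 2 * q ^ depth ρ R S i x := by
              rw [Finset.sum_filter]
              simp only [indicator_apply]
          _ = φ x ^ 2 * ∑ k ∈ Finset.range (S.filter fun i => x ∈ R i).card, q ^ k := by
              rw [← Finset.mul_sum, sum_depth_mem hρ (fun k => q ^ k)]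
          _ ≤ φ x ^ 2 * (1 - q)⁻¹ := by
              gcongr
              rw [← ENNReal.tsum_geometric]
              exact ENNReal.sum_le_tsum _
          _ = _ := mul_comm _ _
    _ ≤ _ := by
        rw [lintegral_const_mul'' _ (hφ.pow_const 2), mul_assoc]

end Embedding

end MatrixA2

end

noncomputable section
namespace MatrixA2

/-! ### Reducing operators and the `A_∞` property of scalar weights. -/

section Reducing

variable {n : ℕ} {E : Set ℝ}

/-- Two operator functions on `E` with `⟪H t x, G t y⟫ = ⟪x, y⟫`. -/
structure IsDualPair (E : Set ℝ) (H G : ℝ → EuclideanSpace ℂ (Fin n) →L[ℂ] EuclideanSpace ℂ (Fin n)) : Prop where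
  meas_left : AEStronglyMeasurable H (volume.restrict E)
  meas_right : AEStronglyMeasurable G (volume.restrict E)
  dual : ∀ᵐ t ∂(volume.restrict E), ∀ x y, inner ℂ (H t x) (G t y) = inner ℂ x y

theorem IsDualPair.symm {H G : ℝ → EuclideanSpace ℂ (Fin n) →L[ℂ] EuclideanSpace ℂ (Fin n)} (h : IsDualPair E H G) : IsDualPair E G H := by
  refine ⟨h.meas_right, h.meas_left, ?_⟩
  filter_upwards [h.dual] with t ht x y
  rw [← inner_conj_symm, ht, inner_conj_symm]

/-- A pair of self-adjoint operators, inverse to each other, that normalizes the averages of a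
dual pair over `(x - δ, x + δ) ∩ E`. -/
structure IsReducing (E : Set ℝ) (H G : ℝ → EuclideanSpace ℂ (Fin n) →L[ℂ] EuclideanSpace ℂ (Fin n)) (C x δ : ℝ) (A B : EuclideanSpace ℂ (Fin n) →L[ℂ] EuclideanSpace ℂ (Fin n)) :
    Prop where
  symm_left : ∀ v w, inner ℂ (A v) w = inner ℂ v (A w)
  symm_right : ∀ v w, inner ℂ (B v) w = inner ℂ v (B w)
  dual : ∀ v w, inner ℂ (A v) (B w) = inner ℂ v w
  left : ∀ v, ∫⁻ t in Ioo (x - δ) (x + δ), ‖H t (B v)‖ₑ ^ 2 ∂(volume.restrict E)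
    ≤ ENNReal.ofReal (C * δ) * ‖v‖ₑ ^ 2
  right : ∀ v, ∫⁻ t in Ioo (x - δ) (x + δ), ‖G t (A v)‖ₑ ^ 2 ∂(volume.restrict E)
    ≤ ENNReal.ofReal (C * δ) * ‖v‖ₑ ^ 2

variable {H G : ℝ → EuclideanSpace ℂ (Fin n) →L[ℂ] EuclideanSpace ℂ (Fin n)} {C x δ : ℝ} {A B : EuclideanSpace ℂ (Fin n) →L[ℂ] EuclideanSpace ℂ (Fin n)}

theorem IsReducing.symm (h : IsReducing E H G C x δ A B) : IsReducing E G H C x δ B A := by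
  refine ⟨h.symm_right, h.symm_left, fun v w => ?_, h.right, h.left⟩
  rw [← inner_conj_symm, h.dual, inner_conj_symm]

theorem IsReducing.surjective (h : IsReducing E H G C x δ A B) : Function.Surjective B := by
  have hi : Function.Injective (B : EuclideanSpace ℂ (Fin n) →ₗ[ℂ] EuclideanSpace ℂ (Fin n)) := by
    rw [injective_iff_map_eq_zero]
    intro v hv
    have := h.dual v v
    rw [show B v = 0 from hv, inner_zero_right] at this
    exact inner_self_eq_zero.1 this.symm
  exact LinearMap.surjective_of_injective hi

theorem aemeasurable_enorm_apply (hH : AEStronglyMeasurable H (volume.restrict E)) (e : EuclideanSpace ℂ (Fin n)) :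
    AEMeasurable (fun t => ‖H t e‖ₑ) (volume.restrict E) :=
  (hH.apply_continuousLinearMap e).enorm

/-- The scalar weights `‖H t e‖²` are `A_∞`. -/
theorem IsReducing.lintegral_le (hD : IsDualPair E H G) (h : IsReducing E H G C x δ A B)
    (hC : 0 < C) (hδ : 0 < δ) {θ : ℝ} (hθ : 0 < θ) {F : Set ℝ} (hF : F ⊆ Ioo (x - δ) (x + δ))
    (hFθ : ENNReal.ofReal (θ * δ) ≤ volume.restrict E F) (e : EuclideanSpace ℂ (Fin n)) :
    ∫⁻ t in Ioo (x - δ) (x + δ), ‖H t e‖ₑ ^ 2 ∂(volume.restrict E)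
      ≤ ENNReal.ofReal ((C / θ) ^ 2) * ∫⁻ t in F, ‖H t e‖ₑ ^ 2 ∂(volume.restrict E) := by
  set μ := volume.restrict E with hμ
  obtain ⟨v, rfl⟩ := h.surjective e
  refine (h.left v).trans ?_
  by_cases hv : v = 0
  · simp [hv]
  have hv0 : ‖v‖ₑ ^ 2 ≠ 0 := by simpa using hv
  have hvt : ‖v‖ₑ ^ 2 ≠ ∞ := ENNReal.pow_ne_top enorm_ne_top
  -- Almost everywhere on `E`, `‖v‖²` is the pairing of `H t (B v)` with `G t (A v)`. By
  -- Cauchy–Schwarz a small integral of `‖H t (B v)‖²` over `F` would force a large one of the dual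
  -- weight, which normalization excludes.
  have h1 : ‖v‖ₑ ^ 2 * ENNReal.ofReal (θ * δ)
      ≤ ∫⁻ t in F, ‖H t (B v)‖ₑ * ‖G t (A v)‖ₑ ∂μ := by
    calc ‖v‖ₑ ^ 2 * ENNReal.ofReal (θ * δ) ≤ ‖v‖ₑ ^ 2 * μ F := by gcongr
      _ = ∫⁻ _ in F, ‖v‖ₑ ^ 2 ∂μ := by rw [setLIntegral_const]
      _ ≤ _ := by
        refine lintegral_mono_ae (ae_restrict_of_ae ?_)
        filter_upwards [hD.dual] with t ht
        have h2 : inner ℂ (H t (B v)) (G t (A v)) = inner ℂ v v := by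
          rw [ht, h.symm.dual]
        calc ‖v‖ₑ ^ 2 = ‖inner ℂ (H t (B v)) (G t (A v))‖ₑ := by
              rw [h2, inner_self_eq_norm_sq_to_K, enorm_pow, ← ofReal_norm, ← ofReal_norm]
              simp
          _ ≤ _ := enorm_inner_le _ _
  have h2 : (‖v‖ₑ ^ 2 * ENNReal.ofReal (θ * δ)) ^ 2
      ≤ (∫⁻ t in F, ‖H t (B v)‖ₑ ^ 2 ∂μ) * (ENNReal.ofReal (C * δ) * ‖v‖ₑ ^ 2) := by
    refine (pow_le_pow_left₀ zero_le h1 2).trans ?_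
    refine (sq_lintegral_mul_le (aemeasurable_enorm_apply hD.meas_left _).restrict
      (aemeasurable_enorm_apply hD.meas_right _).restrict).trans ?_
    gcongr
    exact (lintegral_mono_set hF).trans (h.right v)
  set w := ∫⁻ t in F, ‖H t (B v)‖ₑ ^ 2 ∂μ with hw
  have h3 : ‖v‖ₑ ^ 2 * ENNReal.ofReal ((θ * δ) ^ 2) ≤ w * ENNReal.ofReal (C * δ) := by
    refine (ENNReal.mul_le_mul_iff_right hv0 hvt).1 ?_
    calc ‖v‖ₑ ^ 2 * (‖v‖ₑ ^ 2 * ENNReal.ofReal ((θ * δ) ^ 2))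
        = (‖v‖ₑ ^ 2 * ENNReal.ofReal (θ * δ)) ^ 2 := by
          rw [ENNReal.ofReal_pow (by positivity)]
          ring
      _ ≤ _ := h2
      _ = _ := by ring
  calc ENNReal.ofReal (C * δ) * ‖v‖ₑ ^ 2
      = ENNReal.ofReal (C / (θ ^ 2 * δ)) * (‖v‖ₑ ^ 2 * ENNReal.ofReal ((θ * δ) ^ 2)) := by
        rw [mul_left_comm, ← ENNReal.ofReal_mul (by positivity), mul_comm]
        congr 2
        field_simp
    _ ≤ ENNReal.ofReal (C / (θ ^ 2 * δ)) * (w * ENNReal.ofReal (C * δ)) := by gcongr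
    _ = _ := by
        rw [mul_left_comm, ← ENNReal.ofReal_mul (by positivity), mul_comm]
        congr 2
        field_simp

theorem norm_le_sum_norm_apply (T : EuclideanSpace ℂ (Fin n) →L[ℂ] EuclideanSpace ℂ (Fin n)) :
    ‖T‖ ≤ ∑ i, ‖T (EuclideanSpace.single i 1)‖ := by
  refine T.opNorm_le_bound (by positivity) fun x => ?_
  have hx : x = ∑ i, x i • (EuclideanSpace.single i (1 : ℂ) : EuclideanSpace ℂ (Fin n)) := by
    ext j
    simp [Finset.sum_apply, Pi.single_apply]
  calc ‖T x‖ = ‖∑ i, x i • T (EuclideanSpace.single i (1 : ℂ))‖ := by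
        conv_lhs => rw [hx]
        simp only [map_sum, map_smul]
    _ ≤ ∑ i, ‖x i • T (EuclideanSpace.single i (1 : ℂ))‖ := norm_sum_le _ _
    _ ≤ ∑ i, ‖T (EuclideanSpace.single i 1)‖ * ‖x‖ := by
        refine Finset.sum_le_sum fun i _ => ?_
        rw [norm_smul, mul_comm]
        gcongr
        exact PiLp.norm_apply_le x i
    _ = _ := by rw [Finset.sum_mul]

/-- Replaces operator norms by finitely many scalar weights, to which the `A_∞` estimate applies. -/
theorem sq_enorm_le_sum_sq_enorm_apply (T : EuclideanSpace ℂ (Fin n) →L[ℂ] EuclideanSpace ℂ (Fin n)) :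
    ‖T‖ₑ ^ 2 ≤ n * ∑ i, ‖T (EuclideanSpace.single i 1)‖ₑ ^ 2 := by
  have h : ‖T‖ ^ 2 ≤ n * ∑ i, ‖T (EuclideanSpace.single i 1)‖ ^ 2 := by
    refine (pow_le_pow_left₀ (norm_nonneg _) (norm_le_sum_norm_apply T) 2).trans ?_
    have := sq_sum_le_card_mul_sum_sq (s := Finset.univ)
      (f := fun i => ‖T (EuclideanSpace.single i 1)‖)
    simpa using this
  have h2 := ENNReal.ofReal_le_ofReal h
  rw [ENNReal.ofReal_mul (by positivity), ENNReal.ofReal_sum_of_nonneg fun i _ => by positivity]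
    at h2
  simpa [ENNReal.ofReal_pow, ofReal_norm] using h2

/-- `‖A u‖ ≤ ‖G A‖ ‖H u‖`. -/
theorem IsReducing.enorm_apply_le (h : IsReducing E H G C x δ A B) {H₀ G₀ : EuclideanSpace ℂ (Fin n) →L[ℂ] EuclideanSpace ℂ (Fin n)}
    (h₀ : ∀ x y, inner ℂ (H₀ x) (G₀ y) = inner ℂ x y) (u : EuclideanSpace ℂ (Fin n)) :
    ‖A u‖ₑ ≤ ‖G₀ ∘L A‖ₑ * ‖H₀ u‖ₑ := by
  have hn : ‖A u‖ ≤ ‖G₀ ∘L A‖ * ‖H₀ u‖ := by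
    by_cases h0 : ‖A u‖ = 0
    · rw [h0]
      positivity
    have h1 : ‖A u‖ * ‖A u‖ ≤ ‖G₀ ∘L A‖ * ‖H₀ u‖ * ‖A u‖ := by
      calc ‖A u‖ * ‖A u‖ = ‖inner ℂ (A u) (A u)‖ := by
            rw [inner_self_eq_norm_sq_to_K]
            simp [pow_two]
        _ = ‖inner ℂ (H₀ u) ((G₀ ∘L A) (A u))‖ := by
            rw [ContinuousLinearMap.comp_apply, h₀, h.symm_left]
        _ ≤ ‖H₀ u‖ * ‖(G₀ ∘L A) (A u)‖ := norm_inner_le_norm _ _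
        _ ≤ ‖H₀ u‖ * (‖G₀ ∘L A‖ * ‖A u‖) := by
            gcongr
            exact (G₀ ∘L A).le_opNorm _
        _ = _ := by ring
    exact le_of_mul_le_mul_right h1 (lt_of_le_of_ne (norm_nonneg _) (Ne.symm h0))
  rw [← ofReal_norm (A u), ← ofReal_norm (G₀ ∘L A), ← ofReal_norm (H₀ u),
    ← ENNReal.ofReal_mul (norm_nonneg _)]
  exact ENNReal.ofReal_le_ofReal hn

end Reducing

end MatrixA2

end

noncomputable section
namespace MatrixA2

/-! ### The Carleson embedding for sparse cells with reducing operators. -/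

section CellEmbedding

variable {n : ℕ}

/-- Every point of `E` is the centre of normalized intervals of all radii up to `Δ`, in which `E`
is not thin. -/
structure IsReducible (E : Set ℝ) (H G : ℝ → EuclideanSpace ℂ (Fin n) →L[ℂ] EuclideanSpace ℂ (Fin n))
    (C η Δ : ℝ) : Prop where
  dualPair : IsDualPair E H G
  fat : ∀ x ∈ E, ∀ δ, 0 < δ → δ ≤ Δ →
    ENNReal.ofReal (η * δ) ≤ volume.restrict E (Ioo (x - δ) (x + δ))
  reducing : ∀ x ∈ E, ∀ δ, 0 < δ → δ ≤ Δ → ∃ A B, IsReducing E H G C x δ A B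

theorem IsReducible.symm {E : Set ℝ}
    {H G : ℝ → EuclideanSpace ℂ (Fin n) →L[ℂ] EuclideanSpace ℂ (Fin n)} {C η Δ : ℝ}
    (h : IsReducible E H G C η Δ) : IsReducible E G H C η Δ := by
  refine ⟨h.dualPair.symm, h.fat, fun x hx δ h0 h1 => ?_⟩
  obtain ⟨A, B, hAB⟩ := h.reducing x hx δ h0 h1
  exact ⟨B, A, hAB.symm⟩

open Classical in
-- The abstract embedding is applied on `E` to intervals of radius twice the cell length about
-- points of `E`, with the sums of scalar weights `‖G t (A c eᵢ)‖²`. The constant depends only on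
-- `n`, `C` and `η`.
theorem exists_cell_embedding (n : ℕ) {C η : ℝ} (hC : 0 < C) (hη : 0 < η) :
    ∃ M : ℝ≥0, ∀ {E : Set ℝ}
      {H G : ℝ → EuclideanSpace ℂ (Fin n) →L[ℂ] EuclideanSpace ℂ (Fin n)} {Δ : ℝ}
      (_ : IsReducible E H G C η Δ) {t₀ r : ℝ} (_ : 0 < r) (S : Finset (ℕ × ℤ)) (p : ℕ × ℤ → ℝ)
      (A B : ℕ × ℤ → EuclideanSpace ℂ (Fin n) →L[ℂ] EuclideanSpace ℂ (Fin n))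
      (_ : ∀ c ∈ S, p c ∈ E ∧ p c ∈ cell t₀ r c ∧ 6 * (2 ^ c.1 * r) ≤ Δ ∧
        IsReducing E H G C (p c) (2 * (2 ^ c.1 * r)) (A c) (B c))
      (_ : ∀ R, MeasurableSet R →
        ∑ c ∈ S with cell t₀ r c ⊆ R, volume (cell t₀ r c) ≤ 2 * volume R)
      {φ : ℝ → ℝ≥0∞} (_ : AEMeasurable φ (volume.restrict E)),
      ∑ c ∈ S, (ENNReal.ofReal (2 ^ c.1 * r))⁻¹ *
        (∫⁻ t in Ioo (p c - 2 * (2 ^ c.1 * r)) (p c + 2 * (2 ^ c.1 * r)),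
          ‖G t ∘L A c‖ₑ * φ t ∂(volume.restrict E)) ^ 2
        ≤ M * ∫⁻ t, φ t ^ 2 ∂(volume.restrict E) := by
  -- Twice the total measure of the preceding neighbours of an interval is at most `192 ℓ`, while
  -- the interval itself carries mass at least `2ηℓ`.
  set K : ℕ := ⌈96 / η⌉₊ + 1 with hKdef
  have hK0 : K ≠ 0 := Nat.succ_ne_zero _
  have hKη : 96 ≤ K * η := by
    rw [← div_le_iff₀ hη]
    refine (Nat.le_ceil _).trans ?_
    rw [hKdef]
    push_cast
    linarith
  -- `a` comes from subsets carrying half the mass of an interval, and `D` from an interval inside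
  -- its threefold enlargement. `ε` is small enough for exponential integrability.
  set a : ℝ≥0 := Real.toNNReal ((C / (η / 2)) ^ 2) with ha
  set D : ℝ≥0 := Real.toNNReal ((C / (η / 3)) ^ 2) with hD
  set ε : ℝ≥0 := (2 * (a * K * D) + 1)⁻¹ with hε
  have hε0 : 0 < ε := by positivity
  have hε1 : 2 * ε * (a * K * D) ≤ 1 := by
    rw [hε, mul_right_comm, ← div_eq_mul_inv]
    exact div_le_one_of_le₀ (by simp) (by positivity)
  have hε2 : 2 * (ε : ℝ≥0∞) * (a * K * D) ≤ 1 := by exact_mod_cast hε1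
  set σ : ℝ≥0 := NNReal.sqrt (1 + ε) with hσ
  have hσ2 : σ ^ 2 = 1 + ε := NNReal.sq_sqrt _
  have hσ1 : 1 ≤ σ := by
    rw [hσ, ← NNReal.sqrt_one]
    exact NNReal.sqrt_le_sqrt.2 (by simp)
  have hσe : (σ : ℝ≥0∞) ^ 2 = 1 + ε := by exact_mod_cast congrArg ((↑) : ℝ≥0 → ℝ≥0∞) hσ2
  set M : ℝ≥0∞ := 2 * (n * n * ENNReal.ofReal (2 * C)) * (1 - ((σ : ℝ≥0∞) ^ 2)⁻¹)⁻¹ with hM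
  have hMt : M ≠ ∞ := by
    refine ENNReal.mul_ne_top ?_ ?_
    · exact ENNReal.mul_ne_top (by norm_num) (ENNReal.mul_ne_top
        (ENNReal.mul_ne_top (ENNReal.natCast_ne_top n) (ENNReal.natCast_ne_top n))
        ENNReal.ofReal_ne_top)
    · rw [ENNReal.inv_ne_top, hσe]
      refine (tsub_pos_of_lt ?_).ne'
      rw [ENNReal.inv_lt_one]
      have : (0 : ℝ≥0∞) < ε := by exact_mod_cast hε0
      exact ENNReal.lt_add_right ENNReal.one_ne_top this.ne'
  refine ⟨M.toNNReal, ?_⟩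
  intro E H G Δ hred t₀ r hr S p A B hS hcar φ hφ
  rw [ENNReal.coe_toNNReal hMt]
  set μ := volume.restrict E with hμ
  set ℓ : ℕ × ℤ → ℝ := fun c => 2 ^ c.1 * r with hℓdef
  have hℓ : ∀ c, 0 < ℓ c := fun c => by
    simp only [hℓdef]
    positivity
  set R : ℕ × ℤ → Set ℝ := fun c => Ioo (p c - 2 * ℓ c) (p c + 2 * ℓ c) with hRdef
  have hR : ∀ c, MeasurableSet (R c) := fun c => measurableSet_Ioo
  have hRvol : ∀ c, μ (R c) ≤ ENNReal.ofReal (4 * ℓ c) := fun c => by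
    refine (Measure.restrict_apply_le _ _).trans (le_of_eq ?_)
    rw [hRdef, Real.volume_Ioo]
    congr 1
    ring
  have hfin : ∀ c ∈ S, μ (R c) ≠ ∞ := fun c _ =>
    ((hRvol c).trans_lt ENNReal.ofReal_lt_top).ne
  -- Lexicographic order puts shorter cells first. A preceding interval that meets `R c` therefore
  -- lies within `6 ℓ c` of `p c`.
  set ρ : ℕ × ℤ → ℕ ×ₗ ℤ := fun c => toLex c with hρdef
  have hρ : Function.Injective ρ := toLex.injective
  have hlevel : ∀ {c c'}, ρ c < ρ c' → ℓ c ≤ ℓ c' := by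
    intro c c' h
    have h1 : c.1 ≤ c'.1 := by
      rcases Prod.Lex.toLex_lt_toLex.1 h with h | h
      · exact h.le
      · exact h.1.le
    simp only [hℓdef]
    gcongr
    norm_num
  have hsub : ∀ {c c'}, ρ c' < ρ c → ¬ Disjoint (R c') (R c) →
      R c' ⊆ Ioo (p c - 6 * ℓ c) (p c + 6 * ℓ c) := by
    intro c c' h h'
    obtain ⟨z, hz, hz'⟩ := not_disjoint_iff.1 h'
    have h1 := hlevel h
    rw [hRdef] at hz hz' ⊢
    obtain ⟨h2, h3⟩ := hz
    obtain ⟨h4, h5⟩ := hz'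
    exact Ioo_subset_Ioo (by linarith) (by linarith)
  have hcellR : ∀ c ∈ S, cell t₀ r c ⊆ R c := by
    intro c hc z hz
    have := cell_bounds hz (hS c hc).2.1
    rw [abs_lt] at this
    have h0 := hℓ c
    simp only [hRdef, hℓdef] at this h0 ⊢
    exact ⟨by linarith, by linarith⟩
  have hfat : ∀ c ∈ S, ENNReal.ofReal (η * (2 * ℓ c)) ≤ μ (R c) := fun c hc => by
    have h1 := (hS c hc).2.2.1
    have h0 := hℓ c
    simp only [hℓdef] at h0
    exact hred.fat (p c) (hS c hc).1 (2 * ℓ c) (by simp only [hℓdef]; linarith)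
      (by simp only [hℓdef]; linarith)
  have hK : ∀ i ∈ S, 2 * ∑ j ∈ S with ρ j < ρ i ∧ ¬ Disjoint (R j) (R i), μ (R j)
      ≤ K * μ (R i) := by
    intro i hi
    calc 2 * ∑ j ∈ S with ρ j < ρ i ∧ ¬ Disjoint (R j) (R i), μ (R j)
        ≤ 2 * ∑ j ∈ S with ρ j < ρ i ∧ ¬ Disjoint (R j) (R i), 4 * volume (cell t₀ r j) := by
          gcongr with j
          refine (hRvol j).trans (le_of_eq ?_)
          rw [volume_cell, ENNReal.ofReal_mul (by norm_num), show ENNReal.ofReal 4 = 4 by simp]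
      _ ≤ 2 * (4 * (2 * volume (Ioo (p i - 6 * ℓ i) (p i + 6 * ℓ i)))) := by
          rw [← Finset.mul_sum]
          gcongr
          refine le_trans (Finset.sum_le_sum_of_subset fun j hj => ?_)
            (hcar _ measurableSet_Ioo)
          rw [Finset.mem_filter] at hj ⊢
          exact ⟨hj.1, (hcellR j hj.1).trans (hsub hj.2.1 hj.2.2)⟩
      _ = ENNReal.ofReal (192 * ℓ i) := by
          rw [Real.volume_Ioo, show (2 : ℝ≥0∞) = ENNReal.ofReal 2 by simp,
            show (4 : ℝ≥0∞) = ENNReal.ofReal 4 by simp, ← ENNReal.ofReal_mul (by norm_num),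
            ← ENNReal.ofReal_mul (by norm_num), ← ENNReal.ofReal_mul (by norm_num)]
          congr 1
          ring
      _ ≤ ENNReal.ofReal (K * (η * (2 * ℓ i))) := by
          refine ENNReal.ofReal_le_ofReal ?_
          have := mul_le_mul_of_nonneg_right hKη (hℓ i).le
          nlinarith
      _ ≤ K * μ (R i) := by
          rw [ENNReal.ofReal_mul (by positivity), ENNReal.ofReal_natCast]
          gcongr
          exact hfat i hi
  set w : ℕ × ℤ → ℝ → ℝ≥0∞ := fun c t =>
    ∑ i, ‖G t (A c (EuclideanSpace.single i 1))‖ₑ ^ 2 with hwdef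
  have hwm1 : ∀ e, AEMeasurable (fun t => ‖G t e‖ₑ ^ 2) μ := fun e =>
    (aemeasurable_enorm_apply hred.dualPair.meas_right e).pow_const 2
  have hwm : ∀ c, AEMeasurable (w c) μ := fun c =>
    Finset.aemeasurable_fun_sum _ fun i _ => hwm1 _
  have hwint : ∀ c (F : Set ℝ), ∫⁻ t in F, w c t ∂μ
      = ∑ i, ∫⁻ t in F, ‖G t (A c (EuclideanSpace.single i 1))‖ₑ ^ 2 ∂μ := fun c F =>
    lintegral_finsetSum' _ fun i _ => (hwm1 _).restrict
  -- The `A_∞` estimate at `p c` holds for `‖G t e‖²` with any fixed vector `e`. So the weight may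
  -- belong to another cell `c'`, with the same constants.
  have hAinf : ∀ c ∈ S, ∀ δ, 0 < δ → δ ≤ Δ → ∀ θ, 0 < θ → ∀ F ⊆ Ioo (p c - δ) (p c + δ),
      ENNReal.ofReal (θ * δ) ≤ μ F → ∀ c',
      ∫⁻ t in Ioo (p c - δ) (p c + δ), w c' t ∂μ
        ≤ ENNReal.ofReal ((C / θ) ^ 2) * ∫⁻ t in F, w c' t ∂μ := by
    intro c hc δ hδ hδ' θ hθ F hF hFθ c'
    obtain ⟨A', B', hAB⟩ := hred.reducing (p c) (hS c hc).1 δ hδ hδ'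
    rw [hwint, hwint, Finset.mul_sum]
    exact Finset.sum_le_sum fun i _ =>
      hAB.symm.lintegral_le hred.dualPair.symm hC hδ hθ hF hFθ _
  have hcw : ∀ c, IsCarlesonWeight μ ρ R S a D (w c) := by
    intro c
    refine ⟨fun i hi F hF hFm hF2 => ?_, fun i hi => ?_⟩
    · refine hAinf i hi (2 * ℓ i) (by linarith [hℓ i]) ?_ (η / 2) (by positivity) F hF ?_ c
      · have := (hS i hi).2.2.1
        have h0 := hℓ i
        simp only [hℓdef] at h0 ⊢
        linarith
      · have h1 := (hfat i hi).trans hF2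
        rw [show η * (2 * ℓ i) = 2 * (η / 2 * (2 * ℓ i)) by ring,
          ENNReal.ofReal_mul (by norm_num), show ENNReal.ofReal 2 = 2 by simp] at h1
        exact (ENNReal.mul_le_mul_iff_right (by norm_num) (by norm_num)).1 h1
    · refine (lintegral_mono_set (t := Ioo (p i - 6 * ℓ i) (p i + 6 * ℓ i)) ?_).trans ?_
      · refine iUnion₂_subset fun j _ => iUnion_subset fun hj => ?_
        exact hsub hj.1 hj.2
      · refine hAinf i hi (6 * ℓ i) (by linarith [hℓ i]) (hS i hi).2.2.1 (η / 3) (by positivity)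
          (R i) ?_ ?_ c
        · have := hℓ i
          exact Ioo_subset_Ioo (by linarith) (by linarith)
        · refine le_trans (le_of_eq ?_) (hfat i hi)
          congr 1
          ring
  refine sum_sq_lintegral_le (C := 2 * (n * n * ENNReal.ofReal (2 * C))) (ρ := ρ) (R := R) hρ hR hσ1
    (fun c _ => ⟨?_, ENNReal.ofReal_ne_top⟩) (fun c _ => ?_) (fun c hc => ?_) hφ
  · exact (ENNReal.ofReal_pos.2 (hℓ c)).ne'
  · exact ((ContinuousLinearMap.compL ℂ _ _ _).flip (A c)).continuous.comp_aestronglyMeasurable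
      hred.dualPair.meas_right |>.enorm
  · calc ∫⁻ t in R c, ‖G t ∘L A c‖ₑ ^ 2 * ((σ : ℝ≥0∞) ^ 2) ^ depth ρ R S c t ∂μ
        ≤ ∫⁻ t in R c, n * (w c t * (1 + ε) ^ depth ρ R S c t) ∂μ := by
          refine lintegral_mono fun t => ?_
          rw [hσe, ← mul_assoc]
          gcongr
          exact sq_enorm_le_sum_sq_enorm_apply (G t ∘L A c)
      _ = n * ∫⁻ t in R c, w c t * (1 + ε) ^ depth ρ R S c t ∂μ :=
          lintegral_const_mul' _ _ (ENNReal.natCast_ne_top n)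
      _ ≤ n * (2 * ∫⁻ t in R c, w c t ∂μ) := by
          gcongr
          exact lintegral_mul_pow_depth_le hρ hR hfin hK0 hK (hwm c) (hcw c) hε2
            ENNReal.coe_ne_top hc
      _ ≤ n * (2 * (n * ENNReal.ofReal (C * (2 * ℓ c)))) := by
          gcongr
          rw [hwint]
          refine (Finset.sum_le_sum fun i _ => (hS c hc).2.2.2.right _).trans ?_
          simp [← ofReal_norm, hℓdef]
      _ = _ := by
          rw [show C * (2 * ℓ c) = 2 * C * ℓ c by ring, ENNReal.ofReal_mul (by positivity)]
          ring

end CellEmbedding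

end MatrixA2

end

noncomputable section
namespace MatrixA2

/-! ### The weighted bound for regularized Cauchy integrals. -/

section Bilinear

/-- Cauchy–Schwarz for the measure with mass `k i` at each `i ∈ S`. -/
theorem sq_sum_mul_le {ι : Type*} (S : Finset ι) (k a b : ι → ℝ≥0∞) :
    (∑ i ∈ S, k i * (a i * b i)) ^ 2 ≤ (∑ i ∈ S, k i * a i ^ 2) * ∑ i ∈ S, k i * b i ^ 2 := by
  let _ : MeasurableSpace ι := ⊤
  have hm : ∀ f : ι → ℝ≥0∞, Measurable f := fun f => measurable_from_top
  have hs : ∀ f : ι → ℝ≥0∞, ∫⁻ i, f i ∂(∑ i ∈ S, k i • Measure.dirac i) = ∑ i ∈ S, k i * f i := by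
    intro f
    rw [lintegral_finsetSum_measure]
    refine Finset.sum_congr rfl fun i _ => ?_
    rw [lintegral_smul_measure, lintegral_dirac' _ (hm f), smul_eq_mul]
  have := sq_lintegral_mul_le (μ := ∑ i ∈ S, k i • Measure.dirac i)
    (hm a).aemeasurable (hm b).aemeasurable
  rwa [hs, hs, hs] at this

variable {n : ℕ}

theorem aemeasurable_enorm_clm {α : Type*} [MeasurableSpace α] {μ : Measure α}
    {H : α → EuclideanSpace ℂ (Fin n) →L[ℂ] EuclideanSpace ℂ (Fin n)}
    (hH : AEStronglyMeasurable H μ) {u : α → EuclideanSpace ℂ (Fin n)}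
    (hu : AEStronglyMeasurable u μ) : AEMeasurable (fun t => ‖H t (u t)‖ₑ) μ := by
  have h : AEStronglyMeasurable (fun t => H t (u t)) μ :=
    isBoundedBilinearMap_apply.continuous.comp_aestronglyMeasurable (hH.prodMk hu)
  exact h.enorm

/-- The integral over a set of an expression vanishing off `E`, in a normalized coordinate. -/
theorem IsReducing.lintegral_apply_le {E : Set ℝ} (hEm : MeasurableSet E)
    {H G : ℝ → EuclideanSpace ℂ (Fin n) →L[ℂ] EuclideanSpace ℂ (Fin n)} {C x δ : ℝ}
    {A B : EuclideanSpace ℂ (Fin n) →L[ℂ] EuclideanSpace ℂ (Fin n)} (hD : IsDualPair E H G)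
    (h : IsReducing E H G C x δ A B) {u : ℝ → EuclideanSpace ℂ (Fin n)}
    (hu0 : ∀ t ∉ E, u t = 0) {Q R : Set ℝ} (hR : MeasurableSet R) (hQR : Q ⊆ R) :
    ∫⁻ t in Q, ‖A (u t)‖ₑ
      ≤ ∫⁻ t in R, ‖G t ∘L A‖ₑ * ‖H t (u t)‖ₑ ∂(volume.restrict E) := by
  calc ∫⁻ t in Q, ‖A (u t)‖ₑ ≤ ∫⁻ t in R, ‖A (u t)‖ₑ := lintegral_mono_set hQR
    _ = ∫⁻ t in R, E.indicator (fun t => ‖A (u t)‖ₑ) t := by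
        refine lintegral_congr fun t => ?_
        by_cases ht : t ∈ E
        · rw [indicator_of_mem ht]
        · rw [indicator_of_notMem ht, hu0 t ht]
          simp
    _ = ∫⁻ t in R, ‖A (u t)‖ₑ ∂(volume.restrict E) := by
        rw [lintegral_indicator hEm, Measure.restrict_restrict hEm, Measure.restrict_restrict hR,
          inter_comm]
    _ ≤ _ := by
        refine lintegral_mono_ae (ae_restrict_of_ae ?_)
        filter_upwards [hD.dual] with t ht
        exact h.enorm_apply_le ht _

/-- The bound does not depend on the height, so it survives the passage to the boundary. The radius
`12 L` is six times the length of the top cell `[-L, L)`. -/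
theorem exists_bilinear_bound (n : ℕ) {C η L : ℝ} (hC : 0 < C) (hη : 0 < η) (hL : 0 < L) :
    ∃ M : ℝ≥0, ∀ {E : Set ℝ} (_ : MeasurableSet E) (_ : E ⊆ Ico (-L) L)
      {H G : ℝ → EuclideanSpace ℂ (Fin n) →L[ℂ] EuclideanSpace ℂ (Fin n)}
      (_ : IsReducible E H G C η (12 * L)) {y : ℝ} (_ : 0 < y)
      {u v : ℝ → EuclideanSpace ℂ (Fin n)} (_ : Integrable u) (_ : Integrable v)
      (_ : ∀ t ∉ E, u t = 0) (_ : ∀ t ∉ E, v t = 0),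
      ‖∫ x : ℝ, inner ℂ (cauchy u (x + y * Complex.I)) (v x)‖ₑ ^ 2
        ≤ M * ((∫⁻ t, ‖H t (u t)‖ₑ ^ 2 ∂(volume.restrict E)) *
          ∫⁻ t, ‖G t (v t)‖ₑ ^ 2 ∂(volume.restrict E)) := by
  classical
  obtain ⟨M, hM⟩ := exists_cell_embedding n hC hη
  refine ⟨(localConst n).toNNReal ^ 2 * (M * M), ?_⟩
  intro E hEm hEL H G hred y hy u v hu hv hu0 hv0
  -- Enough generations for the smallest cells to be no longer than `y`.
  obtain ⟨D, hD⟩ := exists_nat_gt (2 * L / y)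
  set r : ℝ := 2 * L / 2 ^ D with hr
  have hr0 : 0 < r := by positivity
  have hry : r ≤ y := by
    rw [hr, div_le_iff₀ (by positivity)]
    rw [div_lt_iff₀ hy] at hD
    have h1 : (D : ℝ) ≤ 2 ^ D := by exact_mod_cast Nat.lt_two_pow_self.le
    nlinarith
  have hDr : 2 ^ D * r = 2 * L := by
    rw [hr]
    field_simp
  have hQ : cell (-L) r (D, 0) = Ico (-L) L := by
    rw [cell]
    simp only [hDr]
    push_cast
    congr 1 <;> ring
  have hlen : ∀ c : ℕ × ℤ, c.1 ≤ D → 2 ^ c.1 * r ≤ 2 * L := fun c hc => by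
    rw [← hDr]
    gcongr
    norm_num
  -- Cells that miss `E` receive the identity pair, since sparse domination asks for a dual pair on
  -- every cell. Their terms vanish with `v`.
  have hex : ∀ c : ℕ × ℤ, ∃ q : ℝ × (EuclideanSpace ℂ (Fin n) →L[ℂ] EuclideanSpace ℂ (Fin n)) ×
      (EuclideanSpace ℂ (Fin n) →L[ℂ] EuclideanSpace ℂ (Fin n)),
      (∀ v w, inner ℂ (q.2.1 v) (q.2.2 w) = inner ℂ v w) ∧
      (c.1 ≤ D → (E ∩ cell (-L) r c).Nonempty → q.1 ∈ E ∧ q.1 ∈ cell (-L) r c ∧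
        IsReducing E H G C q.1 (2 * (2 ^ c.1 * r)) q.2.1 q.2.2) := by
    intro c
    by_cases hc : c.1 ≤ D ∧ (E ∩ cell (-L) r c).Nonempty
    · obtain ⟨hc1, p, hpE, hpc⟩ := hc
      have h0 : 0 < 2 ^ c.1 * r := by positivity
      obtain ⟨A, B, hAB⟩ := hred.reducing p hpE (2 * (2 ^ c.1 * r)) (by linarith)
        (by linarith [hlen c hc1])
      exact ⟨(p, A, B), hAB.dual, fun _ _ => ⟨hpE, hpc, hAB⟩⟩
    · exact ⟨(0, .id ℂ _, .id ℂ _), fun v w => rfl, fun h1 h2 => absurd ⟨h1, h2⟩ hc⟩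
  choose q hq1 hq2 using hex
  obtain ⟨S, hS1, hS2, hS3⟩ := exists_sparse_domination (t₀ := -L) hr0 hry hu hv
    (fun c => (q c).2.1) (fun c => (q c).2.2) hq1 D 0
  rw [hQ] at hS1 hS2 hS3
  have htri : (tripleCell (-L) r (D, 0)).indicator u = u := by
    rw [indicator_eq_self]
    intro t ht
    have : t ∈ E := by
      by_contra h
      exact ht (hu0 t h)
    refine cell_subset_tripleCell hr0 _ ?_
    rw [hQ]
    exact hEL this
  have hint : ∫ x : ℝ in Ico (-L) L, inner ℂ (cauchy u (x + y * Complex.I)) (v x)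
      = ∫ x : ℝ, inner ℂ (cauchy u (x + y * Complex.I)) (v x) := by
    refine setIntegral_eq_integral_of_forall_compl_eq_zero fun x hx => ?_
    rw [hv0 x fun h => hx (hEL h), inner_zero_right]
  rw [htri, hint] at hS3
  set S' := S.filter fun c => (E ∩ cell (-L) r c).Nonempty with hS'
  set ℓ : ℕ × ℤ → ℝ := fun c => 2 ^ c.1 * r with hℓ
  set R : ℕ × ℤ → Set ℝ := fun c => Ioo ((q c).1 - 2 * ℓ c) ((q c).1 + 2 * ℓ c) with hR
  have hS'q : ∀ c ∈ S', c.1 ≤ D ∧ (q c).1 ∈ E ∧ (q c).1 ∈ cell (-L) r c ∧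
      IsReducing E H G C (q c).1 (2 * (2 ^ c.1 * r)) (q c).2.1 (q c).2.2 := by
    intro c hc
    obtain ⟨h1, h2⟩ := Finset.mem_filter.1 hc
    exact ⟨(hS1 c h1).2, hq2 c (hS1 c h1).2 h2⟩
  have hcar : ∀ R, MeasurableSet R →
      ∑ c ∈ S' with cell (-L) r c ⊆ R, volume (cell (-L) r c) ≤ 2 * volume R := by
    intro R hR
    calc _ ≤ ∑ c ∈ S with cell (-L) r c ⊆ R, volume (cell (-L) r c) :=
          Finset.sum_le_sum_of_subset
            (Finset.filter_subset_filter _ (Finset.filter_subset _ _))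
      _ ≤ _ := (hS2 R hR).trans (mul_le_mul_right (measure_mono inter_subset_left) _)
  set μ := volume.restrict E with hμ
  set a : ℕ × ℤ → ℝ≥0∞ := fun c =>
    ∫⁻ t in R c, ‖G t ∘L (q c).2.1‖ₑ * ‖H t (u t)‖ₑ ∂μ with ha
  set b : ℕ × ℤ → ℝ≥0∞ := fun c =>
    ∫⁻ t in R c, ‖H t ∘L (q c).2.2‖ₑ * ‖G t (v t)‖ₑ ∂μ with hb
  have hsum : ∑ c ∈ S, ENNReal.ofReal (2 ^ c.1 * r)⁻¹ *
      ((∫⁻ t in tripleCell (-L) r c, ‖(q c).2.1 (u t)‖ₑ) *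
        ∫⁻ t in cell (-L) r c, ‖(q c).2.2 (v t)‖ₑ)
      ≤ ∑ c ∈ S', (ENNReal.ofReal (2 ^ c.1 * r))⁻¹ * (a c * b c) := by
    rw [hS', Finset.sum_filter]
    refine Finset.sum_le_sum fun c hc => ?_
    have h0 : 0 < 2 ^ c.1 * r := by positivity
    split_ifs with hne
    · rw [ENNReal.ofReal_inv_of_pos h0]
      obtain ⟨-, h1, h2, h3⟩ := hS'q c (Finset.mem_filter.2 ⟨hc, hne⟩)
      have htr : tripleCell (-L) r c ⊆ R c := by
        intro z hz
        rw [tripleCell] at hz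
        obtain ⟨h4, h5⟩ := h2
        obtain ⟨h6, h7⟩ := hz
        simp only [hR, hℓ]
        exact ⟨by linarith, by linarith⟩
      gcongr
      · exact h3.lintegral_apply_le hEm hred.dualPair hu0 measurableSet_Ioo htr
      · exact h3.symm.lintegral_apply_le hEm hred.dualPair.symm hv0 measurableSet_Ioo
          ((cell_subset_tripleCell hr0 c).trans htr)
    · have : ∫⁻ t in cell (-L) r c, ‖(q c).2.2 (v t)‖ₑ = 0 := by
        rw [setLIntegral_congr_fun (g := fun _ => 0) (measurableSet_cell c) fun t ht => ?_]
        · simp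
        · rw [hv0 t fun h => hne ⟨t, h, ht⟩]
          simp
      rw [this, mul_zero, mul_zero]
  have hA := hM hred hr0 S' (fun c => (q c).1) (fun c => (q c).2.1) (fun c => (q c).2.2)
    (fun c hc => ⟨(hS'q c hc).2.1, (hS'q c hc).2.2.1, by linarith [hlen c (hS'q c hc).1],
      (hS'q c hc).2.2.2⟩) hcar
    (aemeasurable_enorm_clm hred.dualPair.meas_left hu.aestronglyMeasurable.restrict)
  have hB := hM hred.symm hr0 S' (fun c => (q c).1) (fun c => (q c).2.2) (fun c => (q c).2.1)
    (fun c hc => ⟨(hS'q c hc).2.1, (hS'q c hc).2.2.1, by linarith [hlen c (hS'q c hc).1],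
      (hS'q c hc).2.2.2.symm⟩) hcar
    (aemeasurable_enorm_clm hred.dualPair.meas_right hv.aestronglyMeasurable.restrict)
  calc ‖∫ x : ℝ, inner ℂ (cauchy u (x + y * Complex.I)) (v x)‖ₑ ^ 2
      ≤ (ENNReal.ofReal (localConst n) *
          ∑ c ∈ S', (ENNReal.ofReal (2 ^ c.1 * r))⁻¹ * (a c * b c)) ^ 2 := by
        gcongr
        exact hS3.trans (mul_le_mul_right hsum _)
    _ ≤ ENNReal.ofReal (localConst n) ^ 2 *
        ((M * ∫⁻ t, ‖H t (u t)‖ₑ ^ 2 ∂μ) * (M * ∫⁻ t, ‖G t (v t)‖ₑ ^ 2 ∂μ)) := by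
        rw [mul_pow]
        gcongr
        exact (sq_sum_mul_le _ _ _ _).trans (mul_le_mul' hA hB)
    _ = _ := by
        push_cast
        rw [show ((localConst n).toNNReal : ℝ≥0∞) = ENNReal.ofReal (localConst n) from rfl]
        ring

end Bilinear

end MatrixA2

end

noncomputable section
namespace MatrixA2

/-! ### Square roots of positive matrices. -/

section Roots

variable {n : ℕ}

/-- The operator on `ℂⁿ` given by a matrix. -/
abbrev clm (A : Matrix (Fin n) (Fin n) ℂ) : EuclideanSpace ℂ (Fin n) →L[ℂ] EuclideanSpace ℂ (Fin n) :=
  Matrix.toEuclideanCLM (n := Fin n) (𝕜 := ℂ) A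

theorem clm_mul_apply (A B : Matrix (Fin n) (Fin n) ℂ) (x : EuclideanSpace ℂ (Fin n)) :
    clm (A * B) x = clm A (clm B x) := by
  rw [clm, map_mul]
  rfl

theorem inner_clm_left (A : Matrix (Fin n) (Fin n) ℂ) (x y : EuclideanSpace ℂ (Fin n)) :
    inner ℂ (clm A x) y = inner ℂ x (clm (star A) y) := by
  rw [clm, clm, map_star, ContinuousLinearMap.star_eq_adjoint,
    ContinuousLinearMap.adjoint_inner_right]

theorem inner_clm_eq_sum (A : Matrix (Fin n) (Fin n) ℂ) (x y : EuclideanSpace ℂ (Fin n)) :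
    inner ℂ x (clm A y) = ∑ i, ∑ j, A i j * (y j * star (x i)) := by
  rw [PiLp.inner_apply]
  refine Finset.sum_congr rfl fun i _ => ?_
  have : (clm A y) i = ∑ j, A i j * y j := rfl
  rw [this, RCLike.inner_apply, Finset.sum_mul]
  exact Finset.sum_congr rfl fun j _ => mul_assoc _ _ _

theorem star_sqrt (A : Matrix (Fin n) (Fin n) ℂ) : star (CFC.sqrt A) = CFC.sqrt A :=
  (IsSelfAdjoint.of_nonneg (CFC.sqrt_nonneg A)).star_eq

theorem inner_sqrt_left (A : Matrix (Fin n) (Fin n) ℂ) (x y : EuclideanSpace ℂ (Fin n)) :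
    inner ℂ (clm (CFC.sqrt A) x) y = inner ℂ x (clm (CFC.sqrt A) y) := by
  rw [inner_clm_left, star_sqrt]

theorem inner_sqrt_sqrt {A : Matrix (Fin n) (Fin n) ℂ} (hA : A.PosSemidef)
    (x y : EuclideanSpace ℂ (Fin n)) :
    inner ℂ (clm (CFC.sqrt A) x) (clm (CFC.sqrt A) y) = inner ℂ x (clm A y) := by
  rw [inner_sqrt_left, ← clm_mul_apply, CFC.sqrt_mul_sqrt_self A hA.nonneg]

theorem sqrt_mul_sqrt_inv {A : Matrix (Fin n) (Fin n) ℂ} (hA : A.PosDef) :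
    CFC.sqrt A * CFC.sqrt A⁻¹ = 1 := by
  rw [← Matrix.PosSemidef.inv_sqrt hA.posSemidef]
  refine Matrix.mul_nonsing_inv _ ?_
  rw [← Matrix.isUnit_iff_isUnit_det]
  refine isUnit_of_mul_isUnit_left (y := CFC.sqrt A) ?_
  rw [CFC.sqrt_mul_sqrt_self A hA.posSemidef.nonneg]
  exact hA.isUnit

theorem inner_sqrt_sqrt_inv {A : Matrix (Fin n) (Fin n) ℂ} (hA : A.PosDef)
    (x y : EuclideanSpace ℂ (Fin n)) :
    inner ℂ (clm (CFC.sqrt A) x) (clm (CFC.sqrt A⁻¹) y) = inner ℂ x y := by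
  rw [inner_sqrt_left, ← clm_mul_apply, sqrt_mul_sqrt_inv hA, clm, map_one]
  rfl

theorem sq_norm_sqrt {A : Matrix (Fin n) (Fin n) ℂ} (hA : A.PosSemidef)
    (x : EuclideanSpace ℂ (Fin n)) :
    ‖clm (CFC.sqrt A) x‖ ^ 2 = (inner ℂ x (clm A x)).re := by
  rw [← inner_sqrt_sqrt hA, inner_self_eq_norm_sq_to_K]
  norm_cast

theorem inner_clm_self_eq {A : Matrix (Fin n) (Fin n) ℂ} (hA : A.PosSemidef)
    (x : EuclideanSpace ℂ (Fin n)) :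
    inner ℂ x (clm A x) = ((inner ℂ x (clm A x)).re : ℂ) := by
  rw [← sq_norm_sqrt hA, ← inner_sqrt_sqrt hA, inner_self_eq_norm_sq_to_K]
  norm_cast

theorem posDef_of_inner {A : Matrix (Fin n) (Fin n) ℂ} (hA : A.IsHermitian)
    (h : ∀ x : EuclideanSpace ℂ (Fin n), x ≠ 0 → 0 < inner ℂ x (clm A x)) : A.PosDef := by
  refine Matrix.PosDef.of_dotProduct_mulVec_pos hA fun {x} hx => ?_
  have h1 := h (WithLp.toLp 2 x) (by simpa using hx)
  rwa [EuclideanSpace.inner_eq_star_dotProduct, dotProduct_comm] at h1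

theorem PosDef.inner_pos {A : Matrix (Fin n) (Fin n) ℂ} (hA : A.PosDef)
    {x : EuclideanSpace ℂ (Fin n)} (hx : x ≠ 0) : 0 < (inner ℂ x (clm A x)).re := by
  have h1 := hA.dotProduct_mulVec_pos (x := x.ofLp) (by simpa using hx)
  rw [dotProduct_comm] at h1
  have : inner ℂ x (clm A x) = dotProduct (A.mulVec x.ofLp) (star x.ofLp) := by
    rw [EuclideanSpace.inner_eq_star_dotProduct]
    rfl
  rw [this]
  exact (Complex.pos_iff.1 h1).1

end Roots

/-! ### Measurability and averages of matrix weights. -/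

section Weights

variable {n : ℕ} {E : Set ℝ} {W : ℝ → Matrix (Fin n) (Fin n) ℂ}

theorem aestronglyMeasurable_matrix {α : Type*} [MeasurableSpace α] {μ : Measure α}
    {W : α → Matrix (Fin n) (Fin n) ℂ} (h : ∀ i j, AEMeasurable (fun t => W t i j) μ) :
    AEStronglyMeasurable W μ := by
  have : W = fun t => ∑ i, ∑ j, W t i j • Matrix.single i j (1 : ℂ) := by
    ext1 t
    conv_lhs => rw [Matrix.matrix_eq_sum_single (W t)]
    simp [Matrix.smul_single]
  rw [this]
  refine Finset.aestronglyMeasurable_fun_sum _ fun i _ =>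
    Finset.aestronglyMeasurable_fun_sum _ fun j _ => ?_
  exact (h i j).aestronglyMeasurable.smul_const _

theorem IsMatrixWeight.aestronglyMeasurable (hW : IsMatrixWeight E W) :
    AEStronglyMeasurable W (volume.restrict E) :=
  aestronglyMeasurable_matrix hW.measurable

theorem IsMatrixWeight.inv (hW : IsMatrixWeight E W) : IsMatrixWeight E fun t => (W t)⁻¹ := by
  refine ⟨fun i j => ?_, ?_⟩
  · have h1 : ∀ t, (W t)⁻¹ i j = (W t).det⁻¹ * (W t).adjugate i j := fun t => by
      rw [Matrix.inv_def, Matrix.smul_apply, Ring.inverse_eq_inv', smul_eq_mul]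
    simp only [h1]
    have h2 : Continuous fun A : Matrix (Fin n) (Fin n) ℂ => A.det := continuous_id.matrix_det
    have h3 : Continuous fun A : Matrix (Fin n) (Fin n) ℂ => A.adjugate i j :=
      continuous_id.matrix_adjugate.matrix_elem i j
    exact (h2.comp_aestronglyMeasurable hW.aestronglyMeasurable).aemeasurable.inv.mul
      (h3.comp_aestronglyMeasurable hW.aestronglyMeasurable).aemeasurable
  · filter_upwards [hW.posDef] with t ht using ht.inv

/-- The square root of `|A|` is defined and continuous on all matrices and agrees with `CFC.sqrt` on
positive ones. This yields measurability of `W^{1/2}` by composition. -/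
theorem continuous_sqrt_abs :
    Continuous fun A : Matrix (Fin n) (Fin n) ℂ => CFC.sqrt (CFC.sqrt (star A * A)) := by
  have h1 : Continuous fun A : Matrix (Fin n) (Fin n) ℂ => CFC.sqrt (star A * A) :=
    CFC.continuousOn_sqrt.comp_continuous (by fun_prop) fun A => star_mul_self_nonneg A
  exact CFC.continuousOn_sqrt.comp_continuous h1 fun A => (CFC.sqrt_nonneg (star A * A) :)

theorem continuous_clm : Continuous (clm (n := n)) := by
  refine AddMonoidHomClass.continuous_of_bound (Matrix.toEuclideanCLM (n := Fin n) (𝕜 := ℂ)) 1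
    fun A => ?_
  rw [Matrix.l2_opNorm_toEuclideanCLM, one_mul]

theorem IsMatrixWeight.aestronglyMeasurable_sqrt (hW : IsMatrixWeight E W) :
    AEStronglyMeasurable (fun t => clm (CFC.sqrt (W t))) (volume.restrict E) := by
  refine (continuous_clm.comp_aestronglyMeasurable
    (continuous_sqrt_abs.comp_aestronglyMeasurable hW.aestronglyMeasurable)).congr ?_
  filter_upwards [hW.posDef] with t ht
  have h1 : star (W t) = W t := ht.isHermitian
  rw [h1, CFC.sqrt_mul_self (W t) ht.posSemidef.nonneg]

theorem IsMatrixWeight.isDualPair (hW : IsMatrixWeight E W) :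
    IsDualPair E (fun t => clm (CFC.sqrt (W t))) (fun t => clm (CFC.sqrt (W t)⁻¹)) := by
  refine ⟨hW.aestronglyMeasurable_sqrt, hW.inv.aestronglyMeasurable_sqrt, ?_⟩
  filter_upwards [hW.posDef] with t ht x y
  exact inner_sqrt_sqrt_inv ht x y

theorem integrable_inner_clm {S : Set ℝ} (h : EntriesIntegrableOn W S)
    (x y : EuclideanSpace ℂ (Fin n)) : IntegrableOn (fun t => inner ℂ x (clm (W t) y)) S := by
  simp only [inner_clm_eq_sum]
  exact integrable_finsetSum _ fun i _ => integrable_finsetSum _ fun j _ => (h i j).mul_const _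

theorem inner_avg {a δ : ℝ} (h : EntriesIntegrableOn W (Ioo (a - δ) (a + δ) ∩ E))
    (x y : EuclideanSpace ℂ (Fin n)) :
    inner ℂ x (clm (avg E W a δ) y)
      = ((2 * δ)⁻¹ : ℝ) * ∫ t in Ioo (a - δ) (a + δ) ∩ E, inner ℂ x (clm (W t) y) := by
  simp only [inner_clm_eq_sum]
  rw [integral_finsetSum _ fun i _ => integrable_finsetSum _ fun j _ => (h i j).mul_const _,
    Finset.mul_sum]
  refine Finset.sum_congr rfl fun i _ => ?_
  rw [integral_finsetSum _ fun j _ => (h i j).mul_const _, Finset.mul_sum]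
  refine Finset.sum_congr rfl fun j _ => ?_
  rw [integral_mul_const, avg, Matrix.of_apply, Complex.real_smul, mul_assoc]

variable {a δ : ℝ}

theorem ae_posDef_inter (hW : IsMatrixWeight E W) (I : Set ℝ) :
    ∀ᵐ t ∂(volume.restrict (I ∩ E)), (W t).PosDef :=
  ae_restrict_of_ae_restrict_of_subset inter_subset_right hW.posDef

theorem inner_avg_self (hW : IsMatrixWeight E W)
    (h : EntriesIntegrableOn W (Ioo (a - δ) (a + δ) ∩ E)) (x : EuclideanSpace ℂ (Fin n)) :
    inner ℂ x (clm (avg E W a δ) x) = (((2 * δ)⁻¹ *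
      ∫ t in Ioo (a - δ) (a + δ) ∩ E, (inner ℂ x (clm (W t) x)).re : ℝ) : ℂ) := by
  rw [inner_avg h, Complex.ofReal_mul, ← integral_complex_ofReal]
  congr 1
  refine integral_congr_ae ?_
  filter_upwards [ae_posDef_inter hW _] with t ht
  exact inner_clm_self_eq ht.posSemidef x

theorem lintegral_sq_sqrt_eq (hW : IsMatrixWeight E W) (hδ : 0 < δ)
    (h : EntriesIntegrableOn W (Ioo (a - δ) (a + δ) ∩ E)) (x : EuclideanSpace ℂ (Fin n)) :
    ∫⁻ t in Ioo (a - δ) (a + δ), ‖clm (CFC.sqrt (W t)) x‖ₑ ^ 2 ∂(volume.restrict E)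
      = ENNReal.ofReal (2 * δ * (inner ℂ x (clm (avg E W a δ) x)).re) := by
  rw [inner_avg_self hW h, Complex.ofReal_re, mul_inv_cancel_left₀ (by positivity),
    Measure.restrict_restrict measurableSet_Ioo, ofReal_integral_eq_lintegral_ofReal]
  · refine lintegral_congr_ae ?_
    filter_upwards [ae_posDef_inter hW _] with t ht
    rw [← sq_norm_sqrt ht.posSemidef, ENNReal.ofReal_pow (norm_nonneg _), ofReal_norm]
  · exact (integrable_inner_clm h x x).re
  · filter_upwards [ae_posDef_inter hW _] with t ht
    rw [Pi.zero_apply, ← sq_norm_sqrt ht.posSemidef]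
    positivity

/-- If the form of the average vanished at some `x ≠ 0`, the positive integrand would vanish almost
everywhere on a set of positive measure. -/
theorem posDef_avg (hW : IsMatrixWeight E W) (hδ : 0 < δ)
    (h : EntriesIntegrableOn W (Ioo (a - δ) (a + δ) ∩ E))
    (hvol : volume (Ioo (a - δ) (a + δ) ∩ E) ≠ 0) : (avg E W a δ).PosDef := by
  refine posDef_of_inner ?_ fun x hx => ?_
  · ext i j
    rw [Matrix.conjTranspose_apply, avg, Matrix.of_apply, Matrix.of_apply, star_smul,
      star_trivial, Complex.star_def, ← integral_conj]
    congr 1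
    refine integral_congr_ae ?_
    filter_upwards [ae_posDef_inter hW _] with t ht
    exact ht.isHermitian.apply i j
  · rw [inner_avg_self hW h]
    norm_cast
    refine mul_pos (by positivity) (lt_of_le_of_ne ?_ fun h0 => ?_)
    · refine integral_nonneg_of_ae ?_
      filter_upwards [ae_posDef_inter hW _] with t ht
      exact (PosDef.inner_pos ht hx).le
    · rw [eq_comm, integral_eq_zero_iff_of_nonneg_ae] at h0
      · have : ∀ᵐ t ∂(volume.restrict (Ioo (a - δ) (a + δ) ∩ E)), False := by
          filter_upwards [h0, ae_posDef_inter hW _] with t ht ht'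
          exact (PosDef.inner_pos ht' hx).ne' ht
        rw [ae_iff] at this
        apply hvol
        simpa using this
      · filter_upwards [ae_posDef_inter hW _] with t ht
        exact (PosDef.inner_pos ht hx).le
      · exact (integrable_inner_clm h x x).re

end Weights

end MatrixA2

end

noncomputable section
namespace MatrixA2

/-! ### Reducing operators from the matrix `A₂` condition. -/

section MatrixWeight

variable {n : ℕ} {E : Set ℝ} {W : ℝ → Matrix (Fin n) (Fin n) ℂ}

theorem A2Const_lt_top (hA : A2Const E W < ⊤) :
    ∃ Q : ℝ≥0, ∀ x ∈ E, ∀ δ ∈ Ioo (0 : ℝ) 1,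
      EntriesIntegrableOn W (Ioo (x - δ) (x + δ) ∩ E) ∧
      EntriesIntegrableOn (fun t => (W t)⁻¹) (Ioo (x - δ) (x + δ) ∩ E) ∧
      ‖CFC.sqrt (avg E W x δ) * CFC.sqrt (avg E (fun t => (W t)⁻¹) x δ)‖ ≤ Q := by
  classical
  refine ⟨(A2Const E W).toNNReal, fun x hx δ hδ => ?_⟩
  have h : (if EntriesIntegrableOn W (Ioo (x - δ) (x + δ) ∩ E) ∧
        EntriesIntegrableOn (fun t => (W t)⁻¹) (Ioo (x - δ) (x + δ) ∩ E)
      then ‖CFC.sqrt (avg E W x δ) * CFC.sqrt (avg E (fun t => (W t)⁻¹) x δ)‖ₑ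
      else ∞) ≤ A2Const E W := by
    rw [A2Const]
    exact le_iSup₂_of_le x hx (le_iSup₂_of_le δ hδ (le_of_eq (by congr)))
  split_ifs at h with hc
  · refine ⟨hc.1, hc.2, ?_⟩
    rw [← ENNReal.coe_toNNReal hA.ne, enorm_le_coe] at h
    exact h
  · exact absurd h (not_le.2 hA)

/-- A bounded set is covered by finitely many intervals of radius `1/2` centred at its points. -/
theorem entriesIntegrableOn_of_local (hb : Bornology.IsBounded E)
    (h : ∀ x ∈ E, EntriesIntegrableOn W (Ioo (x - 1 / 2) (x + 1 / 2) ∩ E)) :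
    EntriesIntegrableOn W E := by
  intro i j
  obtain ⟨T, hTE, hT, hcov⟩ := Metric.finite_approx_of_totallyBounded
    (Bornology.IsBounded.isCompact_closure hb |>.totallyBounded.subset subset_closure) (1 / 2) (by norm_num)
  have h1 : IntegrableOn (fun t => W t i j) (⋃ x ∈ T, Ioo (x - 1 / 2) (x + 1 / 2) ∩ E) :=
    (integrableOn_finite_biUnion hT).2 fun x hx => h x (hTE hx) i j
  refine h1.mono_set fun t ht => ?_
  obtain ⟨x, hx, htx⟩ := mem_iUnion₂.1 (hcov ht)
  rw [Real.ball_eq_Ioo] at htx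
  exact mem_iUnion₂.2 ⟨x, hx, htx, ht⟩

theorem norm_inner_clm_self_le (A : Matrix (Fin n) (Fin n) ℂ) (v : EuclideanSpace ℂ (Fin n)) :
    ‖inner ℂ v (clm A v)‖ ≤ (∑ i, ∑ j, ‖A i j‖) * ‖v‖ ^ 2 := by
  rw [inner_clm_eq_sum, Finset.sum_mul]
  refine (norm_sum_le _ _).trans (Finset.sum_le_sum fun i _ => ?_)
  rw [Finset.sum_mul]
  refine (norm_sum_le _ _).trans (Finset.sum_le_sum fun j _ => ?_)
  rw [norm_mul, norm_mul, norm_star, pow_two]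
  gcongr
  · exact PiLp.norm_apply_le v j
  · exact PiLp.norm_apply_le v i

theorem exists_lintegral_sq_sqrt_le (hW : IsMatrixWeight E W) (h : EntriesIntegrableOn W E) :
    ∃ C : ℝ≥0, ∀ v, ∫⁻ t, ‖clm (CFC.sqrt (W t)) v‖ₑ ^ 2 ∂(volume.restrict E)
      ≤ C * ‖v‖ₑ ^ 2 := by
  have hint : Integrable (fun t => ∑ i, ∑ j, ‖W t i j‖) (volume.restrict E) :=
    integrable_finsetSum _ fun i _ => integrable_finsetSum _ fun j _ => (h i j).norm
  refine ⟨(∫⁻ t, ENNReal.ofReal (∑ i, ∑ j, ‖W t i j‖) ∂(volume.restrict E)).toNNReal,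
    fun v => ?_⟩
  rw [ENNReal.coe_toNNReal hint.lintegral_lt_top.ne,
    ← lintegral_mul_const' _ _ (ENNReal.pow_ne_top enorm_ne_top)]
  refine lintegral_mono_ae ?_
  filter_upwards [hW.posDef] with t ht
  rw [← ofReal_norm, ← ofReal_norm, ← ENNReal.ofReal_pow (norm_nonneg _),
    ← ENNReal.ofReal_pow (norm_nonneg _), ← ENNReal.ofReal_mul (by positivity),
    sq_norm_sqrt ht.posSemidef]
  exact ENNReal.ofReal_le_ofReal
    ((Complex.re_le_norm _).trans (norm_inner_clm_self_le (W t) v))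

/-- With `M = ⟨W⟩` and `N = ⟨W⁻¹⟩`, the operators `M^{1/2}` and `M^{-1/2}` turn the two integrals
into `2δ ‖v‖²` and `2δ ‖N^{1/2} M^{1/2} v‖²`. The second is bounded by the `A₂` constant. -/
theorem isReducing_avg (hW : IsMatrixWeight E W) {x δ Q : ℝ} (hδ : 0 < δ)
    (h : EntriesIntegrableOn W (Ioo (x - δ) (x + δ) ∩ E))
    (h' : EntriesIntegrableOn (fun t => (W t)⁻¹) (Ioo (x - δ) (x + δ) ∩ E))
    (hvol : volume (Ioo (x - δ) (x + δ) ∩ E) ≠ 0)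
    (hQ : ‖CFC.sqrt (avg E W x δ) * CFC.sqrt (avg E (fun t => (W t)⁻¹) x δ)‖ ≤ Q) :
    IsReducing E (fun t => clm (CFC.sqrt (W t))) (fun t => clm (CFC.sqrt (W t)⁻¹))
      (2 + 2 * Q ^ 2) x δ (clm (CFC.sqrt (avg E W x δ))) (clm (CFC.sqrt (avg E W x δ)⁻¹)) := by
  have hM := posDef_avg hW hδ h hvol
  have hN := posDef_avg hW.inv hδ h' hvol
  set M := avg E W x δ with hMdef
  set N := avg E (fun t => (W t)⁻¹) x δ with hNdef
  have hQ0 : 0 ≤ Q := (norm_nonneg _).trans hQ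
  refine ⟨inner_sqrt_left _, inner_sqrt_left _, inner_sqrt_sqrt_inv hM, fun v => ?_, fun v => ?_⟩
  · rw [lintegral_sq_sqrt_eq hW hδ h, ← hMdef, ← sq_norm_sqrt hM.posSemidef, ← clm_mul_apply,
      sqrt_mul_sqrt_inv hM, ← ofReal_norm, ← ENNReal.ofReal_pow (norm_nonneg _),
      ← ENNReal.ofReal_mul (by positivity)]
    refine ENNReal.ofReal_le_ofReal ?_
    rw [clm, map_one, one_apply_eq_self]
    have : 0 ≤ Q ^ 2 * δ * ‖v‖ ^ 2 := by positivity
    nlinarith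
  · rw [lintegral_sq_sqrt_eq hW.inv hδ h', ← hNdef, ← sq_norm_sqrt hN.posSemidef, ← clm_mul_apply,
      ← ofReal_norm, ← ENNReal.ofReal_pow (norm_nonneg _), ← ENNReal.ofReal_mul (by positivity)]
    refine ENNReal.ofReal_le_ofReal ?_
    have h1 : ‖clm (CFC.sqrt N * CFC.sqrt M) v‖ ≤ Q * ‖v‖ := by
      refine ((clm (CFC.sqrt N * CFC.sqrt M)).le_opNorm v).trans ?_
      rw [clm, Matrix.l2_opNorm_toEuclideanCLM, ← norm_star, star_mul, star_sqrt, star_sqrt]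
      gcongr
    have h2 : ‖clm (CFC.sqrt N * CFC.sqrt M) v‖ ^ 2 ≤ (Q * ‖v‖) ^ 2 := by gcongr
    have h3 : 2 * δ * ‖clm (CFC.sqrt N * CFC.sqrt M) v‖ ^ 2 ≤ 2 * δ * (Q * ‖v‖) ^ 2 := by gcongr
    have : 0 ≤ δ * ‖v‖ ^ 2 := by positivity
    nlinarith

/-- At radii of at least `1` no normalization is needed, since the total masses of `W` and `W⁻¹` on
`E` are finite. -/
theorem isReducing_id {C C' : ℝ≥0}
    (hC : ∀ v, ∫⁻ t, ‖clm (CFC.sqrt (W t)) v‖ₑ ^ 2 ∂(volume.restrict E) ≤ C * ‖v‖ₑ ^ 2)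
    (hC' : ∀ v, ∫⁻ t, ‖clm (CFC.sqrt (W t)⁻¹) v‖ₑ ^ 2 ∂(volume.restrict E) ≤ C' * ‖v‖ₑ ^ 2)
    {x δ : ℝ} (hδ : 1 ≤ δ) :
    IsReducing E (fun t => clm (CFC.sqrt (W t))) (fun t => clm (CFC.sqrt (W t)⁻¹))
      (C + C') x δ (.id ℂ _) (.id ℂ _) := by
  have h : ∀ {c : ℝ≥0}, (c : ℝ) ≤ C + C' → (c : ℝ≥0∞) ≤ ENNReal.ofReal ((C + C') * δ) := by
    intro c hc
    rw [← ENNReal.ofReal_coe_nnreal]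
    refine ENNReal.ofReal_le_ofReal (hc.trans ?_)
    exact le_mul_of_one_le_right (by positivity) hδ
  refine ⟨fun _ _ => rfl, fun _ _ => rfl, fun _ _ => rfl, fun v => ?_, fun v => ?_⟩
  · refine (setLIntegral_le_lintegral _ _).trans ((hC v).trans ?_)
    gcongr
    exact h (by simp)
  · refine (setLIntegral_le_lintegral _ _).trans ((hC' v).trans ?_)
    gcongr
    exact h (by simp)

theorem IsReducing.mono {H G : ℝ → EuclideanSpace ℂ (Fin n) →L[ℂ] EuclideanSpace ℂ (Fin n)}
    {C C' x δ : ℝ} {A B : EuclideanSpace ℂ (Fin n) →L[ℂ] EuclideanSpace ℂ (Fin n)}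
    (h : IsReducing E H G C x δ A B) (hC : C ≤ C') (hδ : 0 ≤ δ) :
    IsReducing E H G C' x δ A B := by
  refine ⟨h.symm_left, h.symm_right, h.dual, fun v => (h.left v).trans ?_,
    fun v => (h.right v).trans ?_⟩ <;> gcongr

/-- The hypotheses concern radii below `1`, but the sparse cells can be as long as `E`. Boundedness
of `E` covers larger radii: the identity is reducing there, and the density at radius `1/2`, spread
over `Δ`, gives the lower bound on mass. -/
theorem exists_isReducible (hE : IsHomogeneous E) (hb : Bornology.IsBounded E)
    (hW : IsMatrixWeight E W) (hA : A2Const E W < ⊤) {Δ : ℝ} (hΔ : 0 < Δ) :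
    ∃ C η : ℝ, 0 < C ∧ 0 < η ∧
      IsReducible E (fun t => clm (CFC.sqrt (W t))) (fun t => clm (CFC.sqrt (W t)⁻¹)) C η Δ := by
  obtain ⟨hEm, η, hη, hfat⟩ := hE
  obtain ⟨Q, hQ⟩ := A2Const_lt_top hA
  have hhalf : (1 / 2 : ℝ) ∈ Ioo (0 : ℝ) 1 := by constructor <;> norm_num
  obtain ⟨C, hC⟩ := exists_lintegral_sq_sqrt_le hW
    (entriesIntegrableOn_of_local hb fun x hx => (hQ x hx _ hhalf).1)
  obtain ⟨C', hC'⟩ := exists_lintegral_sq_sqrt_le hW.inv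
    (entriesIntegrableOn_of_local hb fun x hx => (hQ x hx _ hhalf).2.1)
  refine ⟨2 + 2 * (Q : ℝ) ^ 2 + (C + C'), min η (η / (2 * Δ)), by positivity, by positivity,
    hW.isDualPair, fun x hx δ hδ hδΔ => ?_, fun x hx δ hδ hδΔ => ?_⟩
  · rw [Measure.restrict_apply measurableSet_Ioo]
    rcases lt_or_ge δ 1 with h1 | h1
    · refine le_trans (ENNReal.ofReal_le_ofReal ?_) (hfat δ hδ h1 x hx)
      gcongr
      exact min_le_left _ _
    · refine le_trans (ENNReal.ofReal_le_ofReal ?_)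
        ((hfat (1 / 2) hhalf.1 hhalf.2 x hx).trans (measure_mono ?_))
      · calc min η (η / (2 * Δ)) * δ ≤ η / (2 * Δ) * Δ := by
              gcongr
              exact min_le_right _ _
          _ = η * (1 / 2) := by
              field_simp
      · exact inter_subset_inter_left _ (Ioo_subset_Ioo (by linarith) (by linarith))
  · rcases lt_or_ge δ 1 with h1 | h1
    · obtain ⟨h2, h3, h4⟩ := hQ x hx δ ⟨hδ, h1⟩
      refine ⟨_, _, (isReducing_avg hW hδ h2 h3 ?_ h4).mono (le_add_of_nonneg_right (by positivity))
        hδ.le⟩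
      refine ((ENNReal.ofReal_pos.2 ?_).trans_le (hfat δ hδ h1 x hx)).ne'
      positivity
    · exact ⟨_, _, (isReducing_id hC hC' h1).mono (le_add_of_nonneg_left (by positivity)) hδ.le⟩

end MatrixWeight

end MatrixA2

end

noncomputable section
namespace MatrixA2

/-! ### The `A₂` condition implies boundedness. -/

section Sufficiency

variable {n : ℕ} {E : Set ℝ} {W : ℝ → Matrix (Fin n) (Fin n) ℂ}

theorem cauchy_congr {f g : ℝ → EuclideanSpace ℂ (Fin n)} (h : f =ᵐ[volume] g) (z : ℂ) :
    cauchy f z = cauchy g z := by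
  refine integral_congr_ae ?_
  filter_upwards [h] with t ht
  rw [ht]

/-- Square integrable functions on a set of finite measure are integrable, so their Cauchy integrals
are defined. -/
theorem integrable_of_memLp_two {f : ℝ → EuclideanSpace ℂ (Fin n)} (hEm : MeasurableSet E)
    (hfin : volume E ≠ ∞) (hf : MemLp f 2) (h0 : ∀ t ∉ E, f t = 0) : Integrable f := by
  have : IsFiniteMeasure (volume.restrict E) := ⟨by simpa using hfin.lt_top⟩
  have h1 : IntegrableOn f E := (hf.restrict E).integrable (by norm_num)
  rw [← integrable_indicator_iff hEm, indicator_eq_self.2] at h1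
  · exact h1
  · exact fun t ht => by_contra fun h => ht (h0 t h)

theorem mulOn_apply_of_mem {A : ℝ → Matrix (Fin n) (Fin n) ℂ} {f : ℝ → EuclideanSpace ℂ (Fin n)}
    {t : ℝ} (ht : t ∈ E) : mulOn E A f t = clm (A t) (f t) := by
  rw [mulOn, indicator_of_mem ht]
  rfl

theorem lintegral_sq_mulOn (hEm : MeasurableSet E) {A : ℝ → Matrix (Fin n) (Fin n) ℂ}
    {f : ℝ → EuclideanSpace ℂ (Fin n)} :
    ∫⁻ t, ‖mulOn E A f t‖ₑ ^ 2 = ∫⁻ t, ‖clm (A t) (f t)‖ₑ ^ 2 ∂(volume.restrict E) := by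
  rw [← lintegral_indicator hEm]
  refine lintegral_congr fun t => ?_
  by_cases ht : t ∈ E
  · rw [indicator_of_mem ht, mulOn_apply_of_mem ht]
  · rw [indicator_of_notMem ht, mulOn, indicator_of_notMem ht]
    simp

/-- The bilinear bound at `u = W^{-1/2} f` passes to the boundary as a bound for `⟪P₊ u, v⟫`. It is
converted into a norm estimate by duality, with `v` a truncation of `W P₊ u`. -/
theorem weightedRieszBounded_of_A2Const_lt_top (hE : IsHomogeneous E) (hb : Bornology.IsBounded E)
    (hW : IsMatrixWeight E W) (hA : A2Const E W < ⊤) : WeightedRieszBounded E W := by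
  have hEm : MeasurableSet E := hE.1
  obtain ⟨L, hL, hEL⟩ : ∃ L : ℝ, 0 < L ∧ E ⊆ Ico (-L) L := by
    obtain ⟨R, hR, hER⟩ := hb.subset_ball_lt 0 0
    refine ⟨R, hR, fun t ht => ?_⟩
    have := hER ht
    rw [Real.ball_eq_Ioo, zero_sub, zero_add] at this
    exact Ioo_subset_Ico_self this
  have hEfin : volume E ≠ ∞ := hb.measure_lt_top.ne
  obtain ⟨C, η, hC, hη, hred⟩ := exists_isReducible hE hb hW hA (Δ := 12 * L) (by positivity)
  obtain ⟨M, hM⟩ := exists_bilinear_bound n hC hη hL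
  refine ⟨NNReal.sqrt M, fun f hf0 hf => ?_⟩
  set μ := volume.restrict E with hμ
  set u : ℝ → EuclideanSpace ℂ (Fin n) := mulOn E (fun t => (CFC.sqrt (W t))⁻¹) f with hu
  have hu0 : ∀ t ∉ E, u t = 0 := fun t ht => by rw [hu, mulOn, indicator_of_notMem ht]
  have hui : Integrable u := integrable_of_memLp_two hEm hEfin hf hu0
  have hUi : Integrable (hf.toLp u) := hui.congr hf.coeFn_toLp.symm
  set P := rieszProj n (hf.toLp u) with hP
  have hHu : ∫⁻ t, ‖clm (CFC.sqrt (W t)) (u t)‖ₑ ^ 2 ∂μ ≤ eLpNorm f 2 volume ^ 2 := by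
    rw [sq_eLpNorm_two]
    refine le_trans (lintegral_mono_ae ?_) (setLIntegral_le_lintegral E _)
    filter_upwards [hW.posDef, ae_restrict_mem hEm] with t ht htE
    rw [hu, mulOn_apply_of_mem htE, Matrix.PosSemidef.inv_sqrt ht.posSemidef, ← clm_mul_apply,
      sqrt_mul_sqrt_inv ht, clm, map_one, one_apply_eq_self]
  set H := hW.aestronglyMeasurable_sqrt.mk with hH
  have hHm : StronglyMeasurable H := hW.aestronglyMeasurable_sqrt.stronglyMeasurable_mk
  have hHae : (fun t => clm (CFC.sqrt (W t))) =ᵐ[μ] H := hW.aestronglyMeasurable_sqrt.ae_eq_mk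
  -- Truncation makes the test function square integrable and the quantity to be divided out finite.
  -- Monotone convergence removes it at the end.
  set F : ℕ → Set ℝ := fun N => E ∩ {t | ‖H t‖ ≤ N} with hF
  have hFm : ∀ N, MeasurableSet (F N) := fun N =>
    hEm.inter (measurableSet_le hHm.norm.measurable measurable_const)
  have hFU : ⋃ N, F N = E := by
    refine subset_antisymm (iUnion_subset fun N => inter_subset_left) fun t ht => ?_
    obtain ⟨N, hN⟩ := exists_nat_ge ‖H t‖
    exact mem_iUnion.2 ⟨N, ht, hN⟩
  have hFmono : Monotone F := fun N N' h => by
    refine inter_subset_inter_right _ fun t ht => ?_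
    rw [mem_ofPred_eq] at ht ⊢
    exact ht.trans (by exact_mod_cast h)
  have hstep : ∀ N, ∫⁻ t in F N, ‖H t (P t)‖ₑ ^ 2 ≤ M * eLpNorm f 2 volume ^ 2 := by
    intro N
    -- The extremal choice: both `⟪P, v⟫` and the squared dual norm of `v` equal `q = ∫ ‖H P‖²` over
    -- `F N`. The bilinear bound then reads `q² ≤ M ‖f‖² q`.
    set v : ℝ → EuclideanSpace ℂ (Fin n) := (F N).indicator fun t => H t (H t (P t)) with hv
    have hPm : AEStronglyMeasurable P volume := Lp.aestronglyMeasurable P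
    have hHP : AEStronglyMeasurable (fun t => H t (P t)) volume :=
      isBoundedBilinearMap_apply.continuous.comp_aestronglyMeasurable
        (hHm.aestronglyMeasurable.prodMk hPm)
    have hHHP : AEStronglyMeasurable (fun t => H t (H t (P t))) volume :=
      isBoundedBilinearMap_apply.continuous.comp_aestronglyMeasurable
        (hHm.aestronglyMeasurable.prodMk hHP)
    have hb1 : ∀ t ∈ F N, ∀ x, ‖H t x‖ ≤ N * ‖x‖ := fun t ht x => (H t).le_of_opNorm_le ht.2 x
    have hq : ∫⁻ t in F N, ‖H t (P t)‖ₑ ^ 2 ≠ ∞ := by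
      have h1 : MemLp ((F N).indicator fun t => H t (P t)) 2 volume := by
        refine MemLp.of_le_mul (c := N) (Lp.memLp P) (hHP.indicator (hFm N))
          (ae_of_all _ fun t => ?_)
        by_cases ht : t ∈ F N
        · rw [indicator_of_mem ht]
          exact hb1 t ht _
        · rw [indicator_of_notMem ht, norm_zero]
          positivity
      have h2 := sq_eLpNorm_two (μ := volume) ((F N).indicator fun t => H t (P t))
      have h3 : ∀ t, ‖(F N).indicator (fun t => H t (P t)) t‖ₑ ^ 2
          = (F N).indicator (fun t => ‖H t (P t)‖ₑ ^ 2) t := fun t => by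
        by_cases ht : t ∈ F N
        · rw [indicator_of_mem ht, indicator_of_mem ht]
        · rw [indicator_of_notMem ht, indicator_of_notMem ht]
          simp
      simp only [h3] at h2
      rw [lintegral_indicator (hFm N)] at h2
      rw [← h2]
      exact ENNReal.pow_ne_top h1.2.ne
    have hvL : MemLp v 2 volume := by
      refine MemLp.of_le_mul (c := N * N) (Lp.memLp P) (hHHP.indicator (hFm N))
        (ae_of_all _ fun t => ?_)
      by_cases ht : t ∈ F N
      · rw [hv, indicator_of_mem ht, mul_assoc]
        exact (hb1 t ht _).trans (mul_le_mul_of_nonneg_left (hb1 t ht _) (by positivity))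
      · rw [hv, indicator_of_notMem ht, norm_zero]
        positivity
    have hv0 : ∀ t ∉ E, v t = 0 := fun t ht => indicator_of_notMem (fun h => ht h.1) _
    have hvi : Integrable v := integrable_of_memLp_two hEm hEfin hvL hv0
    have hlim : ‖∫ x : ℝ, inner ℂ (P x) (v x)‖ₑ ^ 2
        ≤ M * ((∫⁻ t, ‖clm (CFC.sqrt (W t)) (u t)‖ₑ ^ 2 ∂μ) *
          ∫⁻ t, ‖clm (CFC.sqrt (W t)⁻¹) (v t)‖ₑ ^ 2 ∂μ) := by
      have ht := tendsto_integral_inner_cauchy (hf.toLp u) hUi hvL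
      refine le_of_tendsto (ENNReal.Tendsto.pow (n := 2) (ht.enorm)) ?_
      filter_upwards [self_mem_nhdsWithin] with y hy
      simp only [cauchy_congr hf.coeFn_toLp]
      exact hM hEm hEL hred hy hui hvi hu0 hv0
    have hsymm : ∀ᵐ t ∂μ, ∀ x y, inner ℂ (H t x) y = inner ℂ x (H t y) := by
      filter_upwards [hHae] with t ht x y
      rw [← ht]
      exact inner_sqrt_left _ x y
    have hGv : ∫⁻ t, ‖clm (CFC.sqrt (W t)⁻¹) (v t)‖ₑ ^ 2 ∂μ
        = ∫⁻ t in F N, ‖H t (P t)‖ₑ ^ 2 := by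
      have h1 : μ.restrict (F N) = volume.restrict (F N) := by
        rw [hμ, Measure.restrict_restrict (hFm N), inter_eq_left.2 inter_subset_left]
      rw [← h1, ← lintegral_indicator (hFm N)]
      refine lintegral_congr_ae ?_
      filter_upwards [hW.posDef, hHae] with t ht ht'
      by_cases htF : t ∈ F N
      · simp only [hv, indicator_of_mem htF]
        rw [← ht', ← clm_mul_apply, mul_eq_one_comm.1 (sqrt_mul_sqrt_inv ht)]
        simp
      · simp only [hv, indicator_of_notMem htF]
        simp
    have hPv : ‖∫ x : ℝ, inner ℂ (P x) (v x)‖ₑ = ∫⁻ t in F N, ‖H t (P t)‖ₑ ^ 2 := by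
      have h1 : ∫ x : ℝ, inner ℂ (P x) (v x) = ((∫ t in F N, ‖H t (P t)‖ ^ 2 : ℝ) : ℂ) := by
        rw [← integral_complex_ofReal, ← integral_indicator (hFm N)]
        refine integral_congr_ae ?_
        have h2 : ∀ᵐ t, t ∈ E → ∀ x y, inner ℂ (H t x) y = inner ℂ x (H t y) :=
          (ae_restrict_iff' hEm).1 hsymm
        filter_upwards [h2] with t ht
        by_cases htF : t ∈ F N
        · simp only [hv, indicator_of_mem htF]
          rw [← ht htF.1, inner_self_eq_norm_sq_to_K]
          norm_cast
        · simp only [hv, indicator_of_notMem htF, inner_zero_right]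
      have h2 : AEStronglyMeasurable (fun t => ‖H t (P t)‖ ^ 2) (volume.restrict (F N)) :=
        hHP.restrict.norm.pow 2
      rw [h1, ← ofReal_norm, Complex.norm_real, Real.norm_of_nonneg
        (integral_nonneg fun t => by positivity), integral_eq_lintegral_of_nonneg_ae
        (ae_of_all _ fun t => sq_nonneg _) h2, ENNReal.ofReal_toReal]
      · refine lintegral_congr fun t => ?_
        rw [ENNReal.ofReal_pow (norm_nonneg _), ofReal_norm]
      · refine ne_of_eq_of_ne (lintegral_congr fun t => ?_) hq
        rw [ENNReal.ofReal_pow (norm_nonneg _), ofReal_norm]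
    rw [hGv, hPv] at hlim
    set q := ∫⁻ t in F N, ‖H t (P t)‖ₑ ^ 2 with hqdef
    by_cases hq0 : q = 0
    · rw [hq0]
      exact zero_le
    refine (ENNReal.mul_le_mul_iff_right hq0 hq).1 ?_
    calc q * q = q ^ 2 := (pow_two q).symm
      _ ≤ _ := hlim
      _ ≤ M * (eLpNorm f 2 volume ^ 2 * q) := by gcongr
      _ = _ := by ring
  rw [eLpNorm_two_le_iff, lintegral_sq_mulOn hEm, mul_pow]
  have hM2 : ((NNReal.sqrt M : ℝ≥0) : ℝ≥0∞) ^ 2 = M := by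
    rw [← ENNReal.coe_pow, NNReal.sq_sqrt]
  rw [hM2]
  calc ∫⁻ t, ‖clm (CFC.sqrt (W t)) (P t)‖ₑ ^ 2 ∂μ = ∫⁻ t in ⋃ N, F N, ‖H t (P t)‖ₑ ^ 2 := by
        rw [hFU]
        refine lintegral_congr_ae ?_
        filter_upwards [hHae] with t ht
        rw [← ht]
    _ = ⨆ N, ∫⁻ t in F N, ‖H t (P t)‖ₑ ^ 2 :=
        setLIntegral_iUnion_of_directed _ (directed_of_isDirected_le hFmono)
    _ ≤ _ := iSup_le hstep

end Sufficiency

end MatrixA2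

end

noncomputable section
namespace MatrixA2

/-! ### Blaschke factors and a rank one kernel. -/

section RankOne

variable {n : ℕ} {w : ℂ}

/-- The Blaschke factor of the upper half-plane with zero `w`, on the real line. -/
def blaschke (w : ℂ) (t : ℝ) : ℂ := (t - w) / (t - starRingEnd ℂ w)

theorem im_le_norm_sub (hw : 0 < w.im) (t : ℝ) : w.im ≤ ‖(t - w : ℂ)‖ := by
  have := Complex.abs_im_le_norm (t - w : ℂ)
  simp only [Complex.sub_im, Complex.ofReal_im, zero_sub, abs_neg, abs_of_pos hw] at this
  exact this

theorem norm_sub_conj (t : ℝ) : ‖(t - starRingEnd ℂ w : ℂ)‖ = ‖(t - w : ℂ)‖ := by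
  rw [← Complex.norm_conj (t - w), map_sub, Complex.conj_ofReal]

theorem sub_ne_zero_of_im_pos (hw : 0 < w.im) (t : ℝ) : (t - w : ℂ) ≠ 0 :=
  norm_pos_iff.1 (hw.trans_le (im_le_norm_sub hw t))

theorem sub_conj_ne_zero (hw : 0 < w.im) (t : ℝ) : (t - starRingEnd ℂ w : ℂ) ≠ 0 :=
  norm_pos_iff.1 (by rw [norm_sub_conj]; exact hw.trans_le (im_le_norm_sub hw t))

theorem norm_blaschke (hw : 0 < w.im) (t : ℝ) : ‖blaschke w t‖ = 1 := by
  rw [blaschke, norm_div, norm_sub_conj, div_self]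
  exact norm_ne_zero_iff.2 (sub_ne_zero_of_im_pos hw t)

theorem conj_blaschke (w : ℂ) (t : ℝ) :
    starRingEnd ℂ (blaschke w t) = (t - starRingEnd ℂ w) / (t - w) := by
  rw [blaschke, map_div₀, map_sub, map_sub, Complex.conj_ofReal, Complex.conj_conj]

theorem continuous_blaschke (hw : 0 < w.im) : Continuous (blaschke w) := by
  unfold blaschke
  exact (by fun_prop : Continuous fun t : ℝ => (t - w : ℂ)).div (by fun_prop)
    (sub_conj_ne_zero hw)

/-- The factor `1 - b(x) b̄(t)` vanishes at `t = x` and cancels the singularity of the Cauchy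
kernel. What remains is a bounded factor tending to `1` as `y → 0`, times a product of a function of
`x` and a function of `t`. -/
theorem cauchyKer_mul_blaschke (hw : 0 < w.im) (x t : ℝ) {y : ℝ} (hy : 0 < y) :
    cauchyKer (x + y * Complex.I - t) * (1 - blaschke w x * starRingEnd ℂ (blaschke w t))
      = (w.im / Real.pi : ℝ) * ((x - t) / (x - t + y * Complex.I) *
        ((x - starRingEnd ℂ w)⁻¹ * (t - w)⁻¹)) := by
  have h1 := sub_ne_zero_of_im_pos hw t
  have h2 := sub_conj_ne_zero hw x
  have h3 : (x - t + y * Complex.I : ℂ) ≠ 0 := fun h => by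
    have := congrArg Complex.im h
    simp at this
    linarith
  have h4 : w - starRingEnd ℂ w = 2 * w.im * Complex.I := by
    rw [Complex.sub_conj]
    push_cast
    ring
  have hpi : (Real.pi : ℂ) ≠ 0 := by exact_mod_cast Real.pi_ne_zero
  have hb : 1 - blaschke w x * starRingEnd ℂ (blaschke w t)
      = (t - x) * (2 * w.im * Complex.I) * ((x - starRingEnd ℂ w)⁻¹ * (t - w)⁻¹) := by
    rw [conj_blaschke, blaschke, ← h4]
    field_simp
    ring
  have hk : cauchyKer (x + y * Complex.I - t)
      = Complex.I / (2 * Real.pi) * (x - t + y * Complex.I)⁻¹ := by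
    rw [cauchyKer, div_eq_mul_inv _ (x + y * Complex.I - t : ℂ)]
    congr 2
    ring
  rw [hb, hk, Complex.ofReal_div, div_eq_mul_inv (x - t : ℂ)]
  have hI : Complex.I * Complex.I = -1 := Complex.I_mul_I
  have : Complex.I / (2 * Real.pi) * ((t - x) * (2 * w.im * Complex.I))
      = (w.im / Real.pi : ℂ) * (x - t) := by
    field_simp
    linear_combination (t - x : ℂ) * hI
  linear_combination ((x - t + y * Complex.I : ℂ)⁻¹ * ((x - starRingEnd ℂ w)⁻¹ * (t - w)⁻¹)) * this

/-- Uniform in `y`, as needed for dominated convergence at the boundary. -/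
theorem norm_kernel_le (hw : 0 < w.im) (x t y : ℝ) :
    ‖((w.im / Real.pi : ℝ) : ℂ) * ((x - t) / (x - t + y * Complex.I) *
        ((x - starRingEnd ℂ w)⁻¹ * (t - w)⁻¹))‖ ≤ (Real.pi * w.im)⁻¹ := by
  have h1 : ‖((x - t) / (x - t + y * Complex.I) : ℂ)‖ ≤ 1 := by
    rw [norm_div]
    refine div_le_one_of_le₀ ?_ (norm_nonneg _)
    have := Complex.abs_re_le_norm (x - t + y * Complex.I : ℂ)
    have h2 : ‖(x - t : ℂ)‖ = |x - t| := by
      rw [← Complex.ofReal_sub, Complex.norm_real, Real.norm_eq_abs]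
    rw [h2]
    simpa using this
  have h2 : ‖(x - starRingEnd ℂ w : ℂ)⁻¹‖ ≤ w.im⁻¹ := by
    rw [norm_inv, norm_sub_conj]
    gcongr
    exact im_le_norm_sub hw x
  have h3 : ‖(t - w : ℂ)⁻¹‖ ≤ w.im⁻¹ := by
    rw [norm_inv]
    gcongr
    exact im_le_norm_sub hw t
  have hpi := Real.pi_pos
  rw [norm_mul, norm_mul, norm_mul, Complex.norm_real, Real.norm_of_nonneg (by positivity)]
  calc w.im / Real.pi * (_ * (_ * _)) ≤ w.im / Real.pi * (1 * (w.im⁻¹ * w.im⁻¹)) := by gcongr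
    _ = _ := by
      field_simp

theorem integrable_blaschke_smul (hw : 0 < w.im) {u : ℝ → EuclideanSpace ℂ (Fin n)}
    (hu : Integrable u) : Integrable fun t => starRingEnd ℂ (blaschke w t) • u t := by
  have h : AEStronglyMeasurable (fun t => starRingEnd ℂ (blaschke w t)) volume :=
    (Complex.continuous_conj.comp (continuous_blaschke hw)).aestronglyMeasurable
  refine hu.bdd_smul 1 h (ae_of_all _ fun t => ?_)
  rw [Complex.norm_conj, norm_blaschke hw]

theorem memLp_blaschke_smul (hw : 0 < w.im) {u : ℝ → EuclideanSpace ℂ (Fin n)}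
    (hu : MemLp u 2) : MemLp (fun t => starRingEnd ℂ (blaschke w t) • u t) 2 := by
  refine hu.of_le (((Complex.continuous_conj.comp
    (continuous_blaschke hw)).aestronglyMeasurable).smul hu.1) (ae_of_all _ fun t => ?_)
  rw [norm_smul, Complex.norm_conj, norm_blaschke hw, one_mul]

theorem cauchy_sub_blaschke (hw : 0 < w.im) {u : ℝ → EuclideanSpace ℂ (Fin n)}
    (hu : Integrable u) (x : ℝ) {y : ℝ} (hy : 0 < y) :
    cauchy u (x + y * Complex.I)
        - blaschke w x • cauchy (fun t => starRingEnd ℂ (blaschke w t) • u t) (x + y * Complex.I)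
      = ∫ t : ℝ, (((w.im / Real.pi : ℝ) : ℂ) * ((x - t) / (x - t + y * Complex.I) *
        ((x - starRingEnd ℂ w)⁻¹ * (t - w)⁻¹))) • u t := by
  have hz : (x + y * Complex.I : ℂ).im ≠ 0 := by simpa using hy.ne'
  have hi : Integrable fun t : ℝ => blaschke w x • cauchyKer (x + y * Complex.I - t) •
      starRingEnd ℂ (blaschke w t) • u t :=
    (integrable_cauchyKer_smul (integrable_blaschke_smul hw hu) hz).smul (blaschke w x)
  unfold cauchy
  rw [← integral_smul, ← integral_sub (integrable_cauchyKer_smul hu hz) hi]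
  refine integral_congr_ae (ae_of_all _ fun t => ?_)
  simp only
  rw [← cauchyKer_mul_blaschke hw x t hy, smul_smul, smul_smul, ← sub_smul]
  congr 1
  ring

theorem tendsto_cauchy_sub_blaschke (hw : 0 < w.im) {u : ℝ → EuclideanSpace ℂ (Fin n)}
    (hu : Integrable u) (x : ℝ) :
    Tendsto (fun y : ℝ => cauchy u (x + y * Complex.I)
        - blaschke w x • cauchy (fun t => starRingEnd ℂ (blaschke w t) • u t) (x + y * Complex.I))
      (𝓝[>] 0) (𝓝 ((((w.im / Real.pi : ℝ) : ℂ) * (x - starRingEnd ℂ w)⁻¹) •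
        ∫ t : ℝ, (t - w : ℂ)⁻¹ • u t)) := by
  have h : Tendsto (fun y : ℝ => ∫ t : ℝ, (((w.im / Real.pi : ℝ) : ℂ) *
        ((x - t) / (x - t + y * Complex.I) * ((x - starRingEnd ℂ w)⁻¹ * (t - w)⁻¹))) • u t)
      (𝓝[>] 0) (𝓝 (∫ t : ℝ, (((w.im / Real.pi : ℝ) : ℂ) * (x - starRingEnd ℂ w)⁻¹) •
        (t - w : ℂ)⁻¹ • u t)) := by
    refine tendsto_integral_filter_of_dominated_convergence
      (fun t => (Real.pi * w.im)⁻¹ * ‖u t‖) ?_ ?_ (hu.norm.const_mul _) ?_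
    · refine Eventually.of_forall fun y => ?_
      have hm : Measurable fun t : ℝ => ((w.im / Real.pi : ℝ) : ℂ) *
          ((x - t) / (x - t + y * Complex.I) * ((x - starRingEnd ℂ w)⁻¹ * (t - w)⁻¹)) := by
        fun_prop
      exact hm.aestronglyMeasurable.smul hu.1
    · refine Eventually.of_forall fun y => ae_of_all _ fun t => ?_
      rw [norm_smul]
      gcongr
      exact norm_kernel_le hw x t y
    · have hne : ∀ᵐ t : ℝ, t ≠ x := by
        rw [ae_iff]
        simp
      filter_upwards [hne] with t ht
      have hxt : (x - t : ℂ) ≠ 0 := by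
        rw [← Complex.ofReal_sub]
        exact_mod_cast sub_ne_zero.2 ht.symm
      have h1 : Tendsto (fun y : ℝ => ((x - t) / (x - t + y * Complex.I) : ℂ)) (𝓝[>] 0)
          (𝓝 ((x - t) / (x - t + (0 : ℝ) * Complex.I))) := by
        refine Tendsto.mono_left (ContinuousAt.tendsto ?_) nhdsWithin_le_nhds
        exact ContinuousAt.div (by fun_prop) (by fun_prop) (by simpa using hxt)
      rw [Complex.ofReal_zero, zero_mul, add_zero, div_self hxt] at h1
      have h2 := ((h1.mul_const ((x - starRingEnd ℂ w)⁻¹ * (t - w : ℂ)⁻¹)).const_mul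
        ((w.im / Real.pi : ℝ) : ℂ)).smul_const (u t)
      rw [one_mul, ← mul_assoc, mul_smul] at h2
      exact h2
  rw [integral_smul] at h
  refine h.congr' ?_
  filter_upwards [self_mem_nhdsWithin] with y hy
  exact (cauchy_sub_blaschke hw hu x hy).symm

theorem norm_cauchy_sub_blaschke_le (hw : 0 < w.im) {u : ℝ → EuclideanSpace ℂ (Fin n)}
    (hu : Integrable u) (x : ℝ) {y : ℝ} (hy : 0 < y) :
    ‖cauchy u (x + y * Complex.I) - blaschke w x •
        cauchy (fun t => starRingEnd ℂ (blaschke w t) • u t) (x + y * Complex.I)‖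
      ≤ (Real.pi * w.im)⁻¹ * ∫ t, ‖u t‖ := by
  rw [cauchy_sub_blaschke hw hu x hy, ← integral_const_mul]
  refine norm_integral_le_of_norm_le (hu.norm.const_mul _) (ae_of_all _ fun t => ?_)
  rw [norm_smul]
  gcongr
  exact norm_kernel_le hw x t y

/-- The compression of `P₊` by a Blaschke factor differs from `P₊` by a rank one form. -/
theorem integral_inner_rieszProj_sub (hw : 0 < w.im) {u v : ℝ → EuclideanSpace ℂ (Fin n)}
    (hu : Integrable u) (hv : Integrable v) (hu2 : MemLp u 2) (hv2 : MemLp v 2) :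
    (∫ x, inner ℂ (rieszProj n (hu2.toLp u) x) (v x))
      - ∫ x, inner ℂ (rieszProj n ((memLp_blaschke_smul hw hu2).toLp _) x)
          (starRingEnd ℂ (blaschke w x) • v x)
      = (w.im / Real.pi : ℝ) *
        inner ℂ (∫ t : ℝ, (t - w : ℂ)⁻¹ • u t) (∫ t : ℝ, (t - w : ℂ)⁻¹ • v t) := by
  set u' : ℝ → EuclideanSpace ℂ (Fin n) := fun t => starRingEnd ℂ (blaschke w t) • u t with hu'
  set v' : ℝ → EuclideanSpace ℂ (Fin n) := fun t => starRingEnd ℂ (blaschke w t) • v t with hv'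
  have hu'i : Integrable u' := integrable_blaschke_smul hw hu
  have hv'i : Integrable v' := integrable_blaschke_smul hw hv
  set U := ∫ t : ℝ, (t - w : ℂ)⁻¹ • u t with hU
  have h1 := tendsto_integral_inner_cauchy (hu2.toLp u) (hu.congr hu2.coeFn_toLp.symm) hv2
  have h2 := tendsto_integral_inner_cauchy ((memLp_blaschke_smul hw hu2).toLp u')
    (hu'i.congr (memLp_blaschke_smul hw hu2).coeFn_toLp.symm) (memLp_blaschke_smul hw hv2)
  simp only [cauchy_congr hu2.coeFn_toLp] at h1
  have hc : ∀ z, cauchy ((memLp_blaschke_smul hw hu2).toLp u') z = cauchy u' z :=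
    cauchy_congr (memLp_blaschke_smul hw hu2).coeFn_toLp
  simp only [hc] at h2
  have h3 := h1.sub h2
  have h4 : Tendsto (fun y : ℝ => ∫ x : ℝ, inner ℂ (cauchy u (x + y * Complex.I)
      - blaschke w x • cauchy u' (x + y * Complex.I)) (v x)) (𝓝[>] 0)
      (𝓝 (∫ x : ℝ, inner ℂ ((((w.im / Real.pi : ℝ) : ℂ) * (x - starRingEnd ℂ w)⁻¹) • U)
        (v x))) := by
    refine tendsto_integral_filter_of_dominated_convergence
      (fun x => ((Real.pi * w.im)⁻¹ * ∫ t, ‖u t‖) * ‖v x‖) ?_ ?_ (hv.norm.const_mul _) ?_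
    · filter_upwards [self_mem_nhdsWithin] with y hy
      refine AEStronglyMeasurable.inner ?_ hv.1
      refine Continuous.aestronglyMeasurable ?_
      exact (continuous_cauchy_line hu (ne_of_gt hy)).sub ((continuous_blaschke hw).smul
        (continuous_cauchy_line hu'i (ne_of_gt hy)))
    · filter_upwards [self_mem_nhdsWithin] with y hy
      refine ae_of_all _ fun x => (norm_inner_le_norm _ _).trans ?_
      gcongr
      exact norm_cauchy_sub_blaschke_le hw hu x hy
    · exact ae_of_all _ fun x => (tendsto_cauchy_sub_blaschke hw hu x).inner tendsto_const_nhds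
  have h5 := tendsto_nhds_unique (h3.congr' ?_) h4
  · rw [h5]
    have h6 : ∀ x : ℝ, inner ℂ ((((w.im / Real.pi : ℝ) : ℂ) * (x - starRingEnd ℂ w)⁻¹) • U) (v x)
        = (w.im / Real.pi : ℝ) * inner ℂ U ((x - w : ℂ)⁻¹ • v x) := by
      intro x
      rw [inner_smul_left, inner_smul_right, map_mul, Complex.conj_ofReal, map_inv₀, map_sub,
        Complex.conj_ofReal, Complex.conj_conj, mul_assoc]
    simp only [h6]
    rw [integral_const_mul, integral_inner]
    have hm : Measurable fun t : ℝ => (t - w : ℂ)⁻¹ := by fun_prop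
    refine hv.bdd_smul (w.im⁻¹) hm.aestronglyMeasurable (ae_of_all _ fun t => ?_)
    rw [norm_inv]
    gcongr
    exact im_le_norm_sub hw t
  · filter_upwards [self_mem_nhdsWithin] with y hy
    rw [← integral_sub (integrable_inner_cauchy hu hv hy) (integrable_inner_cauchy hu'i hv'i hy)]
    refine integral_congr_ae (ae_of_all _ fun x => ?_)
    simp only [hv']
    rw [inner_sub_left, inner_smul_left, inner_smul_right]

end RankOne

end MatrixA2

end

noncomputable section
namespace MatrixA2

/-! ### Test functions for the rank one form. -/

section TestFunctions

variable {n : ℕ} {E F : Set ℝ} {W : ℝ → Matrix (Fin n) (Fin n) ℂ}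

theorem IsMatrixWeight.mono (hW : IsMatrixWeight E W) (hF : F ⊆ E) : IsMatrixWeight F W :=
  ⟨fun i j => (hW.measurable i j).mono_measure (Measure.restrict_mono hF le_rfl),
    ae_restrict_of_ae_restrict_of_subset hF hW.posDef⟩

theorem aestronglyMeasurable_clm_apply {α : Type*} [MeasurableSpace α] {μ : Measure α}
    {A : α → Matrix (Fin n) (Fin n) ℂ} (hA : AEStronglyMeasurable (fun t => clm (A t)) μ)
    {f : α → EuclideanSpace ℂ (Fin n)} (hf : AEStronglyMeasurable f μ) :
    AEStronglyMeasurable (fun t => clm (A t) (f t)) μ :=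
  isBoundedBilinearMap_apply.continuous.comp_aestronglyMeasurable (hA.prodMk hf)

theorem aestronglyMeasurable_mulOn (hEm : MeasurableSet E) {A : ℝ → Matrix (Fin n) (Fin n) ℂ}
    (hA : AEStronglyMeasurable (fun t => clm (A t)) (volume.restrict E))
    {f : ℝ → EuclideanSpace ℂ (Fin n)} (hf : AEStronglyMeasurable f volume) :
    AEStronglyMeasurable (mulOn E A f) volume :=
  (aestronglyMeasurable_indicator_iff hEm).2 (aestronglyMeasurable_clm_apply hA hf.restrict)

theorem ae_of_restrict {p : ℝ → Prop} (hEm : MeasurableSet E)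
    (h : ∀ᵐ t ∂(volume.restrict E), p t) : ∀ᵐ t, t ∈ E → p t :=
  (ae_restrict_iff' hEm).1 h

/-- The norm estimate in bilinear form: it is applied to `f = W^{1/2} u`, and `W^{1/2}`, `W^{-1/2}`
are inserted into the pairing. -/
theorem enorm_integral_inner_rieszProj_le (hEm : MeasurableSet E) (hW : IsMatrixWeight E W)
    {C : ℝ≥0} (hC : ∀ f : L2 n, (∀ᵐ t, t ∉ E → f t = 0) →
      ∀ hf : MemLp (mulOn E (fun t => (CFC.sqrt (W t))⁻¹) f) 2 volume,
        eLpNorm (mulOn E (fun t => CFC.sqrt (W t)) (rieszProj n (hf.toLp _))) 2 volume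
          ≤ C * eLpNorm f 2 volume)
    {u v : ℝ → EuclideanSpace ℂ (Fin n)} (hu : MemLp u 2) (hv : MemLp v 2)
    (hu0 : ∀ t ∉ E, u t = 0) (hv0 : ∀ t ∉ E, v t = 0)
    (hHu : MemLp (mulOn E (fun t => CFC.sqrt (W t)) u) 2) :
    ‖∫ x, inner ℂ (rieszProj n (hu.toLp u) x) (v x)‖ₑ
      ≤ C * eLpNorm (mulOn E (fun t => CFC.sqrt (W t)) u) 2 volume *
        eLpNorm (mulOn E (fun t => CFC.sqrt (W t)⁻¹) v) 2 volume := by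
  set f : L2 n := hHu.toLp _ with hf
  have hf1 : f =ᵐ[volume] mulOn E (fun t => CFC.sqrt (W t)) u := hHu.coeFn_toLp
  have hf0 : ∀ᵐ t, t ∉ E → f t = 0 := by
    filter_upwards [hf1] with t ht htE
    rw [ht, mulOn, indicator_of_notMem htE]
  have hfu : mulOn E (fun t => (CFC.sqrt (W t))⁻¹) f =ᵐ[volume] u := by
    filter_upwards [hf1, ae_of_restrict hEm hW.posDef] with t ht hpos
    by_cases htE : t ∈ E
    · have hp := hpos htE
      rw [mulOn_apply_of_mem htE, ht, mulOn_apply_of_mem htE,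
        Matrix.PosSemidef.inv_sqrt hp.posSemidef, ← clm_mul_apply,
        mul_eq_one_comm.1 (sqrt_mul_sqrt_inv hp), clm, map_one, one_apply_eq_self]
    · rw [mulOn, indicator_of_notMem htE, hu0 t htE]
  have hfm : MemLp (mulOn E (fun t => (CFC.sqrt (W t))⁻¹) f) 2 volume :=
    (memLp_congr_ae hfu).2 hu
  have hlp : hfm.toLp _ = hu.toLp u := MemLp.toLp_eq_toLp_iff _ _ |>.2 hfu
  have h1 := hC f hf0 hfm
  rw [hlp, eLpNorm_congr_ae hf1] at h1
  set P := rieszProj n (hu.toLp u) with hP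
  have h2 : ∫ x, inner ℂ (P x) (v x) = ∫ x, inner ℂ (mulOn E (fun t => CFC.sqrt (W t)) P x)
      (mulOn E (fun t => CFC.sqrt (W t)⁻¹) v x) := by
    refine integral_congr_ae ?_
    filter_upwards [ae_of_restrict hEm hW.posDef] with t hpos
    by_cases htE : t ∈ E
    · rw [mulOn_apply_of_mem htE, mulOn_apply_of_mem htE, inner_sqrt_sqrt_inv (hpos htE)]
    · rw [hv0 t htE, mulOn, indicator_of_notMem htE, inner_zero_right, inner_zero_left]
  rw [h2]
  refine (enorm_integral_inner_le ?_ ?_).trans (mul_le_mul_left h1 _)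
  · exact aestronglyMeasurable_mulOn hEm hW.aestronglyMeasurable_sqrt (Lp.aestronglyMeasurable P)
  · exact aestronglyMeasurable_mulOn hEm hW.inv.aestronglyMeasurable_sqrt hv.1

theorem integral_clm_eq_avg {a δ : ℝ} (hδ : 0 < δ)
    (h : EntriesIntegrableOn W (Ioo (a - δ) (a + δ) ∩ F)) (x : EuclideanSpace ℂ (Fin n))
    (hi : IntegrableOn (fun t => clm (W t) x) (Ioo (a - δ) (a + δ) ∩ F)) :
    ∫ t in Ioo (a - δ) (a + δ) ∩ F, clm (W t) x = ((2 * δ : ℝ) : ℂ) • clm (avg F W a δ) x := by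
  refine ext_inner_left ℂ fun y => ?_
  rw [← integral_inner hi, inner_smul_right, inner_avg h, ← mul_assoc, ← Complex.ofReal_mul,
    mul_inv_cancel₀ (by positivity), Complex.ofReal_one, one_mul]

/-- The test function `t ↦ (t - w) W(t) x` on `(a - δ, a + δ) ∩ F`. -/
def testFun (F : Set ℝ) (W : ℝ → Matrix (Fin n) (Fin n) ℂ) (a δ : ℝ)
    (x : EuclideanSpace ℂ (Fin n)) : ℝ → EuclideanSpace ℂ (Fin n) :=
  (Ioo (a - δ) (a + δ) ∩ F).indicator fun t => (t - (a + δ * Complex.I) : ℂ) • clm (W t) x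

variable {a δ : ℝ}

theorem sq_norm_sub_le {t : ℝ} (ht : t ∈ Ioo (a - δ) (a + δ)) :
    ‖(t - (a + δ * Complex.I) : ℂ)‖ ^ 2 ≤ 2 * δ ^ 2 := by
  have h : (t - (a + δ * Complex.I) : ℂ) = ((t - a : ℝ) : ℂ) + ((-δ : ℝ) : ℂ) * Complex.I := by
    push_cast
    ring
  rw [h, ← Complex.normSq_eq_norm_sq, Complex.normSq_add_mul_I]
  obtain ⟨h1, h2⟩ := ht
  nlinarith

theorem integrableOn_clm_of_bound (hW : IsMatrixWeight F W) {N : ℝ}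
    (hN : ∀ᵐ t ∂(volume.restrict F), ‖W t‖ ≤ N) {I : Set ℝ} (hI : volume I ≠ ∞)
    (x : EuclideanSpace ℂ (Fin n)) : IntegrableOn (fun t => clm (W t) x) (I ∩ F) := by
  have hfin : volume (I ∩ F) < ∞ := (measure_mono inter_subset_left).trans_lt hI.lt_top
  have : IsFiniteMeasure (volume.restrict (I ∩ F)) := ⟨by simpa using hfin⟩
  refine Integrable.of_bound (C := N * ‖x‖) ?_ ?_
  · exact ((aestronglyMeasurable_clm_apply (continuous_clm.comp_aestronglyMeasurable
      hW.aestronglyMeasurable) aestronglyMeasurable_const).mono_measure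
      (Measure.restrict_mono inter_subset_right le_rfl))
  · filter_upwards [ae_restrict_of_ae_restrict_of_subset inter_subset_right hN] with t ht
    exact (clm (W t)).le_of_opNorm_le ht x

theorem entriesIntegrableOn_of_bound (hW : IsMatrixWeight F W) {N : ℝ}
    (hN : ∀ᵐ t ∂(volume.restrict F), ‖W t‖ ≤ N) {I : Set ℝ} (hI : volume I ≠ ∞) :
    EntriesIntegrableOn W (I ∩ F) := by
  intro i j
  have h := (integrableOn_clm_of_bound hW hN hI (EuclideanSpace.single j 1)).const_inner
    (𝕜 := ℂ) (EuclideanSpace.single i 1)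
  refine h.congr (ae_of_all _ fun t => ?_)
  simp only [inner_clm_eq_sum]
  simp [apply_ite]

theorem memLp_testFun (hFm : MeasurableSet F) (hW : IsMatrixWeight F W) {N : ℝ}
    (hN : ∀ᵐ t ∂(volume.restrict F), ‖W t‖ ≤ N) (x : EuclideanSpace ℂ (Fin n)) :
    MemLp (testFun F W a δ x) 2 := by
  have hSm : MeasurableSet (Ioo (a - δ) (a + δ) ∩ F) := measurableSet_Ioo.inter hFm
  have hfin : volume (Ioo (a - δ) (a + δ) ∩ F) < ∞ :=
    (measure_mono inter_subset_left).trans_lt measure_Ioo_lt_top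
  have : IsFiniteMeasure (volume.restrict (Ioo (a - δ) (a + δ) ∩ F)) := ⟨by simpa using hfin⟩
  rw [testFun, memLp_indicator_iff_restrict hSm]
  have hm : AEStronglyMeasurable (fun t : ℝ => (t - (a + δ * Complex.I) : ℂ))
      (volume.restrict (Ioo (a - δ) (a + δ) ∩ F)) :=
    Continuous.aestronglyMeasurable (by fun_prop)
  refine MemLp.of_bound (C := √(2 * δ ^ 2) * (N * ‖x‖)) (hm.smul
    (integrableOn_clm_of_bound hW hN measure_Ioo_lt_top.ne x).1) ?_
  filter_upwards [ae_restrict_of_ae_restrict_of_subset inter_subset_right hN,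
    ae_restrict_mem hSm] with t ht htS
  rw [norm_smul]
  gcongr
  · exact Real.le_sqrt_of_sq_le (sq_norm_sub_le htS.1)
  · exact (clm (W t)).le_of_opNorm_le ht x

theorem testFun_eq_zero {t : ℝ} (ht : t ∉ Ioo (a - δ) (a + δ) ∩ F)
    (x : EuclideanSpace ℂ (Fin n)) : testFun F W a δ x t = 0 := indicator_of_notMem ht _

theorem integrable_testFun (hFm : MeasurableSet F) (hW : IsMatrixWeight F W) {N : ℝ}
    (hN : ∀ᵐ t ∂(volume.restrict F), ‖W t‖ ≤ N) (x : EuclideanSpace ℂ (Fin n)) :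
    Integrable (testFun F W a δ x) :=
  integrable_of_memLp_two (measurableSet_Ioo.inter hFm)
    ((measure_mono inter_subset_left).trans_lt measure_Ioo_lt_top).ne
    (memLp_testFun hFm hW hN x) fun _ ht => testFun_eq_zero ht x

/-- The factor `t - w` in the test function cancels the kernel `(t - w)⁻¹` of the rank one form and
leaves exactly the average. -/
theorem integral_testFun (hFm : MeasurableSet F) (hW : IsMatrixWeight F W) (hδ : 0 < δ) {N : ℝ}
    (hN : ∀ᵐ t ∂(volume.restrict F), ‖W t‖ ≤ N) (x : EuclideanSpace ℂ (Fin n)) :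
    ∫ t : ℝ, (t - (a + δ * Complex.I) : ℂ)⁻¹ • testFun F W a δ x t
      = ((2 * δ : ℝ) : ℂ) • clm (avg F W a δ) x := by
  have hSm : MeasurableSet (Ioo (a - δ) (a + δ) ∩ F) := measurableSet_Ioo.inter hFm
  rw [← integral_clm_eq_avg hδ (entriesIntegrableOn_of_bound hW hN measure_Ioo_lt_top.ne) x
    (integrableOn_clm_of_bound hW hN measure_Ioo_lt_top.ne x), ← integral_indicator hSm]
  refine integral_congr_ae (ae_of_all _ fun t => ?_)
  by_cases ht : t ∈ Ioo (a - δ) (a + δ) ∩ F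
  · simp only [testFun, indicator_of_mem ht]
    refine inv_smul_smul₀ ?_ _
    exact sub_ne_zero_of_im_pos (by simpa using hδ) t
  · simp only [testFun, indicator_of_notMem ht, smul_zero]

/-- The weighted norm of a test function, up to a unimodular factor. -/
theorem sq_eLpNorm_mulOn_testFun_le (hFm : MeasurableSet F) (hFE : F ⊆ E)
    {V R : ℝ → Matrix (Fin n) (Fin n) ℂ} (hV : IsMatrixWeight F V) (hδ : 0 < δ) {N : ℝ}
    (hN : ∀ᵐ t ∂(volume.restrict F), ‖V t‖ ≤ N)
    (hR : ∀ᵐ t ∂(volume.restrict F), R t * V t = CFC.sqrt (V t)) (x : EuclideanSpace ℂ (Fin n))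
    {f : ℝ → EuclideanSpace ℂ (Fin n)} {k : ℝ → ℂ} (hk : ∀ t, ‖k t‖ = 1)
    (hf : ∀ t, f t = k t • testFun F V a δ x t) :
    eLpNorm (mulOn E R f) 2 volume ^ 2
      ≤ ENNReal.ofReal (4 * δ ^ 3 * (inner ℂ x (clm (avg F V a δ) x)).re) := by
  have hSm : MeasurableSet (Ioo (a - δ) (a + δ) ∩ F) := measurableSet_Ioo.inter hFm
  have hint := entriesIntegrableOn_of_bound hV hN (measure_Ioo_lt_top (a := a - δ) (b := a + δ)).ne
  have h1 := lintegral_sq_sqrt_eq hV hδ hint x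
  -- The factor `2δ²` bounds `|t - w|²` on the interval, and `2δ` is the length in the average.
  rw [show 4 * δ ^ 3 * (inner ℂ x (clm (avg F V a δ) x)).re
    = 2 * δ ^ 2 * (2 * δ * (inner ℂ x (clm (avg F V a δ) x)).re) by ring,
    ENNReal.ofReal_mul (by positivity), ← h1, Measure.restrict_restrict measurableSet_Ioo,
    sq_eLpNorm_two, ← lintegral_const_mul' _ _ ENNReal.ofReal_ne_top, ← lintegral_indicator hSm]
  refine lintegral_mono_ae ?_
  filter_upwards [ae_of_restrict hFm hR] with t hRt
  by_cases ht : t ∈ Ioo (a - δ) (a + δ) ∩ F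
  · rw [indicator_of_mem ht, mulOn_apply_of_mem (hFE ht.2), hf, testFun, indicator_of_mem ht,
      map_smul, map_smul, ← clm_mul_apply, hRt ht.2, enorm_smul, enorm_smul, ← mul_assoc, mul_pow]
    gcongr
    rw [← ofReal_norm, hk, ENNReal.ofReal_one, one_mul, ← ofReal_norm,
      ← ENNReal.ofReal_pow (norm_nonneg _)]
    exact ENNReal.ofReal_le_ofReal (sq_norm_sub_le ht.1)
  · rw [indicator_of_notMem ht]
    have : mulOn E R f t = 0 := by
      rw [mulOn, indicator_apply_eq_zero]
      intro _
      rw [hf, testFun_eq_zero ht, smul_zero, map_zero]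
    rw [this]
    simp

end TestFunctions

end MatrixA2

end

noncomputable section
namespace MatrixA2

/-! ### The form inequality for averages and its consequences. -/

section Necessity

variable {n : ℕ} {E F : Set ℝ} {W : ℝ → Matrix (Fin n) (Fin n) ℂ} {a δ : ℝ}

/-- `|⟪N h, M e⟫|² ≤ K² ⟪N h, h⟫ ⟪M e, e⟫`. -/
def FormBound (K : ℝ) (M N : Matrix (Fin n) (Fin n) ℂ) : Prop :=
  ∀ h e, ‖inner ℂ (clm N h) (clm M e)‖ ^ 2
    ≤ K ^ 2 * ((inner ℂ h (clm N h)).re * (inner ℂ e (clm M e)).re)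

theorem FormBound.symm {K : ℝ} {M N : Matrix (Fin n) (Fin n) ℂ} (h : FormBound K M N) :
    FormBound K N M := by
  intro e f
  rw [norm_inner_symm, mul_comm (inner ℂ e (clm M e)).re]
  exact h f e

theorem inner_avg_self_nonneg (hW : IsMatrixWeight F W) (hδ : 0 < δ)
    (h : EntriesIntegrableOn W (Ioo (a - δ) (a + δ) ∩ F)) (x : EuclideanSpace ℂ (Fin n)) :
    0 ≤ (inner ℂ x (clm (avg F W a δ) x)).re := by
  rw [inner_avg_self hW h, Complex.ofReal_re]
  refine mul_nonneg (by positivity) (integral_nonneg_of_ae ?_)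
  filter_upwards [ae_posDef_inter hW _] with t ht
  rw [Pi.zero_apply, ← sq_norm_sqrt ht.posSemidef]
  positivity

theorem sqrt_inv_mul_self {A : Matrix (Fin n) (Fin n) ℂ} (hA : A.PosDef) :
    CFC.sqrt A⁻¹ * A = CFC.sqrt A := by
  calc CFC.sqrt A⁻¹ * A = CFC.sqrt A⁻¹ * (CFC.sqrt A * CFC.sqrt A) := by
        rw [CFC.sqrt_mul_sqrt_self A hA.posSemidef.nonneg]
    _ = _ := by rw [← mul_assoc, mul_eq_one_comm.1 (sqrt_mul_sqrt_inv hA), one_mul]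

theorem sqrt_mul_inv_self {A : Matrix (Fin n) (Fin n) ℂ} (hA : A.PosDef) :
    CFC.sqrt A * A⁻¹ = CFC.sqrt A⁻¹ := by
  calc CFC.sqrt A * A⁻¹ = CFC.sqrt A * (CFC.sqrt A⁻¹ * CFC.sqrt A⁻¹) := by
        rw [CFC.sqrt_mul_sqrt_self A⁻¹ hA.inv.posSemidef.nonneg]
    _ = _ := by rw [← mul_assoc, sqrt_mul_sqrt_inv hA, one_mul]

/-- The rank one form is a difference of two Riesz pairings, one of them with unimodular factors,
and both obey the same weighted bound. The set `F` serves to make all averages finite. -/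
theorem formBound_avg (hEm : MeasurableSet E) (hFm : MeasurableSet F) (hFE : F ⊆ E)
    (hW : IsMatrixWeight E W) {C : ℝ≥0} (hC : ∀ f : L2 n, (∀ᵐ t, t ∉ E → f t = 0) →
      ∀ hf : MemLp (mulOn E (fun t => (CFC.sqrt (W t))⁻¹) f) 2 volume,
        eLpNorm (mulOn E (fun t => CFC.sqrt (W t)) (rieszProj n (hf.toLp _))) 2 volume
          ≤ C * eLpNorm f 2 volume) (hδ : 0 < δ) {N : ℝ}
    (hN : ∀ᵐ t ∂(volume.restrict F), ‖W t‖ ≤ N)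
    (hN' : ∀ᵐ t ∂(volume.restrict F), ‖(W t)⁻¹‖ ≤ N) :
    FormBound (2 * Real.pi * C) (avg F W a δ) (avg F (fun t => (W t)⁻¹) a δ) := by
  intro h e
  set W' : ℝ → Matrix (Fin n) (Fin n) ℂ := fun t => (W t)⁻¹ with hW'
  have hWF := hW.mono hFE
  have hWF' := hW.inv.mono hFE
  set w : ℂ := a + δ * Complex.I with hw
  have hwim : w.im = δ := by simp [hw]
  have hw0 : 0 < w.im := by rwa [hwim]
  set u := testFun F W' a δ h with hu
  set v := testFun F W a δ e with hv
  have hu2 : MemLp u 2 := memLp_testFun hFm hWF' hN' h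
  have hv2 : MemLp v 2 := memLp_testFun hFm hWF hN e
  have hui : Integrable u := integrable_testFun hFm hWF' hN' h
  have hvi : Integrable v := integrable_testFun hFm hWF hN e
  have hu0 : ∀ t ∉ E, u t = 0 := fun t ht => testFun_eq_zero (fun h => ht (hFE h.2)) h
  have hv0 : ∀ t ∉ E, v t = 0 := fun t ht => testFun_eq_zero (fun h => ht (hFE h.2)) e
  set k : ℝ → ℂ := fun t => starRingEnd ℂ (blaschke w t) with hk
  have hk1 : ∀ t, ‖k t‖ = 1 := fun t => by rw [hk, Complex.norm_conj, norm_blaschke hw0]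
  set p := (inner ℂ h (clm (avg F W' a δ) h)).re with hp
  set q := (inner ℂ e (clm (avg F W a δ) e)).re with hq
  have hp0 : 0 ≤ p := inner_avg_self_nonneg hWF' hδ
    (entriesIntegrableOn_of_bound hWF' hN' measure_Ioo_lt_top.ne) h
  have hq0 : 0 ≤ q := inner_avg_self_nonneg hWF hδ
    (entriesIntegrableOn_of_bound hWF hN measure_Ioo_lt_top.ne) e
  have hHu : ∀ {f : ℝ → EuclideanSpace ℂ (Fin n)} {k : ℝ → ℂ}, (∀ t, ‖k t‖ = 1) →
      (∀ t, f t = k t • u t) →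
      eLpNorm (mulOn E (fun t => CFC.sqrt (W t)) f) 2 volume ^ 2
        ≤ ENNReal.ofReal (4 * δ ^ 3 * p) := fun hk hf => by
    refine sq_eLpNorm_mulOn_testFun_le hFm hFE hWF' hδ hN' ?_ h hk hf
    filter_upwards [hWF.posDef] with t ht using sqrt_mul_inv_self ht
  have hGv : ∀ {f : ℝ → EuclideanSpace ℂ (Fin n)} {k : ℝ → ℂ}, (∀ t, ‖k t‖ = 1) →
      (∀ t, f t = k t • v t) →
      eLpNorm (mulOn E (fun t => CFC.sqrt (W t)⁻¹) f) 2 volume ^ 2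
        ≤ ENNReal.ofReal (4 * δ ^ 3 * q) := fun hk hf => by
    refine sq_eLpNorm_mulOn_testFun_le hFm hFE hWF hδ hN ?_ e hk hf
    filter_upwards [hWF.posDef] with t ht using sqrt_inv_mul_self ht
  have hbound : ∀ {f g : ℝ → EuclideanSpace ℂ (Fin n)} {k : ℝ → ℂ} (hf : MemLp f 2),
      MemLp g 2 → (∀ t, ‖k t‖ = 1) → (∀ t, f t = k t • u t) → (∀ t, g t = k t • v t) →
      ‖∫ x, inner ℂ (rieszProj n (hf.toLp f) x) (g x)‖ ≤ C * (4 * δ ^ 3) * √(p * q) := by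
    intro f g k hf hg hk hfu hgv
    have h1 : MemLp (mulOn E (fun t => CFC.sqrt (W t)) f) 2 := by
      refine ⟨aestronglyMeasurable_mulOn hEm hW.aestronglyMeasurable_sqrt hf.1, ?_⟩
      have := (hHu hk hfu).trans_lt ENNReal.ofReal_lt_top
      rcases eq_or_ne (eLpNorm (mulOn E (fun t => CFC.sqrt (W t)) f) 2 volume) ∞ with h | h
      · rw [h] at this
        simp at this
      · exact h.lt_top
    have h2 := enorm_integral_inner_rieszProj_le hEm hW hC hf hg
      (fun t ht => by rw [hfu, hu0 t ht, smul_zero]) (fun t ht => by rw [hgv, hv0 t ht, smul_zero])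
      h1
    have h3 : ‖∫ x, inner ℂ (rieszProj n (hf.toLp f) x) (g x)‖ₑ ^ 2
        ≤ ENNReal.ofReal ((C * (4 * δ ^ 3) * √(p * q)) ^ 2) := by
      calc _ ≤ (C * eLpNorm (mulOn E (fun t => CFC.sqrt (W t)) f) 2 volume *
              eLpNorm (mulOn E (fun t => CFC.sqrt (W t)⁻¹) g) 2 volume) ^ 2 := by gcongr
        _ ≤ C ^ 2 * ENNReal.ofReal (4 * δ ^ 3 * p) * ENNReal.ofReal (4 * δ ^ 3 * q) := by
            rw [mul_pow, mul_pow]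
            gcongr
            · exact hHu hk hfu
            · exact hGv hk hgv
        _ = _ := by
            rw [mul_pow, Real.sq_sqrt (by positivity), ← ENNReal.ofReal_coe_nnreal,
              ← ENNReal.ofReal_pow (by positivity), ← ENNReal.ofReal_mul (by positivity),
              ← ENNReal.ofReal_mul (by positivity)]
            congr 1
            ring
    rw [← ofReal_norm, ← ENNReal.ofReal_pow (norm_nonneg _),
      ENNReal.ofReal_le_ofReal_iff (by positivity)] at h3
    exact (pow_le_pow_iff_left₀ (norm_nonneg _) (by positivity) (by norm_num)).1 h3
  have hid := integral_inner_rieszProj_sub hw0 hui hvi hu2 hv2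
  have hb1 := hbound hu2 hv2 (k := fun _ => 1) (by simp) (by simp) (by simp)
  have hb2 := hbound (memLp_blaschke_smul hw0 hu2) (memLp_blaschke_smul hw0 hv2) hk1
    (fun t => rfl) (fun t => rfl)
  have hU : ∫ t : ℝ, (t - w : ℂ)⁻¹ • u t = ((2 * δ : ℝ) : ℂ) • clm (avg F W' a δ) h :=
    integral_testFun hFm hWF' hδ hN' h
  have hV : ∫ t : ℝ, (t - w : ℂ)⁻¹ • v t = ((2 * δ : ℝ) : ℂ) • clm (avg F W a δ) e :=
    integral_testFun hFm hWF hδ hN e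
  rw [hU, hV, inner_smul_left, inner_smul_right, Complex.conj_ofReal, hwim] at hid
  have hn := congrArg norm hid
  rw [norm_mul, norm_mul, norm_mul, Complex.norm_real, Complex.norm_real,
    Real.norm_of_nonneg (by positivity), Real.norm_of_nonneg (by positivity)] at hn
  set z := ‖inner ℂ (clm (avg F W' a δ) h) (clm (avg F W a δ) e)‖ with hz
  -- The powers of `δ` agree on both sides, so the constant `2πC` is independent of scale.
  have h1 : δ / Real.pi * (2 * δ * (2 * δ * z)) ≤ 2 * (C * (4 * δ ^ 3) * √(p * q)) := by
    rw [← hn]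
    refine (norm_sub_le _ _).trans ?_
    linarith
  have hpi := Real.pi_pos
  have h2 : z ≤ 2 * Real.pi * C * √(p * q) := by
    have h3 : δ / Real.pi * (2 * δ * (2 * δ * z)) = 4 * δ ^ 3 / Real.pi * z := by ring
    have h4 : 2 * (C * (4 * δ ^ 3) * √(p * q))
        = 4 * δ ^ 3 / Real.pi * (2 * Real.pi * C * √(p * q)) := by
      field_simp
    rw [h3, h4] at h1
    exact le_of_mul_le_mul_left h1 (by positivity)
  calc z ^ 2 ≤ (2 * Real.pi * C * √(p * q)) ^ 2 := by gcongr
    _ = _ := by rw [mul_pow, Real.sq_sqrt (by positivity)]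

theorem sq_norm_le_of_posDef {N : Matrix (Fin n) (Fin n) ℂ} (hN : N.PosDef)
    (h : EuclideanSpace ℂ (Fin n)) :
    ‖h‖ ^ 2 ≤ ‖CFC.sqrt N⁻¹‖ ^ 2 * (inner ℂ h (clm N h)).re := by
  have h1 : h = clm (CFC.sqrt N⁻¹) (clm (CFC.sqrt N) h) := by
    rw [← clm_mul_apply, mul_eq_one_comm.1 (sqrt_mul_sqrt_inv hN), clm, map_one, one_apply_eq_self]
  rw [← sq_norm_sqrt hN.posSemidef, ← mul_pow]
  gcongr
  conv_lhs => rw [h1]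
  refine ((clm (CFC.sqrt N⁻¹)).le_opNorm _).trans (le_of_eq ?_)
  rw [clm, Matrix.l2_opNorm_toEuclideanCLM]

/-- Putting `h = N⁻¹ e` in the form inequality gives `M ≤ K² N⁻¹`. A lower bound for `N` is thus an
upper bound for `M`. -/
theorem FormBound.inner_le {K B : ℝ} {M N : Matrix (Fin n) (Fin n) ℂ} (hMN : FormBound K M N)
    (hM : M.PosDef) (hN : N.PosDef)
    (hB : ∀ h, ‖h‖ ^ 2 ≤ B * (inner ℂ h (clm N h)).re) (e : EuclideanSpace ℂ (Fin n)) :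
    (inner ℂ e (clm M e)).re ≤ K ^ 2 * (B * ‖e‖ ^ 2) := by
  set h := clm N⁻¹ e with hh
  have hNh : clm N h = e := by
    rw [hh, ← clm_mul_apply, Matrix.mul_nonsing_inv _ ((Matrix.isUnit_iff_isUnit_det _).1 hN.isUnit),
      clm, map_one, one_apply_eq_self]
  have h1 := hMN h e
  have h2 := hB h
  rw [hNh] at h1 h2
  set p := (inner ℂ h e).re with hp
  set q := (inner ℂ e (clm M e)).re with hq
  have hq0 : 0 ≤ q := by
    rw [hq, ← sq_norm_sqrt hM.posSemidef]
    positivity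
  have hp0 : 0 ≤ p := by
    rw [hp, ← hNh, ← sq_norm_sqrt hN.posSemidef]
    positivity
  have hqn : ‖inner ℂ e (clm M e)‖ = q := by
    rw [inner_clm_self_eq hM.posSemidef, Complex.norm_real, Real.norm_of_nonneg hq0]
  rw [hqn] at h1
  have hpe : p ≤ B * ‖e‖ ^ 2 := by
    have h3 : p ≤ ‖h‖ * ‖e‖ := (Complex.re_le_norm _).trans (norm_inner_le_norm _ _)
    rcases hp0.eq_or_lt with h0 | h0
    · have h4 : ‖h‖ = 0 := by
        rw [← h0, mul_zero] at h2
        exact pow_eq_zero_iff (two_ne_zero) |>.1 (le_antisymm h2 (sq_nonneg _))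
      have h5 : h = 0 := norm_eq_zero.1 h4
      have h6 : e = 0 := by rw [← hNh, h5, map_zero]
      rw [← h0, h6]
      simp
    · have h4 : p * p ≤ p * (B * ‖e‖ ^ 2) := by
        calc p * p ≤ (‖h‖ * ‖e‖) * (‖h‖ * ‖e‖) := by gcongr
          _ = ‖h‖ ^ 2 * ‖e‖ ^ 2 := by ring
          _ ≤ B * p * ‖e‖ ^ 2 := by gcongr
          _ = _ := by ring
      exact le_of_mul_le_mul_left h4 h0
  have hqp : q ≤ K ^ 2 * p := by
    rcases hq0.eq_or_lt with h0 | h0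
    · rw [← h0]
      positivity
    · refine le_of_mul_le_mul_left ?_ h0
      nlinarith
  exact hqp.trans (by gcongr)

theorem FormBound.norm_sqrt_mul_sqrt_le {K : ℝ} (hK : 0 ≤ K) {M N : Matrix (Fin n) (Fin n) ℂ}
    (hMN : FormBound K M N) (hM : M.PosDef) (hN : N.PosDef) :
    ‖CFC.sqrt M * CFC.sqrt N‖ ≤ K := by
  rw [← Matrix.l2_opNorm_toEuclideanCLM]
  refine ContinuousLinearMap.opNorm_le_bound _ hK fun z => ?_
  set y := clm (CFC.sqrt M * CFC.sqrt N) z with hy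
  change ‖y‖ ≤ _
  have hroot : ∀ {A : Matrix (Fin n) (Fin n) ℂ}, A.PosDef → ∀ x,
      clm (CFC.sqrt A) (clm (CFC.sqrt A⁻¹) x) = x := fun hA x => by
    rw [← clm_mul_apply, sqrt_mul_sqrt_inv hA, clm, map_one, one_apply_eq_self]
  -- For these vectors the left side is `‖y‖⁴` and the right side is `K² ‖z‖² ‖y‖²`.
  have h1 := hMN (clm (CFC.sqrt N⁻¹) z) (clm (CFC.sqrt M⁻¹) y)
  rw [← sq_norm_sqrt hN.posSemidef, ← sq_norm_sqrt hM.posSemidef, hroot hN, hroot hM,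
    ← CFC.sqrt_mul_sqrt_self N hN.posSemidef.nonneg, ← CFC.sqrt_mul_sqrt_self M
    hM.posSemidef.nonneg, clm_mul_apply (CFC.sqrt N), clm_mul_apply (CFC.sqrt M),
    CFC.sqrt_mul_sqrt_self N hN.posSemidef.nonneg, CFC.sqrt_mul_sqrt_self M
    hM.posSemidef.nonneg, hroot hN, hroot hM, ← inner_sqrt_left, ← clm_mul_apply, ← hy,
    inner_self_eq_norm_sq_to_K] at h1
  by_cases h0 : ‖y‖ = 0
  · rw [h0]
    positivity
  have h0' : 0 < ‖y‖ := lt_of_le_of_ne (norm_nonneg _) (Ne.symm h0)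
  have h2 : (‖y‖ ^ 2) ^ 2 ≤ K ^ 2 * (‖z‖ ^ 2 * ‖y‖ ^ 2) := by
    refine le_trans (le_of_eq ?_) h1
    simp
  have h3 : ‖y‖ ^ 2 ≤ (K * ‖z‖) ^ 2 := by
    refine le_of_mul_le_mul_right ?_ (by positivity : 0 < ‖y‖ ^ 2)
    nlinarith
  exact (pow_le_pow_iff_left₀ h0'.le (by positivity) (by norm_num)).1 h3

end Necessity

end MatrixA2

end

noncomputable section
namespace MatrixA2

/-! ### Removing the truncation. -/

section Exhaustion

variable {n : ℕ} {E : Set ℝ} {W : ℝ → Matrix (Fin n) (Fin n) ℂ} {a δ : ℝ}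

theorem iUnion_inter_right (I : Set ℝ) {F : ℕ → Set ℝ} (hFU : ⋃ N, F N = E) :
    ⋃ N, I ∩ F N = I ∩ E := by rw [← inter_iUnion, hFU]

theorem inner_avg_self_mono {F F' : Set ℝ} (hFF : F ⊆ F') (hW : IsMatrixWeight F' W) (hδ : 0 < δ)
    (h : EntriesIntegrableOn W (Ioo (a - δ) (a + δ) ∩ F))
    (h' : EntriesIntegrableOn W (Ioo (a - δ) (a + δ) ∩ F')) (x : EuclideanSpace ℂ (Fin n)) :
    (inner ℂ x (clm (avg F W a δ) x)).re ≤ (inner ℂ x (clm (avg F' W a δ) x)).re := by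
  have h1 : ∫⁻ t in Ioo (a - δ) (a + δ), ‖clm (CFC.sqrt (W t)) x‖ₑ ^ 2 ∂(volume.restrict F)
      ≤ ∫⁻ t in Ioo (a - δ) (a + δ), ‖clm (CFC.sqrt (W t)) x‖ₑ ^ 2 ∂(volume.restrict F') :=
    lintegral_mono' (Measure.restrict_mono le_rfl (Measure.restrict_mono hFF le_rfl)) le_rfl
  have h0 := inner_avg_self_nonneg hW hδ h' x
  rw [lintegral_sq_sqrt_eq (hW.mono hFF) hδ h, lintegral_sq_sqrt_eq hW hδ h',
    ENNReal.ofReal_le_ofReal_iff (by positivity)] at h1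
  exact le_of_mul_le_mul_left h1 (by positivity)

/-- An entry of `W` is a pairing of two columns of `W^{1/2}`, so it is dominated by the sum of the
squared norms of all columns. -/
theorem entriesIntegrableOn_of_lintegral (hW : IsMatrixWeight E W) {I : Set ℝ}
    (h : ∀ x, ∫⁻ t in I ∩ E, ‖clm (CFC.sqrt (W t)) x‖ₑ ^ 2 < ∞) :
    EntriesIntegrableOn W (I ∩ E) := by
  have hWI := hW.mono (inter_subset_right (s := I) (t := E))
  intro i j
  refine ⟨(hWI.measurable i j).aestronglyMeasurable, ?_⟩
  have h1 : ∀ᵐ t ∂(volume.restrict (I ∩ E)), ‖W t i j‖ₑ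
      ≤ n * ∑ k, ‖clm (CFC.sqrt (W t)) (EuclideanSpace.single k 1)‖ₑ ^ 2 := by
    filter_upwards [hWI.posDef] with t ht
    refine le_trans ?_ (sq_enorm_le_sum_sq_enorm_apply (clm (CFC.sqrt (W t))))
    have h2 : inner ℂ (EuclideanSpace.single i (1 : ℂ)) (clm (W t) (EuclideanSpace.single j 1))
        = W t i j := by
      rw [inner_clm_eq_sum]
      simp [apply_ite]
    rw [← h2, ← inner_sqrt_sqrt ht.posSemidef, pow_two]
    refine (enorm_inner_le _ _).trans ?_
    have h3 : ∀ k : Fin n, ‖clm (CFC.sqrt (W t)) (EuclideanSpace.single k 1)‖ₑ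
        ≤ ‖clm (CFC.sqrt (W t))‖ₑ := fun k => by
      rw [enorm_le_iff_norm_le]
      refine ((clm (CFC.sqrt (W t))).le_opNorm _).trans (le_of_eq ?_)
      simp
    exact mul_le_mul' (h3 i) (h3 j)
  refine (lintegral_mono_ae h1).trans_lt ?_
  rw [lintegral_const_mul' _ _ (ENNReal.natCast_ne_top n), lintegral_finsetSum']
  · exact ENNReal.mul_lt_top (ENNReal.natCast_lt_top n) (ENNReal.sum_lt_top.2 fun k _ => h _)
  · exact fun k _ => (aemeasurable_enorm_apply hWI.aestronglyMeasurable_sqrt _).pow_const 2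

/-- The averages of `V` over the growing sets stay above a fixed positive definite one. By the form
inequality the averages of `W` are then bounded uniformly, and monotone convergence gives
integrability. -/
theorem entriesIntegrableOn_of_formBound {V : ℝ → Matrix (Fin n) (Fin n) ℂ}
    (hW : IsMatrixWeight E W) (hV : IsMatrixWeight E V) (hδ : 0 < δ)
    (hvol : volume (Ioo (a - δ) (a + δ) ∩ E) ≠ 0) {F : ℕ → Set ℝ} (hFU : ⋃ N, F N = E)
    (hFmono : Monotone F) {K : ℝ}
    (hWi : ∀ N, EntriesIntegrableOn W (Ioo (a - δ) (a + δ) ∩ F N))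
    (hVi : ∀ N, EntriesIntegrableOn V (Ioo (a - δ) (a + δ) ∩ F N))
    (hK : ∀ N, FormBound K (avg (F N) W a δ) (avg (F N) V a δ)) :
    EntriesIntegrableOn W (Ioo (a - δ) (a + δ) ∩ E) := by
  set I := Ioo (a - δ) (a + δ) with hI
  have hFE : ∀ N, F N ⊆ E := fun N => hFU ▸ subset_iUnion F N
  obtain ⟨N₀, hN₀⟩ : ∃ N, volume (I ∩ F N) ≠ 0 := by
    by_contra! h
    apply hvol
    rw [← iUnion_inter_right I hFU]
    exact measure_iUnion_null h
  have hvolN : ∀ N ≥ N₀, volume (I ∩ F N) ≠ 0 := fun N hN =>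
    ((pos_iff_ne_zero.2 hN₀).trans_le
      (measure_mono (inter_subset_inter_right _ (hFmono hN)))).ne'
  have hVpos := posDef_avg (hV.mono (hFE N₀)) hδ (hVi N₀) hN₀
  set B := ‖CFC.sqrt (avg (F N₀) V a δ)⁻¹‖ ^ 2 with hB
  have hbd : ∀ N ≥ N₀, ∀ x, (inner ℂ x (clm (avg (F N) W a δ) x)).re ≤ K ^ 2 * (B * ‖x‖ ^ 2) := by
    intro N hN x
    refine (hK N).inner_le (posDef_avg (hW.mono (hFE N)) hδ (hWi N) (hvolN N hN))
      (posDef_avg (hV.mono (hFE N)) hδ (hVi N) (hvolN N hN)) (fun h => ?_) x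
    refine (sq_norm_le_of_posDef hVpos h).trans ?_
    exact mul_le_mul_of_nonneg_left
      (inner_avg_self_mono (hFmono hN) (hV.mono (hFE N)) hδ (hVi N₀) (hVi N) h) (sq_nonneg _)
  refine entriesIntegrableOn_of_lintegral hW fun x => ?_
  have hmono : Monotone fun N => I ∩ F N := fun N N' h => inter_subset_inter_right _ (hFmono h)
  rw [← iUnion_inter_right I hFU,
    setLIntegral_iUnion_of_directed _ (directed_of_isDirected_le hmono)]
  refine lt_of_le_of_lt (iSup_le fun N => ?_)
    (ENNReal.ofReal_lt_top (r := 2 * δ * (K ^ 2 * (B * ‖x‖ ^ 2))))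
  refine (lintegral_mono_set (hmono (le_max_left N N₀))).trans ?_
  have h1 := lintegral_sq_sqrt_eq (hW.mono (hFE (max N N₀))) hδ (hWi _) x
  rw [Measure.restrict_restrict measurableSet_Ioo] at h1
  rw [h1]
  refine ENNReal.ofReal_le_ofReal ?_
  have := hbd (max N N₀) (le_max_right _ _) x
  gcongr

theorem tendsto_avg {F : ℕ → Set ℝ} (hFm : ∀ N, MeasurableSet (F N))
    (hFU : ⋃ N, F N = E) (hFmono : Monotone F)
    (h : EntriesIntegrableOn W (Ioo (a - δ) (a + δ) ∩ E)) :
    Tendsto (fun N => avg (F N) W a δ) atTop (𝓝 (avg E W a δ)) := by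
  refine tendsto_pi_nhds.2 fun i => tendsto_pi_nhds.2 fun j => ?_
  have h1 := tendsto_setIntegral_of_monotone (μ := volume) (f := fun t => W t i j)
    (s := fun N => Ioo (a - δ) (a + δ) ∩ F N) (fun N => measurableSet_Ioo.inter (hFm N))
    (fun N N' h => inter_subset_inter_right _ (hFmono h))
  rw [iUnion_inter_right _ hFU] at h1
  exact (h1 (h i j)).const_smul ((2 * δ)⁻¹ : ℝ)

theorem tendsto_clm_apply {M : Matrix (Fin n) (Fin n) ℂ} {M' : ℕ → Matrix (Fin n) (Fin n) ℂ}
    (hM : Tendsto M' atTop (𝓝 M)) (z : EuclideanSpace ℂ (Fin n)) :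
    Tendsto (fun k => clm (M' k) z) atTop (𝓝 (clm M z)) := by
  have h : Continuous fun A : Matrix (Fin n) (Fin n) ℂ => clm A z :=
    continuous_clm.clm_apply continuous_const
  exact (h.tendsto M).comp hM

theorem FormBound.of_tendsto {K : ℝ} {M N : Matrix (Fin n) (Fin n) ℂ}
    {M' N' : ℕ → Matrix (Fin n) (Fin n) ℂ}
    (hM : ∀ z, Tendsto (fun k => clm (M' k) z) atTop (𝓝 (clm M z)))
    (hN : ∀ z, Tendsto (fun k => clm (N' k) z) atTop (𝓝 (clm N z)))
    (h : ∀ k, FormBound K (M' k) (N' k)) : FormBound K M N := by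
  intro x y
  have h1 := (((hN x).inner (𝕜 := ℂ) (hM y)).norm).pow 2
  have h2 : ∀ {v : ℕ → EuclideanSpace ℂ (Fin n)} {v₀ : EuclideanSpace ℂ (Fin n)},
      Tendsto v atTop (𝓝 v₀) → ∀ z : EuclideanSpace ℂ (Fin n),
        Tendsto (fun k => (inner ℂ z (v k)).re) atTop (𝓝 (inner ℂ z v₀).re) := fun hv z =>
    (Complex.continuous_re.tendsto _).comp (tendsto_const_nhds.inner hv)
  exact le_of_tendsto_of_tendsto' h1 (((h2 (hN x) x).mul (h2 (hM y) y)).const_mul (K ^ 2))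
    fun k => h k x y

/-- The sets `F N`, where `W` and `W⁻¹` are bounded by `N`, exhaust `E`. The form inequality holds
on each with the same constant, yields integrability of both weights, and passes to the limit.
Homogeneity enters only to give the sets `I ∩ E` positive measure. -/
theorem A2Const_lt_top_of_weightedRieszBounded (hE : IsHomogeneous E) (hW : IsMatrixWeight E W)
    (h : WeightedRieszBounded E W) : A2Const E W < ⊤ := by
  classical
  obtain ⟨hEm, η, hη, hfat⟩ := hE
  obtain ⟨C, hC⟩ := h
  set W₁ := hW.aestronglyMeasurable.mk with hW₁
  set W₂ := hW.inv.aestronglyMeasurable.mk with hW₂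
  have hm₁ : StronglyMeasurable W₁ := hW.aestronglyMeasurable.stronglyMeasurable_mk
  have hm₂ : StronglyMeasurable W₂ := hW.inv.aestronglyMeasurable.stronglyMeasurable_mk
  set F : ℕ → Set ℝ := fun N => E ∩ ({t | ‖W₁ t‖ ≤ N} ∩ {t | ‖W₂ t‖ ≤ N}) with hF
  have hFm : ∀ N, MeasurableSet (F N) := fun N =>
    hEm.inter ((measurableSet_le hm₁.norm.measurable measurable_const).inter
      (measurableSet_le hm₂.norm.measurable measurable_const))
  have hFU : ⋃ N, F N = E := by
    refine subset_antisymm (iUnion_subset fun N => inter_subset_left) fun t ht => ?_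
    obtain ⟨N, hN⟩ := exists_nat_ge (max ‖W₁ t‖ ‖W₂ t‖)
    exact mem_iUnion.2 ⟨N, ht, (le_max_left _ _).trans hN, (le_max_right _ _).trans hN⟩
  have hFmono : Monotone F := fun N N' h => by
    have h' : (N : ℝ) ≤ N' := by exact_mod_cast h
    refine inter_subset_inter_right _ (inter_subset_inter ?_ ?_) <;> intro t ht <;>
      rw [mem_ofPred_eq] at ht ⊢ <;> exact ht.trans h'
  have hFE : ∀ N, F N ⊆ E := fun N => inter_subset_left
  have hb₁ : ∀ N : ℕ, ∀ᵐ t ∂(volume.restrict (F N)), ‖W t‖ ≤ N := fun N => by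
    filter_upwards [ae_restrict_of_ae_restrict_of_subset (hFE N) hW.aestronglyMeasurable.ae_eq_mk,
      ae_restrict_mem (hFm N)] with t ht htF
    rw [ht]
    exact htF.2.1
  have hb₂ : ∀ N : ℕ, ∀ᵐ t ∂(volume.restrict (F N)), ‖(W t)⁻¹‖ ≤ N := fun N => by
    filter_upwards [ae_restrict_of_ae_restrict_of_subset (hFE N)
      hW.inv.aestronglyMeasurable.ae_eq_mk, ae_restrict_mem (hFm N)] with t ht htF
    rw [ht]
    exact htF.2.2
  set K : ℝ := 2 * Real.pi * C with hK
  have hK0 : 0 ≤ K := by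
    have := Real.pi_pos
    positivity
  refine lt_of_le_of_lt (?_ : A2Const E W ≤ ENNReal.ofReal K) ENNReal.ofReal_lt_top
  refine iSup₂_le fun x hx => iSup₂_le fun δ hδ => ?_
  have hvol : volume (Ioo (x - δ) (x + δ) ∩ E) ≠ 0 :=
    ((ENNReal.ofReal_pos.2 (mul_pos hη hδ.1)).trans_le (hfat δ hδ.1 hδ.2 x hx)).ne'
  have hi₁ : ∀ N, EntriesIntegrableOn W (Ioo (x - δ) (x + δ) ∩ F N) := fun N =>
    entriesIntegrableOn_of_bound (hW.mono (hFE N)) (hb₁ N) measure_Ioo_lt_top.ne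
  have hi₂ : ∀ N, EntriesIntegrableOn (fun t => (W t)⁻¹) (Ioo (x - δ) (x + δ) ∩ F N) := fun N =>
    entriesIntegrableOn_of_bound (hW.inv.mono (hFE N)) (hb₂ N) measure_Ioo_lt_top.ne
  have hform : ∀ N, FormBound K (avg (F N) W x δ) (avg (F N) (fun t => (W t)⁻¹) x δ) := fun N =>
    formBound_avg hEm (hFm N) (hFE N) hW hC hδ.1 (hb₁ N) (hb₂ N)
  have h₁ := entriesIntegrableOn_of_formBound hW hW.inv hδ.1 hvol hFU hFmono hi₁ hi₂ hform
  have h₂ := entriesIntegrableOn_of_formBound hW.inv hW hδ.1 hvol hFU hFmono hi₂ hi₁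
    fun N => (hform N).symm
  have hlim : FormBound K (avg E W x δ) (avg E (fun t => (W t)⁻¹) x δ) :=
    FormBound.of_tendsto (tendsto_clm_apply (tendsto_avg hFm hFU hFmono h₁))
      (tendsto_clm_apply (tendsto_avg hFm hFU hFmono h₂)) hform
  rw [if_pos ⟨h₁, h₂⟩, ← ofReal_norm]
  exact ENNReal.ofReal_le_ofReal (hlim.norm_sqrt_mul_sqrt_le hK0
    (posDef_avg hW hδ.1 h₁ hvol) (posDef_avg hW.inv hδ.1 h₂ hvol))

end Exhaustion

end MatrixA2

end

theorem theorem5p1 (n : ℕ) (E : Set ℝ) (hE : MatrixA2.IsHomogeneous E)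
    (hb : Bornology.IsBounded E) (W : ℝ → Matrix (Fin n) (Fin n) ℂ)
    (hW : MatrixA2.IsMatrixWeight E W) :
    MatrixA2.WeightedRieszBounded E W ↔ MatrixA2.A2Const E W < ⊤ :=
  ⟨MatrixA2.A2Const_lt_top_of_weightedRieszBounded hE hW,
    MatrixA2.weightedRieszBounded_of_A2Const_lt_top hE hb hW⟩
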